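/- **Setting (LFR, canonical LF with refinement sorts).** Let $a$, $c$, $s$ range over type, term and sort constants. The syntax, taken up to renaming of bound variables, is $$R ::= c\mid x\mid R\,N,\qquad N ::= R\mid \lambda x.N,\qquad P ::= a\mid P\,N,\qquad A,B ::= P\mid \Pi x{:}A.\,B,\qquad K ::= \mathsf{type}\mid \Pi x{:}A.\,K,$$ $$Q ::= s\mid Q\,N,\qquad S,T ::= Q\mid \Pi x{::}S{\sqsubset}A.\,T\mid \top\mid S_1\wedge S_2,\qquad L ::= \mathsf{sort}\mid \Pi x{::}S{\sqsubset}A.\,L\mid \top\mid L_1\wedge L_2 .$$ A signature $\Sigma$ is a list of declarations $a{:}K$, $c{:}A$, $s\sqsubset a::L$, $s_1\le s_2$, $c::S$. A context $\Gamma$ is a list of declarations $x::S\sqsubset A$ with distinct variables, and $\Gamma^*$ is the LF context obtained by replacing each $x::S\sqsubset A$ by $x{:}A$. A type erases to a simple type by $|a\,N_1\cdots N_k|=a$ and $|\Pi x{:}A.B|=|A|\to|B|$. The $\eta$-expansion is $\eta_a(R)=R$ and $\eta_{\alpha\to\beta}(R)=\lambda x.\,\eta_\beta(R\;\eta_\alpha(x))$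 with $x$ fresh, and $\eta_A:=\eta_{|A|}$. *Hereditary substitution* $[N_0/x_0]_{\alpha}$ (with $[N_0/x_0]_A:=[N_0/x_0]_{|A|}$) is the partial, capture-avoiding operation defined compositionally on all syntactic categories and on contexts, except on atomic terms with head $x_0$. On these it is defined through an auxiliary operation $[N_0/x_0]^{rn}_\alpha$ with values (normal term, simple type), given by $[N_0/x_0]^{rn}_{\alpha}x_0=(N_0,\alpha)$ and, if $[N_0/x_0]^{rn}_\alpha R_1=(\lambda x.N_1,\alpha_2\to\alpha_1)$, by $[N_0/x_0]^{rn}_\alpha(R_1\,N_2)=([N_2'/x]_{\alpha_2}N_1,\ \alpha_1)$ where $N_2'=[N_0/x_0]_\alpha N_2$. The value of $[N_0/x_0]_\alpha R$ is then $R'$ if $[N_0/x_0]^{rn}_\alpha R=(R',a)$ with $R'$ atomic and $a$ a base type. *Types.* The LF judgments $\Gamma^*\vdash R\Rightarrow A$, $\Gamma^*\vdash N\Leftarrow A$, $\Gamma^*\vdash P\Rightarrow K$, $\Gamma^*\vdash A:\mathsf{type}$ and $\vdash K:\mathsf{kind}$ are those of canonical-forms LF: variables and constants synthesize their declared types; if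 $R\Rightarrow\Pi x{:}A.B$ and $N\Leftarrow A$ then $R\,N\Rightarrow[N/x]_AB$; $R\Leftarrow P$ if $R\Rightarrow P$; $\lambda x.N\Leftarrow\Pi x{:}A.B$ if $N\Leftarrow B$ under $x{:}A$; and analogously for kinds. *Sorts.* $Q\le Q'$ is the reflexive-transitive closure of $s_1N_1\cdots N_k\le s_2N_1\cdots N_k$ for $s_1\le s_2\in\Sigma$. Synthesis $\Gamma\vdash R\Rightarrow S$: a variable or constant synthesizes its declared sort; if $R\Rightarrow\Pi x{::}S{\sqsubset}A.T$ and $N\Leftarrow S$ then $R\,N\Rightarrow[N/x]_AT$; if $R\Rightarrow S_1\wedge S_2$ then $R\Rightarrow S_1$ and $R\Rightarrow S_2$. Checking $\Gamma\vdash N\Leftarrow S$: $R\Leftarrow Q$ if $R\Rightarrow Q'$ and $Q'\le Q$; $\lambda x.N\Leftarrow\Pi x{::}S{\sqsubset}A.T$ if $\Gamma,x{::}S{\sqsubset}A\vdash N\Leftarrow T$; $N\Leftarrow\top$ always; $N\Leftarrow S_1\wedge S_2$ if $N\Leftarrow S_1$ and $N\Leftarrow S_2$. *Refinement.* $\Gamma\vdash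 Q\sqsubset P\Rightarrow L$: $s\sqsubset a\Rightarrow L$ if $s\sqsubset a::L\in\Sigma$; $Q\,N\sqsubset P\,N\Rightarrow[N/x]_AL$ if $Q\sqsubset P\Rightarrow\Pi x{::}S{\sqsubset}A.L$ and $N\Leftarrow S$; and $Q\sqsubset P\Rightarrow L_i$ if $Q\sqsubset P\Rightarrow L_1\wedge L_2$. $\Gamma\vdash S\sqsubset A$: $Q\sqsubset P$ if $Q\sqsubset P\Rightarrow\mathsf{sort}$; $\Pi x{::}S{\sqsubset}A.T\sqsubset\Pi x{:}A.B$ if $S\sqsubset A$ and $\Gamma,x{::}S{\sqsubset}A\vdash T\sqsubset B$; $\top\sqsubset A$ always; $S_1\wedge S_2\sqsubset A$ if $S_1\sqsubset A$ and $S_2\sqsubset A$. The relation $\Gamma\vdash L\sqsubset K$ is analogous, with $\mathsf{sort}\sqsubset\mathsf{type}$. *Well-formedness.* $\Sigma$ is well-formed if every declaration is well-formed over the preceding ones: $K$ is a kind for $a{:}K$; $A$ is a type for $c{:}A$; $L\sqsubset K$ with $a{:}K$ declared for $s\sqsubset a::L$; $S\sqsubset A$ with $c{:}A$ declared for $c::S$;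 $s_1,s_2$ declared with the same $a$ and $L$ for $s_1\le s_2$; and no constant gets two declarations of the same form $a{:}K$, $c{:}A$, $s\sqsubset a::L$ or $c::S$. $\Gamma$ is well-formed if every $x::S\sqsubset A$ in it satisfies $S\sqsubset A$ and $A:\mathsf{type}$ over the preceding part. *Convention (refinement restriction).* Below, $\Gamma\vdash S\sqsubset A$ includes $\Gamma^*\vdash A:\mathsf{type}$, all contexts are well-formed, and a sorting judgment is only asserted for a term that has a type which the sort refines: $\Gamma\vdash N\Leftarrow S$ includes $\Gamma\vdash S\sqsubset B$ and $\Gamma^*\vdash N\Leftarrow B$ for a type $B$ (and likewise for $\Gamma\vdash R\Rightarrow S$). For $S=S_1$ or $S_2$ in (1)–(3), and for the term $N_1$ in (5), the type is the given $A$. In (4) the type $B$ is the same in hypothesis and conclusion; in (5) the type of the conclusion is $[N_1/x]_AB$. In (1)–(3) the context $\Gamma$, and in (4)–(5) the context $\Gamma_L$, ranges over the well-formed contexts in which both $S_1\sqsubset A$ and $S_2\sqsubset A$ hold. The declared variable $x$ is arbitrary subject to being distinct from the other declared variables. **Theorem (Alternate Formulations of Subsorting).** Fix a well-formed signature $\Sigma$.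 Suppose that for some well-formed $\Gamma_0$, $\Gamma_0\vdash S_1\sqsubset A$ and $\Gamma_0\vdash S_2\sqsubset A$. Then the following are equivalent. 1. For all $\Gamma$ and $R$: if $\Gamma\vdash R\Rightarrow S_1$, then $\Gamma\vdash\eta_A(R)\Leftarrow S_2$. 2. For all $\Gamma$: $\Gamma,x::S_1\sqsubset A\vdash\eta_A(x)\Leftarrow S_2$. 3. For all $\Gamma$ and $N$: if $\Gamma\vdash N\Leftarrow S_1$, then $\Gamma\vdash N\Leftarrow S_2$. 4. For all $\Gamma_L,\Gamma_R,N,S$: if $\Gamma_L,x::S_2\sqsubset A,\Gamma_R\vdash N\Leftarrow S$, then $\Gamma_L,x::S_1\sqsubset A,\Gamma_R\vdash N\Leftarrow S$. 5. For all $\Gamma_L,\Gamma_R,N,S,N_1$: if $\Gamma_L,x::S_2\sqsubset A,\Gamma_R\vdash N\Leftarrow S$ and $\Gamma_L\vdash N_1\Leftarrow S_1$, then the hereditary substitutions $[N_1/x]_A$ into $\Gamma_R$, $N$ and $S$ are defined and $\Gamma_L,[N_1/x]_A\Gamma_R\vdash[N_1/x]_AN\Leftarrow[N_1/x]_AS$.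 -/

import Mathlib

namespace LFR

/-! # The logical framework LFR (LF with refinements), canonical forms presentation

Syntax is locally nameless: free variables carry names, bound variables are de Bruijn indices, so
that α-equivalence is equality.  Binder rules quantify over all names outside a finite set, which
is the usual "for a sufficiently fresh variable".  Contexts and signatures are lists whose head is
the most recent declaration. -/

/-- Names of free variables. -/
abbrev Var := ℕ
/-- Type family constants `a`. -/
abbrev TyCon := ℕ
/-- Term constants `c`. -/
abbrev TmCon := ℕ
/-- Sort family constants `s`. -/
abbrev SrtCon := ℕ

/-! ## Grammar -/

mutual
/-- Atomic terms `R ::= c | x | R N`. -/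
inductive Atm : Type
  | con (c : TmCon) : Atm
  | fvar (x : Var) : Atm
  | bvar (i : ℕ) : Atm
  | app (R : Atm) (N : Nrm) : Atm
/-- Normal terms `N ::= R | λx.N`. -/
inductive Nrm : Type
  | atm (R : Atm) : Nrm
  | lam (N : Nrm) : Nrm
end

/-- Atomic type families `P ::= a | P N`. -/
inductive ATy : Type
  | con (a : TyCon) : ATy
  | app (P : ATy) (N : Nrm) : ATy

/-- Normal type families `A ::= P | Πx:A.B`. -/
inductive Ty : Type
  | atm (P : ATy) : Ty
  | pi (A B : Ty) : Ty

/-- Atomic sort families `Q ::= s | Q N`. -/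
inductive ASrt : Type
  | con (s : SrtCon) : ASrt
  | app (Q : ASrt) (N : Nrm) : ASrt

/-- Normal sort families `S ::= Q | Πx::S⊏A.T | ⊤ | S₁ ∧ S₂`. -/
inductive Srt : Type
  | atm (Q : ASrt) : Srt
  | pi (S : Srt) (A : Ty) (T : Srt) : Srt
  | top : Srt
  | inter (S₁ S₂ : Srt) : Srt

/-- Kinds `K ::= type | Πx:A.K`. -/
inductive Knd : Type
  | type : Knd
  | pi (A : Ty) (K : Knd) : Knd

/-- Classes `L ::= sort | Πx::S⊏A.L | ⊤ | L₁ ∧ L₂`. -/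
inductive Cls : Type
  | sort : Cls
  | pi (S : Srt) (A : Ty) (L : Cls) : Cls
  | top : Cls
  | inter (L₁ L₂ : Cls) : Cls

/-- Simple types `α ::= a | α₁ → α₂`. -/
inductive STy : Type
  | base (a : TyCon) : STy
  | arr (α β : STy) : STy

/-- Signature declarations `a:K`, `c:A`, `s⊏a::L`, `s₁≤s₂`, `c::S`. -/
inductive Decl : Type
  | tyKind (a : TyCon) (K : Knd) : Decl
  | tmType (c : TmCon) (A : Ty) : Decl
  | srtRef (s : SrtCon) (a : TyCon) (L : Cls) : Decl
  | subsort (s₁ s₂ : SrtCon) : Decl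
  | tmSort (c : TmCon) (S : Srt) : Decl

/-- Signatures. -/
abbrev Sig := List Decl

/-- LFR contexts, with declarations `x::S⊏A`. -/
abbrev Ctx := List (Var × Srt × Ty)

/-- LF contexts, with declarations `x:A`. -/
abbrev LFCtx := List (Var × Ty)

/-- The erasure `Γ*` of an LFR context to an LF context. -/
def Ctx.erase (Γ : Ctx) : LFCtx := Γ.map fun d => (d.1, d.2.2)

/-- The names declared in a context. -/
def Ctx.dom (Γ : Ctx) : List Var := Γ.map fun d => d.1

/-! ## Opening a binder with a named variable -/

mutual
/-- Replace the bound variable with index `k` by the free variable `x`. -/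
def Atm.opn (k : ℕ) (x : Var) : Atm → Atm
  | .con c => .con c
  | .fvar y => .fvar y
  | .bvar i => if i = k then .fvar x else .bvar i
  | .app R N => .app (R.opn k x) (N.opn k x)
/-- Replace the bound variable with index `k` by the free variable `x`. -/
def Nrm.opn (k : ℕ) (x : Var) : Nrm → Nrm
  | .atm R => .atm (R.opn k x)
  | .lam N => .lam (N.opn (k + 1) x)
end

def ATy.opn (k : ℕ) (x : Var) : ATy → ATy
  | .con a => .con a
  | .app P N => .app (P.opn k x) (N.opn k x)

def Ty.opn (k : ℕ) (x : Var) : Ty → Ty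
  | .atm P => .atm (P.opn k x)
  | .pi A B => .pi (A.opn k x) (B.opn (k + 1) x)

def ASrt.opn (k : ℕ) (x : Var) : ASrt → ASrt
  | .con s => .con s
  | .app Q N => .app (Q.opn k x) (N.opn k x)

def Srt.opn (k : ℕ) (x : Var) : Srt → Srt
  | .atm Q => .atm (Q.opn k x)
  | .pi S A T => .pi (S.opn k x) (A.opn k x) (T.opn (k + 1) x)
  | .top => .top
  | .inter S₁ S₂ => .inter (S₁.opn k x) (S₂.opn k x)

def Knd.opn (k : ℕ) (x : Var) : Knd → Knd
  | .type => .type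
  | .pi A K => .pi (A.opn k x) (K.opn (k + 1) x)

def Cls.opn (k : ℕ) (x : Var) : Cls → Cls
  | .sort => .sort
  | .pi S A L => .pi (S.opn k x) (A.opn k x) (L.opn (k + 1) x)
  | .top => .top
  | .inter L₁ L₂ => .inter (L₁.opn k x) (L₂.opn k x)

/-! ## Erasure to simple types and η-expansion -/

/-- `|P|` is the head constant of `P`. -/
def ATy.simple : ATy → STy
  | .con a => .base a
  | .app P _ => P.simple

/-- `|Πx:A.B| = |A| → |B|`. -/
def Ty.simple : Ty → STy
  | .atm P => P.simple
  | .pi A B => .arr A.simple B.simple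

mutual
/-- Increment the bound variables with index at least `k`; the identity on terms without
dangling indices. -/
def Atm.shift (k : ℕ) : Atm → Atm
  | .con c => .con c
  | .fvar y => .fvar y
  | .bvar i => if i < k then .bvar i else .bvar (i + 1)
  | .app R N => .app (R.shift k) (N.shift k)
/-- Increment the bound variables with index at least `k`. -/
def Nrm.shift (k : ℕ) : Nrm → Nrm
  | .atm R => .atm (R.shift k)
  | .lam N => .lam (N.shift (k + 1))
end

/-- η-expansion: `η_a(R) = R` and `η_{α→β}(R) = λx. η_β(R η_α(x))`. -/
def expand : STy → Atm → Nrm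
  | .base _, R => .atm R
  | .arr α β, R => .lam (expand β (.app (R.shift 0) (expand α (.bvar 0))))

/-! ## Hereditary substitution

A partial operation `[N₀/x₀]_{α₀}`, given as a relation between input and output. -/

mutual
/-- `[N₀/x₀]ⁿ_{α₀} N = Nr`. -/
inductive SubstN : Nrm → Var → STy → Nrm → Nrm → Prop
  | atom {N₀ x₀ α₀ R Rr} :
      SubstRR N₀ x₀ α₀ R Rr → SubstN N₀ x₀ α₀ (.atm R) (.atm Rr)
  | atomNorm {N₀ x₀ α₀ R Rr a} :
      SubstRN N₀ x₀ α₀ R (.atm Rr) (.base a) → SubstN N₀ x₀ α₀ (.atm R) (.atm Rr)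
  | lam {N₀ x₀ α₀ N Nr} (F : Finset Var) :
      (∀ y, y ∉ F → SubstN N₀ x₀ α₀ (N.opn 0 y) (Nr.opn 0 y)) →
      SubstN N₀ x₀ α₀ (.lam N) (.lam Nr)
/-- `[N₀/x₀]^{rr}_{α₀} R = Rr`. -/
inductive SubstRR : Nrm → Var → STy → Atm → Atm → Prop
  | var {N₀ x₀ α₀ x} : x ≠ x₀ → SubstRR N₀ x₀ α₀ (.fvar x) (.fvar x)
  | con {N₀ x₀ α₀ c} : SubstRR N₀ x₀ α₀ (.con c) (.con c)
  | app {N₀ x₀ α₀ R Rr N Nr} :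
      SubstRR N₀ x₀ α₀ R Rr → SubstN N₀ x₀ α₀ N Nr →
      SubstRR N₀ x₀ α₀ (.app R N) (.app Rr Nr)
/-- `[N₀/x₀]^{rn}_{α₀} R = (Nr, αr)`. -/
inductive SubstRN : Nrm → Var → STy → Atm → Nrm → STy → Prop
  | var {N₀ x₀ α₀} : SubstRN N₀ x₀ α₀ (.fvar x₀) N₀ α₀
  | beta {N₀ x₀ α₀ R₁ N₂ N₁ N₂' N₁' α₁ α₂} (F : Finset Var) :
      SubstRN N₀ x₀ α₀ R₁ (.lam N₁) (.arr α₂ α₁) →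
      SubstN N₀ x₀ α₀ N₂ N₂' →
      (∀ x, x ∉ F → SubstN N₂' x α₂ (N₁.opn 0 x) N₁') →
      SubstRN N₀ x₀ α₀ (.app R₁ N₂) N₁' α₁
end

/-- Substitution into atomic types. -/
inductive SubstP (N₀ : Nrm) (x₀ : Var) (α₀ : STy) : ATy → ATy → Prop
  | con {a} : SubstP N₀ x₀ α₀ (.con a) (.con a)
  | app {P Pr N Nr} : SubstP N₀ x₀ α₀ P Pr → SubstN N₀ x₀ α₀ N Nr →
      SubstP N₀ x₀ α₀ (.app P N) (.app Pr Nr)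

/-- Substitution into normal types. -/
inductive SubstA (N₀ : Nrm) (x₀ : Var) (α₀ : STy) : Ty → Ty → Prop
  | atm {P Pr} : SubstP N₀ x₀ α₀ P Pr → SubstA N₀ x₀ α₀ (.atm P) (.atm Pr)
  | pi {A Ar B Br} (F : Finset Var) : SubstA N₀ x₀ α₀ A Ar →
      (∀ y, y ∉ F → SubstA N₀ x₀ α₀ (B.opn 0 y) (Br.opn 0 y)) →
      SubstA N₀ x₀ α₀ (.pi A B) (.pi Ar Br)

/-- Substitution into atomic sorts. -/
inductive SubstQ (N₀ : Nrm) (x₀ : Var) (α₀ : STy) : ASrt → ASrt → Prop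
  | con {s} : SubstQ N₀ x₀ α₀ (.con s) (.con s)
  | app {Q Qr N Nr} : SubstQ N₀ x₀ α₀ Q Qr → SubstN N₀ x₀ α₀ N Nr →
      SubstQ N₀ x₀ α₀ (.app Q N) (.app Qr Nr)

/-- Substitution into normal sorts. -/
inductive SubstS (N₀ : Nrm) (x₀ : Var) (α₀ : STy) : Srt → Srt → Prop
  | atm {Q Qr} : SubstQ N₀ x₀ α₀ Q Qr → SubstS N₀ x₀ α₀ (.atm Q) (.atm Qr)
  | pi {S Sr A Ar T Tr} (F : Finset Var) :
      SubstS N₀ x₀ α₀ S Sr → SubstA N₀ x₀ α₀ A Ar →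
      (∀ y, y ∉ F → SubstS N₀ x₀ α₀ (T.opn 0 y) (Tr.opn 0 y)) →
      SubstS N₀ x₀ α₀ (.pi S A T) (.pi Sr Ar Tr)
  | top : SubstS N₀ x₀ α₀ .top .top
  | inter {S₁ S₁' S₂ S₂'} : SubstS N₀ x₀ α₀ S₁ S₁' → SubstS N₀ x₀ α₀ S₂ S₂' →
      SubstS N₀ x₀ α₀ (.inter S₁ S₂) (.inter S₁' S₂')

/-- Substitution into kinds. -/
inductive SubstK (N₀ : Nrm) (x₀ : Var) (α₀ : STy) : Knd → Knd → Prop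
  | type : SubstK N₀ x₀ α₀ .type .type
  | pi {A Ar K Kr} (F : Finset Var) : SubstA N₀ x₀ α₀ A Ar →
      (∀ y, y ∉ F → SubstK N₀ x₀ α₀ (K.opn 0 y) (Kr.opn 0 y)) →
      SubstK N₀ x₀ α₀ (.pi A K) (.pi Ar Kr)

/-- Substitution into classes. -/
inductive SubstL (N₀ : Nrm) (x₀ : Var) (α₀ : STy) : Cls → Cls → Prop
  | sort : SubstL N₀ x₀ α₀ .sort .sort
  | pi {S Sr A Ar L Lr} (F : Finset Var) :
      SubstS N₀ x₀ α₀ S Sr → SubstA N₀ x₀ α₀ A Ar →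
      (∀ y, y ∉ F → SubstL N₀ x₀ α₀ (L.opn 0 y) (Lr.opn 0 y)) →
      SubstL N₀ x₀ α₀ (.pi S A L) (.pi Sr Ar Lr)
  | top : SubstL N₀ x₀ α₀ .top .top
  | inter {L₁ L₁' L₂ L₂'} : SubstL N₀ x₀ α₀ L₁ L₁' → SubstL N₀ x₀ α₀ L₂ L₂' →
      SubstL N₀ x₀ α₀ (.inter L₁ L₂) (.inter L₁' L₂')

/-- Substitution into contexts. -/
inductive SubstCtx (N₀ : Nrm) (x₀ : Var) (α₀ : STy) : Ctx → Ctx → Prop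
  | nil : SubstCtx N₀ x₀ α₀ [] []
  | cons {Γ Γr y S Sr A Ar} : SubstCtx N₀ x₀ α₀ Γ Γr →
      SubstS N₀ x₀ α₀ S Sr → SubstA N₀ x₀ α₀ A Ar →
      SubstCtx N₀ x₀ α₀ ((y, S, A) :: Γ) ((y, Sr, Ar) :: Γr)

/-! ## Canonical LF

These judgments consult only the declarations `a:K` and `c:A` of the signature, that is, the
erasure of the signature to an LF signature. -/

mutual
/-- `Γ ⊢ R ⇒ A`: the atomic term `R` synthesizes the type `A`. -/
inductive SynthTy (Sg : Sig) : LFCtx → Atm → Ty → Prop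
  | con {Γ c A} : Decl.tmType c A ∈ Sg → SynthTy Sg Γ (.con c) A
  | var {Γ x A} : (x, A) ∈ Γ → SynthTy Sg Γ (.fvar x) A
  | app {Γ R N A B Br} (F : Finset Var) :
      SynthTy Sg Γ R (.pi A B) → CheckTy Sg Γ N A →
      (∀ x, x ∉ F → SubstA N x A.simple (B.opn 0 x) Br) →
      SynthTy Sg Γ (.app R N) Br
/-- `Γ ⊢ N ⇐ A`: the normal term `N` checks against the type `A`. -/
inductive CheckTy (Sg : Sig) : LFCtx → Nrm → Ty → Prop
  | atm {Γ R P} : SynthTy Sg Γ R (.atm P) → CheckTy Sg Γ (.atm R) (.atm P)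
  | lam {Γ N A B} (F : Finset Var) :
      (∀ x, x ∉ F → CheckTy Sg ((x, A) :: Γ) (N.opn 0 x) (B.opn 0 x)) →
      CheckTy Sg Γ (.lam N) (.pi A B)
end

/-- `Γ ⊢ P ⇒ K`: the atomic type family `P` synthesizes the kind `K`. -/
inductive SynthKnd (Sg : Sig) (Γ : LFCtx) : ATy → Knd → Prop
  | con {a K} : Decl.tyKind a K ∈ Sg → SynthKnd Sg Γ (.con a) K
  | app {P N A K Kr} (F : Finset Var) :
      SynthKnd Sg Γ P (.pi A K) → CheckTy Sg Γ N A →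
      (∀ x, x ∉ F → SubstK N x A.simple (K.opn 0 x) Kr) →
      SynthKnd Sg Γ (.app P N) Kr

/-- `Γ ⊢ A : type`. -/
inductive IsType (Sg : Sig) : LFCtx → Ty → Prop
  | atm {Γ P} : SynthKnd Sg Γ P .type → IsType Sg Γ (.atm P)
  | pi {Γ A B} (F : Finset Var) : IsType Sg Γ A →
      (∀ x, x ∉ F → IsType Sg ((x, A) :: Γ) (B.opn 0 x)) →
      IsType Sg Γ (.pi A B)

/-- `Γ ⊢ K : kind`. -/
inductive IsKnd (Sg : Sig) : LFCtx → Knd → Prop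
  | type {Γ} : IsKnd Sg Γ .type
  | pi {Γ A K} (F : Finset Var) : IsType Sg Γ A →
      (∀ x, x ∉ F → IsKnd Sg ((x, A) :: Γ) (K.opn 0 x)) →
      IsKnd Sg Γ (.pi A K)

/-! ## Sorting -/

/-- A declared subsorting `s₁ ≤ s₂` applied to a common spine of arguments. -/
inductive SubDecl (Sg : Sig) : ASrt → ASrt → Prop
  | con {s₁ s₂} : Decl.subsort s₁ s₂ ∈ Sg → SubDecl Sg (.con s₁) (.con s₂)
  | app {Q₁ Q₂ N} : SubDecl Sg Q₁ Q₂ → SubDecl Sg (.app Q₁ N) (.app Q₂ N)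

/-- Subsorting `Q₁ ≤ Q₂` at atomic sorts. -/
inductive Subsort (Sg : Sig) : ASrt → ASrt → Prop
  | refl {Q} : Subsort Sg Q Q
  | step {Q₁ Qr Q₂} : SubDecl Sg Q₁ Qr → Subsort Sg Qr Q₂ → Subsort Sg Q₁ Q₂

mutual
/-- `Γ ⊢ R ⇒ S`: the atomic term `R` synthesizes the sort `S`. -/
inductive Synth (Sg : Sig) : Ctx → Atm → Srt → Prop
  | con {Γ c S} : Decl.tmSort c S ∈ Sg → Synth Sg Γ (.con c) S
  | var {Γ x S A} : (x, S, A) ∈ Γ → Synth Sg Γ (.fvar x) S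
  | app {Γ R N S A T Tr} (F : Finset Var) :
      Synth Sg Γ R (.pi S A T) → Check Sg Γ N S →
      (∀ x, x ∉ F → SubstS N x A.simple (T.opn 0 x) Tr) →
      Synth Sg Γ (.app R N) Tr
  | interL {Γ R S₁ S₂} : Synth Sg Γ R (.inter S₁ S₂) → Synth Sg Γ R S₁
  | interR {Γ R S₁ S₂} : Synth Sg Γ R (.inter S₁ S₂) → Synth Sg Γ R S₂
/-- `Γ ⊢ N ⇐ S`: the normal term `N` checks against the sort `S`. -/
inductive Check (Sg : Sig) : Ctx → Nrm → Srt → Prop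
  | switch {Γ R Q Qr} : Synth Sg Γ R (.atm Qr) → Subsort Sg Qr Q →
      Check Sg Γ (.atm R) (.atm Q)
  | lam {Γ N S A T} (F : Finset Var) :
      (∀ x, x ∉ F → Check Sg ((x, S, A) :: Γ) (N.opn 0 x) (T.opn 0 x)) →
      Check Sg Γ (.lam N) (.pi S A T)
  | top {Γ N} : Check Sg Γ N .top
  | inter {Γ N S₁ S₂} : Check Sg Γ N S₁ → Check Sg Γ N S₂ → Check Sg Γ N (.inter S₁ S₂)
end

/-- `Γ ⊢ Q ⊏ P ⇒ L`: the atomic sort `Q` refines `P` and synthesizes the class `L`. -/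
inductive SynthCls (Sg : Sig) (Γ : Ctx) : ASrt → ATy → Cls → Prop
  | con {s a L} : Decl.srtRef s a L ∈ Sg → SynthCls Sg Γ (.con s) (.con a) L
  | app {Q P N S A L Lr} (F : Finset Var) :
      SynthCls Sg Γ Q P (.pi S A L) → Check Sg Γ N S →
      (∀ x, x ∉ F → SubstL N x A.simple (L.opn 0 x) Lr) →
      SynthCls Sg Γ (.app Q N) (.app P N) Lr
  | interL {Q P L₁ L₂} : SynthCls Sg Γ Q P (.inter L₁ L₂) → SynthCls Sg Γ Q P L₁
  | interR {Q P L₁ L₂} : SynthCls Sg Γ Q P (.inter L₁ L₂) → SynthCls Sg Γ Q P L₂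

/-- `Γ ⊢ S ⊏ A`: the sort `S` refines the type `A`. -/
inductive Refines (Sg : Sig) : Ctx → Srt → Ty → Prop
  | atm {Γ Q P} : SynthCls Sg Γ Q P .sort → Refines Sg Γ (.atm Q) (.atm P)
  | pi {Γ S A T B} (F : Finset Var) : Refines Sg Γ S A →
      (∀ x, x ∉ F → Refines Sg ((x, S, A) :: Γ) (T.opn 0 x) (B.opn 0 x)) →
      Refines Sg Γ (.pi S A T) (.pi A B)
  | top {Γ A} : Refines Sg Γ .top A
  | inter {Γ S₁ S₂ A} : Refines Sg Γ S₁ A → Refines Sg Γ S₂ A →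
      Refines Sg Γ (.inter S₁ S₂) A

/-- `Γ ⊢ L ⊏ K`: the class `L` refines the kind `K`. -/
inductive RefinesCls (Sg : Sig) : Ctx → Cls → Knd → Prop
  | sort {Γ} : RefinesCls Sg Γ .sort .type
  | pi {Γ S A L K} (F : Finset Var) : Refines Sg Γ S A →
      (∀ x, x ∉ F → RefinesCls Sg ((x, S, A) :: Γ) (L.opn 0 x) (K.opn 0 x)) →
      RefinesCls Sg Γ (.pi S A L) (.pi A K)
  | top {Γ K} : RefinesCls Sg Γ .top K
  | inter {Γ L₁ L₂ K} : RefinesCls Sg Γ L₁ K → RefinesCls Sg Γ L₂ K →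
      RefinesCls Sg Γ (.inter L₁ L₂) K

/-! ## Well-formed signatures and contexts -/

/-- `⊢ Σ sig`. -/
inductive WfSig : Sig → Prop
  | nil : WfSig []
  | tyKind {Sg a K} : WfSig Sg → IsKnd Sg [] K → (∀ Kr, Decl.tyKind a Kr ∉ Sg) →
      WfSig (.tyKind a K :: Sg)
  | tmType {Sg c A} : WfSig Sg → IsType Sg [] A → (∀ Ar, Decl.tmType c Ar ∉ Sg) →
      WfSig (.tmType c A :: Sg)
  | srtRef {Sg s a L K} : WfSig Sg → Decl.tyKind a K ∈ Sg → RefinesCls Sg [] L K →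
      (∀ a' Lr, Decl.srtRef s a' Lr ∉ Sg) → WfSig (.srtRef s a L :: Sg)
  | tmSort {Sg c S A} : WfSig Sg → Decl.tmType c A ∈ Sg → Refines Sg [] S A →
      (∀ Sr, Decl.tmSort c Sr ∉ Sg) → WfSig (.tmSort c S :: Sg)
  | subsort {Sg s₁ s₂ a L} : WfSig Sg → Decl.srtRef s₁ a L ∈ Sg → Decl.srtRef s₂ a L ∈ Sg →
      WfSig (.subsort s₁ s₂ :: Sg)

/-- A sort `S` refining a well-formed type `A`: `Γ* ⊢ A : type` and `Γ ⊢ S ⊏ A`. -/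
def RefinesTy (Sg : Sig) (Γ : Ctx) (S : Srt) (A : Ty) : Prop :=
  IsType Sg Γ.erase A ∧ Refines Sg Γ S A

/-- `⊢ Γ ctx`: the declared names are distinct and every declared sort refines its type, which is
itself well-formed. -/
inductive WfCtx (Sg : Sig) : Ctx → Prop
  | nil : WfCtx Sg []
  | cons {Γ x S A} : WfCtx Sg Γ → x ∉ Γ.dom → RefinesTy Sg Γ S A → WfCtx Sg ((x, S, A) :: Γ)

/-! ## Judgments under the refinement restriction

A term is sort-checked only in a well-formed context, only if it is already well-typed, and only at
sorts that refine its type. -/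

/-- `Γ ⊢ R ⇒ S` with its presuppositions: `Γ` is well-formed, `S` refines the well-formed type `A`,
and `R` synthesizes `A`. -/
structure SynthAt (Sg : Sig) (Γ : Ctx) (R : Atm) (S : Srt) (A : Ty) : Prop where
  ctx : WfCtx Sg Γ
  refines : RefinesTy Sg Γ S A
  typed : SynthTy Sg Γ.erase R A
  sorted : Synth Sg Γ R S

/-- `Γ ⊢ N ⇐ S` with its presuppositions: `Γ` is well-formed, `S` refines the well-formed type `A`,
and `N` checks against `A`. -/
structure CheckAt (Sg : Sig) (Γ : Ctx) (N : Nrm) (S : Srt) (A : Ty) : Prop where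
  ctx : WfCtx Sg Γ
  refines : RefinesTy Sg Γ S A
  typed : CheckTy Sg Γ.erase N A
  sorted : Check Sg Γ N S

/-! ## Five formulations of subsorting between two refinements of `A`

Contexts range over those in which both sorts refine `A`. -/

/-- `Γ` is well-formed and both `S₁` and `S₂` refine the well-formed type `A` in `Γ`. -/
structure BothRefine (Sg : Sig) (Γ : Ctx) (S₁ S₂ : Srt) (A : Ty) : Prop where
  ctx : WfCtx Sg Γ
  left : RefinesTy Sg Γ S₁ A
  right : RefinesTy Sg Γ S₂ A

/-- η-expansions of terms synthesizing `S₁` check against `S₂`. -/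
def SubExpansion (Sg : Sig) (A : Ty) (S₁ S₂ : Srt) : Prop :=
  ∀ (Γ : Ctx) (R : Atm), BothRefine Sg Γ S₁ S₂ A →
    SynthAt Sg Γ R S₁ A → CheckAt Sg Γ (expand A.simple R) S₂ A

/-- The η-expansion of a variable of sort `S₁` checks against `S₂`. -/
def SubIdentity (Sg : Sig) (A : Ty) (S₁ S₂ : Srt) : Prop :=
  ∀ (Γ : Ctx) (x : Var), BothRefine Sg Γ S₁ S₂ A → x ∉ Γ.dom →
    CheckAt Sg ((x, S₁, A) :: Γ) (expand A.simple (.fvar x)) S₂ A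

/-- Every term that checks against `S₁` checks against `S₂`. -/
def SubSubsumption (Sg : Sig) (A : Ty) (S₁ S₂ : Srt) : Prop :=
  ∀ (Γ : Ctx) (N : Nrm), BothRefine Sg Γ S₁ S₂ A →
    CheckAt Sg Γ N S₁ A → CheckAt Sg Γ N S₂ A

/-- A variable of sort `S₂` in the context may be given the sort `S₁` instead. -/
def SubNarrowing (Sg : Sig) (A : Ty) (S₁ S₂ : Srt) : Prop :=
  ∀ (ΓL ΓR : Ctx) (x : Var) (N : Nrm) (S : Srt) (B : Ty), BothRefine Sg ΓL S₁ S₂ A →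
    CheckAt Sg (ΓR ++ (x, S₂, A) :: ΓL) N S B →
    CheckAt Sg (ΓR ++ (x, S₁, A) :: ΓL) N S B

/-- Terms of sort `S₁` may be substituted for variables of sort `S₂`; in particular all the
hereditary substitutions involved are defined. -/
def SubSubstitution (Sg : Sig) (A : Ty) (S₁ S₂ : Srt) : Prop :=
  ∀ (ΓL ΓR : Ctx) (x : Var) (N : Nrm) (S : Srt) (B : Ty) (N₁ : Nrm),
    BothRefine Sg ΓL S₁ S₂ A →
    CheckAt Sg (ΓR ++ (x, S₂, A) :: ΓL) N S B →
    CheckAt Sg ΓL N₁ S₁ A →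
    ∃ (ΓRr : Ctx) (Nr : Nrm) (Sr : Srt) (Br : Ty),
      SubstCtx N₁ x A.simple ΓR ΓRr ∧ SubstN N₁ x A.simple N Nr ∧
      SubstS N₁ x A.simple S Sr ∧ SubstA N₁ x A.simple B Br ∧
      CheckAt Sg (ΓRr ++ ΓL) Nr Sr Br

end LFR

namespace LFR

/-! ## Free variables, local closure and renaming -/

-- Two metatheorems carry the equivalence. The substitution theorem `CheckAt.subst` says that a term
-- of sort `S` may be hereditarily substituted for a variable of sort `S`, with everything involved
-- defined. The identity theorem `SynthAt.expand` says that η-expanding a term that synthesizes `S`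
-- yields one that checks against `S`. Two equations tie them together, valid whenever the
-- substitution is defined: `[N/x]η(x) = N` (`SubstN.eq_of_expand_fvar`), and `[η(x)/y]` renames `y`
-- to `x` (`expandRenames`).
--
-- Granting these, 1 gives 2 with `R = x`, and 2 gives 3 by substituting `N` for `x` in `η(x)`. From
-- 3, 1 follows by expanding `R` at `S₁`, and 5 by moving `N₁` from `S₁` to `S₂` and substituting. 3
-- gives 4 because `η(x)`, for `x` of sort `S₁`, has sort `S₂` and can be substituted for `x`
-- itself, which changes nothing. Conversely 4 gives 2 and 5 gives 3 on taking for `N` the term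
-- `η(x)` with `x` of sort `S₂`.
--
-- The substitution theorem is proved by induction on the simple type of the substitution, then on
-- the derivation. If the head of a term is the substituted variable, a β step starts another
-- substitution at the domain of an arrow type no larger than the original one (`SubstRN.size_le`),
-- hence at a strictly smaller type. Since the type of an application is itself a substitution
-- instance, substitutions must commute: `[N₀/x₀][N₂/x]B = [[N₀/x₀]N₂/x][N₀/x₀]B`, with `substComm`
-- as the core. Definedness comes from typing alone (`checkTySubst`); sorting is only transported
-- along substitutions already known to be defined (`checkSubst`), because `⊤` accepts every term
-- and so a sorting derivation does not guarantee definedness. The refinement restriction supplies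
-- the typing.
--
-- Substitution is a relation, so uniqueness (`SubstN.det`) is needed throughout. Binder rules
-- quantify over almost all names; equivariance under permutations of names allows working with one
-- fresh name.

mutual
/-- The free variables of an atomic term. -/
def Atm.fv : Atm → Finset Var
  | .con _ => ∅
  | .fvar x => {x}
  | .bvar _ => ∅
  | .app R N => R.fv ∪ N.fv
/-- The free variables of a normal term. -/
def Nrm.fv : Nrm → Finset Var
  | .atm R => R.fv
  | .lam N => N.fv
end

def ATy.fv : ATy → Finset Var
  | .con _ => ∅
  | .app P N => P.fv ∪ N.fv

def Ty.fv : Ty → Finset Var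
  | .atm P => P.fv
  | .pi A B => A.fv ∪ B.fv

def ASrt.fv : ASrt → Finset Var
  | .con _ => ∅
  | .app Q N => Q.fv ∪ N.fv

def Srt.fv : Srt → Finset Var
  | .atm Q => Q.fv
  | .pi S A T => S.fv ∪ A.fv ∪ T.fv
  | .top => ∅
  | .inter S₁ S₂ => S₁.fv ∪ S₂.fv

def Knd.fv : Knd → Finset Var
  | .type => ∅
  | .pi A K => A.fv ∪ K.fv

def Cls.fv : Cls → Finset Var
  | .sort => ∅
  | .pi S A L => S.fv ∪ A.fv ∪ L.fv
  | .top => ∅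
  | .inter L₁ L₂ => L₁.fv ∪ L₂.fv

mutual
/-- All dangling indices are less than `k`. -/
def Atm.LcAt (k : ℕ) : Atm → Prop
  | .con _ => True
  | .fvar _ => True
  | .bvar i => i < k
  | .app R N => R.LcAt k ∧ N.LcAt k
/-- All dangling indices are less than `k`. -/
def Nrm.LcAt (k : ℕ) : Nrm → Prop
  | .atm R => R.LcAt k
  | .lam N => N.LcAt (k + 1)
end

def ATy.LcAt (k : ℕ) : ATy → Prop
  | .con _ => True
  | .app P N => P.LcAt k ∧ N.LcAt k

def Ty.LcAt (k : ℕ) : Ty → Prop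
  | .atm P => P.LcAt k
  | .pi A B => A.LcAt k ∧ B.LcAt (k + 1)

def ASrt.LcAt (k : ℕ) : ASrt → Prop
  | .con _ => True
  | .app Q N => Q.LcAt k ∧ N.LcAt k

def Srt.LcAt (k : ℕ) : Srt → Prop
  | .atm Q => Q.LcAt k
  | .pi S A T => S.LcAt k ∧ A.LcAt k ∧ T.LcAt (k + 1)
  | .top => True
  | .inter S₁ S₂ => S₁.LcAt k ∧ S₂.LcAt k

def Knd.LcAt (k : ℕ) : Knd → Prop
  | .type => True
  | .pi A K => A.LcAt k ∧ K.LcAt (k + 1)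

def Cls.LcAt (k : ℕ) : Cls → Prop
  | .sort => True
  | .pi S A L => S.LcAt k ∧ A.LcAt k ∧ L.LcAt (k + 1)
  | .top => True
  | .inter L₁ L₂ => L₁.LcAt k ∧ L₂.LcAt k

mutual
/-- Apply `ρ` to all free variables. -/
def Atm.ren (ρ : Var → Var) : Atm → Atm
  | .con c => .con c
  | .fvar x => .fvar (ρ x)
  | .bvar i => .bvar i
  | .app R N => .app (R.ren ρ) (N.ren ρ)
/-- Apply `ρ` to all free variables. -/
def Nrm.ren (ρ : Var → Var) : Nrm → Nrm
  | .atm R => .atm (R.ren ρ)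
  | .lam N => .lam (N.ren ρ)
end

def ATy.ren (ρ : Var → Var) : ATy → ATy
  | .con a => .con a
  | .app P N => .app (P.ren ρ) (N.ren ρ)

def Ty.ren (ρ : Var → Var) : Ty → Ty
  | .atm P => .atm (P.ren ρ)
  | .pi A B => .pi (A.ren ρ) (B.ren ρ)

def ASrt.ren (ρ : Var → Var) : ASrt → ASrt
  | .con s => .con s
  | .app Q N => .app (Q.ren ρ) (N.ren ρ)

def Srt.ren (ρ : Var → Var) : Srt → Srt
  | .atm Q => .atm (Q.ren ρ)
  | .pi S A T => .pi (S.ren ρ) (A.ren ρ) (T.ren ρ)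
  | .top => .top
  | .inter S₁ S₂ => .inter (S₁.ren ρ) (S₂.ren ρ)

def Knd.ren (ρ : Var → Var) : Knd → Knd
  | .type => .type
  | .pi A K => .pi (A.ren ρ) (K.ren ρ)

def Cls.ren (ρ : Var → Var) : Cls → Cls
  | .sort => .sort
  | .pi S A L => .pi (S.ren ρ) (A.ren ρ) (L.ren ρ)
  | .top => .top
  | .inter L₁ L₂ => .inter (L₁.ren ρ) (L₂.ren ρ)

attribute [simp] Atm.fv Nrm.fv ATy.fv Ty.fv ASrt.fv Srt.fv Knd.fv Cls.fv
  Atm.LcAt Nrm.LcAt ATy.LcAt Ty.LcAt ASrt.LcAt Srt.LcAt Knd.LcAt Cls.LcAt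
  Atm.ren Nrm.ren ATy.ren Ty.ren ASrt.ren Srt.ren Knd.ren Cls.ren
  Atm.opn Nrm.opn ATy.opn Ty.opn ASrt.opn Srt.opn Knd.opn Cls.opn
  Atm.shift Nrm.shift ATy.simple Ty.simple

/-! ### Opening a term without the opened index -/

mutual
theorem Atm.opn_of_lcAt {k j x} : ∀ {R : Atm}, R.LcAt j → j ≤ k → R.opn k x = R
  | .con _, _, _ => rfl
  | .fvar _, _, _ => rfl
  | .bvar i, h, hk => by simp at h ⊢; omega
  | .app R N, h, hk => by simp [R.opn_of_lcAt h.1 hk, N.opn_of_lcAt h.2 hk]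
theorem Nrm.opn_of_lcAt {k j x} : ∀ {N : Nrm}, N.LcAt j → j ≤ k → N.opn k x = N
  | .atm R, h, hk => by simp at h; simp [R.opn_of_lcAt h hk]
  | .lam N, h, hk => by simp at h; simp [N.opn_of_lcAt h (Nat.succ_le_succ hk)]
end

mutual
theorem Atm.lcAt_opn {k x} : ∀ {R : Atm}, (R.opn k x).LcAt k ↔ R.LcAt (k + 1)
  | .con _ => by simp
  | .fvar _ => by simp
  | .bvar i => by simp only [Atm.opn]; split_ifs <;> simp <;> omega
  | .app R N => by simp [R.lcAt_opn, N.lcAt_opn]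
theorem Nrm.lcAt_opn {k x} : ∀ {N : Nrm}, (N.opn k x).LcAt k ↔ N.LcAt (k + 1)
  | .atm R => by simp [R.lcAt_opn]
  | .lam N => by simp [N.lcAt_opn]
end

theorem ATy.lcAt_opn {k x} {P : ATy} : (P.opn k x).LcAt k ↔ P.LcAt (k + 1) := by
  induction P <;> simp_all [Nrm.lcAt_opn]

theorem Ty.lcAt_opn {x} {A : Ty} : ∀ {k}, (A.opn k x).LcAt k ↔ A.LcAt (k + 1) := by
  induction A <;> simp_all [ATy.lcAt_opn]

theorem ASrt.lcAt_opn {k x} {Q : ASrt} : (Q.opn k x).LcAt k ↔ Q.LcAt (k + 1) := by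
  induction Q <;> simp_all [Nrm.lcAt_opn]

theorem Srt.lcAt_opn {x} {S : Srt} : ∀ {k}, (S.opn k x).LcAt k ↔ S.LcAt (k + 1) := by
  induction S <;> simp_all [ASrt.lcAt_opn, Ty.lcAt_opn]

theorem Knd.lcAt_opn {x} {K : Knd} : ∀ {k}, (K.opn k x).LcAt k ↔ K.LcAt (k + 1) := by
  induction K <;> simp_all [Ty.lcAt_opn]

theorem Cls.lcAt_opn {x} {L : Cls} : ∀ {k}, (L.opn k x).LcAt k ↔ L.LcAt (k + 1) := by
  induction L <;> simp_all [Srt.lcAt_opn, Ty.lcAt_opn]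

/-! ### Free variables of an opened term -/

mutual
theorem Atm.mem_fv_of_opn {k x v} : ∀ {R : Atm}, v ∈ (R.opn k x).fv → v = x ∨ v ∈ R.fv
  | .con _ => by simp
  | .fvar _ => by simp; tauto
  | .bvar i => by simp only [Atm.opn]; split_ifs <;> simp
  | .app R N => by
      have h₁ := R.mem_fv_of_opn (k := k) (x := x) (v := v)
      have h₂ := N.mem_fv_of_opn (k := k) (x := x) (v := v)
      simp; tauto
theorem Nrm.mem_fv_of_opn {k x v} : ∀ {N : Nrm}, v ∈ (N.opn k x).fv → v = x ∨ v ∈ N.fv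
  | .atm R => by simpa using R.mem_fv_of_opn
  | .lam N => by simpa using N.mem_fv_of_opn
end

theorem ATy.mem_fv_of_opn {k x v} {P : ATy} : v ∈ (P.opn k x).fv → v = x ∨ v ∈ P.fv := by
  induction P with
  | con => simp
  | app P N ih => have := N.mem_fv_of_opn (k := k) (x := x) (v := v); simp; tauto

theorem Ty.mem_fv_of_opn {x v} {A : Ty} : ∀ {k}, v ∈ (A.opn k x).fv → v = x ∨ v ∈ A.fv := by
  induction A with
  | atm P => exact fun {k} => P.mem_fv_of_opn
  | pi A B ihA ihB => intro k; have := ihA (k := k); have := ihB (k := k + 1); simp; tauto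

theorem Srt.mem_fv_of_opn {x v} {S : Srt} : ∀ {k}, v ∈ (S.opn k x).fv → v = x ∨ v ∈ S.fv := by
  induction S with
  | atm Q =>
    intro k
    induction Q with
    | con => simp
    | app Q N ih => have := N.mem_fv_of_opn (k := k) (x := x) (v := v); simp at ih ⊢; tauto
  | pi S A T ihS ihT =>
    intro k
    have := ihS (k := k); have := ihT (k := k + 1)
    have := A.mem_fv_of_opn (k := k) (x := x) (v := v); simp; tauto
  | top => simp
  | inter S₁ S₂ ih₁ ih₂ => intro k; have := ih₁ (k := k); have := ih₂ (k := k); simp; tauto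

mutual
theorem Atm.fv_subset_opn {k x} : ∀ {R : Atm}, R.fv ⊆ (R.opn k x).fv
  | .con _ => by simp
  | .fvar _ => by simp
  | .bvar i => by simp
  | .app R N => Finset.union_subset_union R.fv_subset_opn N.fv_subset_opn
theorem Nrm.fv_subset_opn {k x} : ∀ {N : Nrm}, N.fv ⊆ (N.opn k x).fv
  | .atm R => by simpa using R.fv_subset_opn
  | .lam N => by simpa using N.fv_subset_opn
end

theorem ATy.fv_subset_opn {k x} {P : ATy} : P.fv ⊆ (P.opn k x).fv := by
  induction P with
  | con => simp
  | app P N ih => exact Finset.union_subset_union ih N.fv_subset_opn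

theorem Ty.fv_subset_opn {x} {A : Ty} : ∀ {k}, A.fv ⊆ (A.opn k x).fv := by
  induction A with
  | atm P => exact fun {k} => P.fv_subset_opn
  | pi A B ihA ihB => exact fun {k} => Finset.union_subset_union ihA ihB

theorem ASrt.fv_subset_opn {k x} {Q : ASrt} : Q.fv ⊆ (Q.opn k x).fv := by
  induction Q with
  | con => simp
  | app Q N ih => exact Finset.union_subset_union ih N.fv_subset_opn

theorem Srt.fv_subset_opn {x} {S : Srt} : ∀ {k}, S.fv ⊆ (S.opn k x).fv := by
  induction S with
  | atm Q => exact fun {k} => Q.fv_subset_opn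
  | pi S A T ihS ihT =>
    exact fun {k} => Finset.union_subset_union (Finset.union_subset_union ihS A.fv_subset_opn) ihT
  | top => simp
  | inter S₁ S₂ ih₁ ih₂ => exact fun {k} => Finset.union_subset_union ih₁ ih₂

theorem Knd.fv_subset_opn {x} {K : Knd} : ∀ {k}, K.fv ⊆ (K.opn k x).fv := by
  induction K with
  | type => simp
  | pi A K ih => exact fun {k} => Finset.union_subset_union A.fv_subset_opn ih

theorem Cls.fv_subset_opn {x} {L : Cls} : ∀ {k}, L.fv ⊆ (L.opn k x).fv := by
  induction L with
  | sort => simp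
  | pi S A L ih =>
    exact fun {k} => Finset.union_subset_union (Finset.union_subset_union S.fv_subset_opn A.fv_subset_opn) ih
  | top => simp
  | inter L₁ L₂ ih₁ ih₂ => exact fun {k} => Finset.union_subset_union ih₁ ih₂

theorem Knd.mem_fv_of_opn {x v} {K : Knd} : ∀ {k}, v ∈ (K.opn k x).fv → v = x ∨ v ∈ K.fv := by
  induction K with
  | type => simp
  | pi A K ih =>
    intro k
    have := ih (k := k + 1); have := A.mem_fv_of_opn (k := k) (x := x) (v := v); simp; tauto

theorem Cls.mem_fv_of_opn {x v} {L : Cls} : ∀ {k}, v ∈ (L.opn k x).fv → v = x ∨ v ∈ L.fv := by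
  induction L with
  | sort => simp
  | pi S A L ih =>
    intro k
    have := ih (k := k + 1); have := A.mem_fv_of_opn (k := k) (x := x) (v := v)
    have := S.mem_fv_of_opn (k := k) (x := x) (v := v); simp; tauto
  | top => simp
  | inter L₁ L₂ ih₁ ih₂ => intro k; have := ih₁ (k := k); have := ih₂ (k := k); simp; tauto

/-! ### Renaming -/

mutual
theorem Atm.ren_opn {ρ k x} : ∀ {R : Atm}, (R.opn k x).ren ρ = (R.ren ρ).opn k (ρ x)
  | .con _ => by simp
  | .fvar _ => by simp
  | .bvar i => by simp only [Atm.opn, Atm.ren]; split_ifs <;> simp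
  | .app R N => by simp [R.ren_opn, N.ren_opn]
theorem Nrm.ren_opn {ρ k x} : ∀ {N : Nrm}, (N.opn k x).ren ρ = (N.ren ρ).opn k (ρ x)
  | .atm R => by simp [R.ren_opn]
  | .lam N => by simp [N.ren_opn]
end

theorem ATy.ren_opn {ρ k x} {P : ATy} : (P.opn k x).ren ρ = (P.ren ρ).opn k (ρ x) := by
  induction P <;> simp_all [Nrm.ren_opn]

theorem Ty.ren_opn {ρ x} {A : Ty} : ∀ {k}, (A.opn k x).ren ρ = (A.ren ρ).opn k (ρ x) := by
  induction A <;> simp_all [ATy.ren_opn]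

theorem ASrt.ren_opn {ρ k x} {Q : ASrt} : (Q.opn k x).ren ρ = (Q.ren ρ).opn k (ρ x) := by
  induction Q <;> simp_all [Nrm.ren_opn]

theorem Srt.ren_opn {ρ x} {S : Srt} : ∀ {k}, (S.opn k x).ren ρ = (S.ren ρ).opn k (ρ x) := by
  induction S <;> simp_all [ASrt.ren_opn, Ty.ren_opn]

theorem Knd.ren_opn {ρ x} {K : Knd} : ∀ {k}, (K.opn k x).ren ρ = (K.ren ρ).opn k (ρ x) := by
  induction K <;> simp_all [Ty.ren_opn]

theorem Cls.ren_opn {ρ x} {L : Cls} : ∀ {k}, (L.opn k x).ren ρ = (L.ren ρ).opn k (ρ x) := by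
  induction L <;> simp_all [Srt.ren_opn, Ty.ren_opn]

mutual
theorem Atm.ren_eq_self {ρ} : ∀ {R : Atm}, (∀ v ∈ R.fv, ρ v = v) → R.ren ρ = R
  | .con _, _ => rfl
  | .fvar _, h => by simpa using h
  | .bvar _, _ => rfl
  | .app R N, h => by
      simp [R.ren_eq_self fun v hv => h v (by simp [hv]),
        N.ren_eq_self fun v hv => h v (by simp [hv])]
theorem Nrm.ren_eq_self {ρ} : ∀ {N : Nrm}, (∀ v ∈ N.fv, ρ v = v) → N.ren ρ = N
  | .atm R, h => by simp at h; simp [R.ren_eq_self h]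
  | .lam N, h => by simp at h; simp [N.ren_eq_self h]
end

theorem ATy.ren_eq_self {ρ} {P : ATy} (h : ∀ v ∈ P.fv, ρ v = v) : P.ren ρ = P := by
  induction P with
  | con => rfl
  | app P N ih =>
    simp [ih fun v hv => h v (by simp [hv]), N.ren_eq_self fun v hv => h v (by simp [hv])]

theorem Ty.ren_eq_self {ρ} {A : Ty} (h : ∀ v ∈ A.fv, ρ v = v) : A.ren ρ = A := by
  induction A with
  | atm P => simp [P.ren_eq_self h]
  | pi A B ihA ihB =>
    simp [ihA fun v hv => h v (by simp [hv]), ihB fun v hv => h v (by simp [hv])]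

theorem ASrt.ren_eq_self {ρ} {Q : ASrt} (h : ∀ v ∈ Q.fv, ρ v = v) : Q.ren ρ = Q := by
  induction Q with
  | con => rfl
  | app Q N ih =>
    simp [ih fun v hv => h v (by simp [hv]), N.ren_eq_self fun v hv => h v (by simp [hv])]

theorem Srt.ren_eq_self {ρ} {S : Srt} (h : ∀ v ∈ S.fv, ρ v = v) : S.ren ρ = S := by
  induction S with
  | atm Q => simp [Q.ren_eq_self h]
  | pi S A T ihS ihT =>
    simp [ihS fun v hv => h v (by simp [hv]), ihT fun v hv => h v (by simp [hv]),
      A.ren_eq_self fun v hv => h v (by simp [hv])]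
  | top => rfl
  | inter S₁ S₂ ih₁ ih₂ =>
    simp [ih₁ fun v hv => h v (by simp [hv]), ih₂ fun v hv => h v (by simp [hv])]

theorem Knd.ren_eq_self {ρ} {K : Knd} (h : ∀ v ∈ K.fv, ρ v = v) : K.ren ρ = K := by
  induction K with
  | type => rfl
  | pi A K ih =>
    simp [A.ren_eq_self fun v hv => h v (by simp [hv]), ih fun v hv => h v (by simp [hv])]

theorem Cls.ren_eq_self {ρ} {L : Cls} (h : ∀ v ∈ L.fv, ρ v = v) : L.ren ρ = L := by
  induction L with
  | sort => rfl
  | pi S A L ih =>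
    simp [S.ren_eq_self fun v hv => h v (by simp [hv]), ih fun v hv => h v (by simp [hv]),
      A.ren_eq_self fun v hv => h v (by simp [hv])]
  | top => rfl
  | inter L₁ L₂ ih₁ ih₂ =>
    simp [ih₁ fun v hv => h v (by simp [hv]), ih₂ fun v hv => h v (by simp [hv])]

mutual
theorem Atm.lcAt_ren {ρ k} : ∀ {R : Atm}, (R.ren ρ).LcAt k ↔ R.LcAt k
  | .con _ => by simp
  | .fvar _ => by simp
  | .bvar _ => by simp
  | .app R N => by simp [R.lcAt_ren, N.lcAt_ren]
theorem Nrm.lcAt_ren {ρ k} : ∀ {N : Nrm}, (N.ren ρ).LcAt k ↔ N.LcAt k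
  | .atm R => by simp [R.lcAt_ren]
  | .lam N => by simp [N.lcAt_ren]
end

theorem ne_of_mem_of_notMem {v x : Var} {s : Finset Var} (h : v ∈ s) (hx : x ∉ s) : v ≠ x :=
  fun e => hx (e ▸ h)

/-- Neither name occurs in the body, so the transposition acts only on the variable just inserted.
This moves a judgment from one fresh name to another. -/
theorem Nrm.ren_swap_opn {N : Nrm} {y z : Var} (hy : y ∉ N.fv) (hz : z ∉ N.fv) {k} :
    (N.opn k y).ren (Equiv.swap y z) = N.opn k z := by
  rw [ren_opn, ren_eq_self, Equiv.swap_apply_left]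
  exact fun v hv => Equiv.swap_apply_of_ne_of_ne
    (ne_of_mem_of_notMem hv hy) (ne_of_mem_of_notMem hv hz)

theorem Ty.ren_swap_opn {A : Ty} {y z : Var} (hy : y ∉ A.fv) (hz : z ∉ A.fv) {k} :
    (A.opn k y).ren (Equiv.swap y z) = A.opn k z := by
  rw [ren_opn, ren_eq_self, Equiv.swap_apply_left]
  exact fun v hv => Equiv.swap_apply_of_ne_of_ne
    (ne_of_mem_of_notMem hv hy) (ne_of_mem_of_notMem hv hz)

theorem Srt.ren_swap_opn {S : Srt} {y z : Var} (hy : y ∉ S.fv) (hz : z ∉ S.fv) {k} :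
    (S.opn k y).ren (Equiv.swap y z) = S.opn k z := by
  rw [ren_opn, ren_eq_self, Equiv.swap_apply_left]
  exact fun v hv => Equiv.swap_apply_of_ne_of_ne
    (ne_of_mem_of_notMem hv hy) (ne_of_mem_of_notMem hv hz)

theorem Knd.ren_swap_opn {K : Knd} {y z : Var} (hy : y ∉ K.fv) (hz : z ∉ K.fv) {k} :
    (K.opn k y).ren (Equiv.swap y z) = K.opn k z := by
  rw [ren_opn, ren_eq_self, Equiv.swap_apply_left]
  exact fun v hv => Equiv.swap_apply_of_ne_of_ne
    (ne_of_mem_of_notMem hv hy) (ne_of_mem_of_notMem hv hz)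

theorem Cls.ren_swap_opn {L : Cls} {y z : Var} (hy : y ∉ L.fv) (hz : z ∉ L.fv) {k} :
    (L.opn k y).ren (Equiv.swap y z) = L.opn k z := by
  rw [ren_opn, ren_eq_self, Equiv.swap_apply_left]
  exact fun v hv => Equiv.swap_apply_of_ne_of_ne
    (ne_of_mem_of_notMem hv hy) (ne_of_mem_of_notMem hv hz)

/-! ### Opening with a fresh variable is invertible -/

mutual
-- Freshness separates an index `k` that was opened from an occurrence of `x` that was there before;
-- a body is thus determined by one fresh opening.
theorem Atm.opn_inj {k x} : ∀ {R R' : Atm}, x ∉ R.fv → x ∉ R'.fv →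
    R.opn k x = R'.opn k x → R = R'
  | .app R N, .app R' N', h, h', e => by
      simp at h h' e
      rw [R.opn_inj h.1 h'.1 e.1, N.opn_inj h.2 h'.2 e.2]
  | .con _, R', h, h', e => by cases R' <;> simp at h' e ⊢ <;> grind
  | .fvar _, R', h, h', e => by cases R' <;> simp at h h' e ⊢ <;> grind
  | .bvar _, R', h, h', e => by cases R' <;> simp at h' e ⊢ <;> grind
  | .app R N, .con _, h, h', e => by simp at e
  | .app R N, .fvar _, h, h', e => by simp at e
  | .app R N, .bvar _, h, h', e => by simp at e; grind
theorem Nrm.opn_inj {k x} : ∀ {N N' : Nrm}, x ∉ N.fv → x ∉ N'.fv →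
    N.opn k x = N'.opn k x → N = N'
  | .atm R, .atm R', h, h', e => by simp at h h' e; rw [R.opn_inj h h' e]
  | .lam N, .lam N', h, h', e => by simp at h h' e; rw [N.opn_inj h h' e]
  | .atm R, .lam N', h, h', e => by simp at e
  | .lam R, .atm N', h, h', e => by simp at e
end

theorem ATy.opn_inj {k x} : ∀ {P P' : ATy}, x ∉ P.fv → x ∉ P'.fv →
    P.opn k x = P'.opn k x → P = P'
  | .con _, .con _, _, _, e => by simpa using e
  | .app P N, .app P' N', h, h', e => by
      simp at h h' e; rw [P.opn_inj h.1 h'.1 e.1, N.opn_inj h.2 h'.2 e.2]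
  | .con _, .app _ _, _, _, e => by simp at e
  | .app _ _, .con _, _, _, e => by simp at e

theorem Ty.opn_inj {k x} : ∀ {A A' : Ty}, x ∉ A.fv → x ∉ A'.fv →
    A.opn k x = A'.opn k x → A = A'
  | .atm P, .atm P', h, h', e => by simp at h h' e; rw [P.opn_inj h h' e]
  | .pi A B, .pi A' B', h, h', e => by
      simp at h h' e; rw [A.opn_inj h.1 h'.1 e.1, B.opn_inj h.2 h'.2 e.2]
  | .atm _, .pi _ _, _, _, e => by simp at e
  | .pi _ _, .atm _, _, _, e => by simp at e

theorem ASrt.opn_inj {k x} : ∀ {Q Q' : ASrt}, x ∉ Q.fv → x ∉ Q'.fv →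
    Q.opn k x = Q'.opn k x → Q = Q'
  | .con _, .con _, _, _, e => by simpa using e
  | .app Q N, .app Q' N', h, h', e => by
      simp at h h' e; rw [Q.opn_inj h.1 h'.1 e.1, N.opn_inj h.2 h'.2 e.2]
  | .con _, .app _ _, _, _, e => by simp at e
  | .app _ _, .con _, _, _, e => by simp at e

theorem Srt.opn_inj {x} {S : Srt} : ∀ {k} {S' : Srt}, x ∉ S.fv → x ∉ S'.fv →
    S.opn k x = S'.opn k x → S = S' := by
  induction S with
  | atm Q =>
    rintro k (_ | _ | _ | _) h h' e <;> simp at h h' e ⊢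
    exact Q.opn_inj h h' e
  | pi S A T ihS ihT =>
    rintro k (_ | _ | _ | _) h h' e <;> simp at h h' e ⊢
    exact ⟨ihS h.1 h'.1 e.1, A.opn_inj h.2.1 h'.2.1 e.2.1, ihT h.2.2 h'.2.2 e.2.2⟩
  | top => rintro k (_ | _ | _ | _) h h' e <;> simp at h h' e ⊢
  | inter S₁ S₂ ih₁ ih₂ =>
    rintro k (_ | _ | _ | _) h h' e <;> simp at h h' e ⊢
    exact ⟨ih₁ h.1 h'.1 e.1, ih₂ h.2 h'.2 e.2⟩

theorem Knd.opn_inj {x} {K : Knd} : ∀ {k} {K' : Knd}, x ∉ K.fv → x ∉ K'.fv →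
    K.opn k x = K'.opn k x → K = K' := by
  induction K with
  | type => rintro k (_ | _) h h' e <;> simp at h h' e ⊢
  | pi A K ih =>
    rintro k (_ | _) h h' e <;> simp at h h' e ⊢
    exact ⟨A.opn_inj h.1 h'.1 e.1, ih h.2 h'.2 e.2⟩

theorem Cls.opn_inj {x} {L : Cls} : ∀ {k} {L' : Cls}, x ∉ L.fv → x ∉ L'.fv →
    L.opn k x = L'.opn k x → L = L' := by
  induction L with
  | sort => rintro k (_ | _ | _ | _) h h' e <;> simp at h h' e ⊢
  | pi S A L ih =>
    rintro k (_ | _ | _ | _) h h' e <;> simp at h h' e ⊢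
    exact ⟨S.opn_inj h.1 h'.1 e.1, A.opn_inj h.2.1 h'.2.1 e.2.1, ih h.2.2 h'.2.2 e.2.2⟩
  | top => rintro k (_ | _ | _ | _) h h' e <;> simp at h h' e ⊢
  | inter L₁ L₂ ih₁ ih₂ =>
    rintro k (_ | _ | _ | _) h h' e <;> simp at h h' e ⊢
    exact ⟨ih₁ h.1 h'.1 e.1, ih₂ h.2 h'.2 e.2⟩

mutual
-- Abstraction: occurrences of `x` become the index `k`, which local closure guarantees to be
-- unused. Results of substituting under a binder are turned back into bodies in this way.
theorem Atm.exists_opn_eq {k} (x : Var) : ∀ {R : Atm}, R.LcAt k → ∃ R' : Atm, x ∉ R'.fv ∧ R'.opn k x = R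
  | .con c, _ => ⟨.con c, by simp⟩
  | .fvar y, _ => by
      by_cases h : y = x
      · exact ⟨.bvar k, by simp [h]⟩
      · exact ⟨.fvar y, by simp [Ne.symm h]⟩
  | .bvar i, h => ⟨.bvar i, by simp at h ⊢; omega⟩
  | .app R N, h => by
      obtain ⟨R', hx, rfl⟩ := R.exists_opn_eq x h.1
      obtain ⟨N', hx', rfl⟩ := N.exists_opn_eq x h.2
      exact ⟨.app R' N', by simp [hx, hx']⟩
theorem Nrm.exists_opn_eq {k} (x : Var) : ∀ {N : Nrm}, N.LcAt k → ∃ N' : Nrm, x ∉ N'.fv ∧ N'.opn k x = N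
  | .atm R, h => by
      obtain ⟨R', hx, rfl⟩ := R.exists_opn_eq x h
      exact ⟨.atm R', by simp [hx]⟩
  | .lam N, h => by
      obtain ⟨N', hx, rfl⟩ := N.exists_opn_eq x h
      exact ⟨.lam N', by simp [hx]⟩
end

theorem ATy.exists_opn_eq {k} (x : Var) {P : ATy} (h : P.LcAt k) :
    ∃ P' : ATy, x ∉ P'.fv ∧ P'.opn k x = P := by
  induction P with
  | con a => exact ⟨.con a, by simp⟩
  | app P N ih =>
    obtain ⟨P', hx, rfl⟩ := ih h.1
    obtain ⟨N', hx', rfl⟩ := N.exists_opn_eq x h.2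
    exact ⟨.app P' N', by simp [hx, hx']⟩

theorem Ty.exists_opn_eq (x : Var) {A : Ty} : ∀ {k}, A.LcAt k → ∃ A' : Ty, x ∉ A'.fv ∧ A'.opn k x = A := by
  induction A with
  | atm P =>
    intro k h
    obtain ⟨P', hx, rfl⟩ := P.exists_opn_eq x h
    exact ⟨.atm P', by simp [hx]⟩
  | pi A B ihA ihB =>
    intro k h
    obtain ⟨A', hx, rfl⟩ := ihA h.1
    obtain ⟨B', hx', rfl⟩ := ihB h.2
    exact ⟨.pi A' B', by simp [hx, hx']⟩

theorem ASrt.exists_opn_eq {k} (x : Var) {Q : ASrt} (h : Q.LcAt k) :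
    ∃ Q' : ASrt, x ∉ Q'.fv ∧ Q'.opn k x = Q := by
  induction Q with
  | con a => exact ⟨.con a, by simp⟩
  | app Q N ih =>
    obtain ⟨Q', hx, rfl⟩ := ih h.1
    obtain ⟨N', hx', rfl⟩ := N.exists_opn_eq x h.2
    exact ⟨.app Q' N', by simp [hx, hx']⟩

theorem Srt.exists_opn_eq (x : Var) {S : Srt} :
    ∀ {k}, S.LcAt k → ∃ S' : Srt, x ∉ S'.fv ∧ S'.opn k x = S := by
  induction S with
  | atm Q =>
    intro k h
    obtain ⟨Q', hx, rfl⟩ := Q.exists_opn_eq x h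
    exact ⟨.atm Q', by simp [hx]⟩
  | pi S A T ihS ihT =>
    intro k h
    obtain ⟨S', hx, rfl⟩ := ihS h.1
    obtain ⟨A', hx₁, rfl⟩ := A.exists_opn_eq x h.2.1
    obtain ⟨T', hx₂, rfl⟩ := ihT h.2.2
    exact ⟨.pi S' A' T', by simp [hx, hx₁, hx₂]⟩
  | top => exact fun _ => ⟨.top, by simp⟩
  | inter S₁ S₂ ih₁ ih₂ =>
    intro k h
    obtain ⟨S₁', hx, rfl⟩ := ih₁ h.1
    obtain ⟨S₂', hx', rfl⟩ := ih₂ h.2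
    exact ⟨.inter S₁' S₂', by simp [hx, hx']⟩

theorem Knd.exists_opn_eq (x : Var) {K : Knd} :
    ∀ {k}, K.LcAt k → ∃ K' : Knd, x ∉ K'.fv ∧ K'.opn k x = K := by
  induction K with
  | type => exact fun _ => ⟨.type, by simp⟩
  | pi A K ih =>
    intro k h
    obtain ⟨A', hx, rfl⟩ := A.exists_opn_eq x h.1
    obtain ⟨K', hx', rfl⟩ := ih h.2
    exact ⟨.pi A' K', by simp [hx, hx']⟩

theorem Cls.exists_opn_eq (x : Var) {L : Cls} :
    ∀ {k}, L.LcAt k → ∃ L' : Cls, x ∉ L'.fv ∧ L'.opn k x = L := by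
  induction L with
  | sort => exact fun _ => ⟨.sort, by simp⟩
  | pi S A L ih =>
    intro k h
    obtain ⟨S', hx, rfl⟩ := S.exists_opn_eq x h.1
    obtain ⟨A', hx₁, rfl⟩ := A.exists_opn_eq x h.2.1
    obtain ⟨L', hx₂, rfl⟩ := ih h.2.2
    exact ⟨.pi S' A' L', by simp [hx, hx₁, hx₂]⟩
  | top => exact fun _ => ⟨.top, by simp⟩
  | inter L₁ L₂ ih₁ ih₂ =>
    intro k h
    obtain ⟨L₁', hx, rfl⟩ := ih₁ h.1
    obtain ⟨L₂', hx', rfl⟩ := ih₂ h.2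
    exact ⟨.inter L₁' L₂', by simp [hx, hx']⟩

@[simp] theorem ATy.simple_opn {k x} {P : ATy} : (P.opn k x).simple = P.simple := by
  induction P <;> simp_all

@[simp] theorem Ty.simple_opn {x} {A : Ty} : ∀ {k}, (A.opn k x).simple = A.simple := by
  induction A <;> simp_all

/-! ### Shifting and η-expansion -/

mutual
theorem Atm.shift_of_lcAt {k j} : ∀ {R : Atm}, R.LcAt j → j ≤ k → R.shift k = R
  | .con _, _, _ => rfl
  | .fvar _, _, _ => rfl
  | .bvar i, h, hk => by simp at h ⊢; omega
  | .app R N, h, hk => by simp [R.shift_of_lcAt h.1 hk, N.shift_of_lcAt h.2 hk]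
theorem Nrm.shift_of_lcAt {k j} : ∀ {N : Nrm}, N.LcAt j → j ≤ k → N.shift k = N
  | .atm R, h, hk => by simp at h; simp [R.shift_of_lcAt h hk]
  | .lam N, h, hk => by simp at h; simp [N.shift_of_lcAt h (Nat.succ_le_succ hk)]
end

mutual
theorem Atm.opn_shift {j k x} : ∀ {R : Atm}, j ≤ k →
    (R.shift j).opn (k + 1) x = (R.opn k x).shift j
  | .con _, _ => rfl
  | .fvar _, _ => rfl
  | .bvar i, h => by simp; grind [Atm.opn, Atm.shift]
  | .app R N, h => by simp [R.opn_shift h, N.opn_shift h]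
theorem Nrm.opn_shift {j k x} : ∀ {N : Nrm}, j ≤ k →
    (N.shift j).opn (k + 1) x = (N.opn k x).shift j
  | .atm R, h => by simp [R.opn_shift h]
  | .lam N, h => by simp [N.opn_shift (Nat.succ_le_succ h)]
end

mutual
theorem Atm.lcAt_shift {j k} : ∀ {R : Atm}, R.LcAt k → (R.shift j).LcAt (k + 1)
  | .con _, _ => trivial
  | .fvar _, _ => trivial
  | .bvar i, h => by simp at h ⊢; split_ifs <;> simp <;> omega
  | .app R N, h => ⟨R.lcAt_shift h.1, N.lcAt_shift h.2⟩
theorem Nrm.lcAt_shift {j k} : ∀ {N : Nrm}, N.LcAt k → (N.shift j).LcAt (k + 1)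
  | .atm R, h => by simp at h ⊢; exact R.lcAt_shift h
  | .lam N, h => by simp at h ⊢; exact N.lcAt_shift h
end

mutual
@[simp] theorem Atm.fv_shift {j} : ∀ {R : Atm}, (R.shift j).fv = R.fv
  | .con _ => rfl
  | .fvar _ => rfl
  | .bvar i => by simp only [Atm.shift]; split_ifs <;> simp
  | .app R N => by simp [R.fv_shift, N.fv_shift]
@[simp] theorem Nrm.fv_shift {j} : ∀ {N : Nrm}, (N.shift j).fv = N.fv
  | .atm R => by simp [R.fv_shift]
  | .lam N => by simp [N.fv_shift]
end

theorem expand_opn {α : STy} : ∀ {k x R}, (expand α R).opn k x = expand α (R.opn k x) := by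
  induction α with
  | base a => simp [expand]
  | arr α β ihα ihβ => intro k x R; simp [expand, ihα, ihβ, Atm.opn_shift]

theorem lcAt_expand {α : STy} : ∀ {k R}, R.LcAt k → (expand α R).LcAt k := by
  induction α with
  | base a => simp [expand]
  | arr α β ihα ihβ =>
    intro k R h
    simp only [expand, Nrm.LcAt]
    exact ihβ ⟨Atm.lcAt_shift h, ihα (by simp)⟩

theorem lcAt_expand_fvar {α : STy} {x : Var} : (expand α (.fvar x)).LcAt 0 := lcAt_expand trivial

@[simp] theorem fv_expand {α : STy} : ∀ {R}, (expand α R).fv = R.fv := by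
  induction α with
  | base a => simp [expand]
  | arr α β ihα ihβ => intro R; simp [expand, ihα, ihβ]

/-- The body of an η-expansion at an arrow type, opened. -/
theorem expand_body_opn {α β : STy} {R : Atm} (h : R.LcAt 0) {x} :
    (expand β (.app (R.shift 0) (expand α (.bvar 0)))).opn 0 x =
      expand β (.app R (expand α (.fvar x))) := by
  rw [Atm.shift_of_lcAt h le_rfl]
  simp [expand_opn, Atm.opn_of_lcAt h le_rfl]

/-! ## Hereditary substitution: basic properties -/

theorem exists_fresh (F : Finset Var) : ∃ y, y ∉ F := Infinite.exists_notMem_finset F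

/-! ### Equivariance -/

/-- A name outside `π(F)` is the image of a name outside `F`; cofinite premises can therefore be
carried along a permutation. -/
theorem forall_notMem_image {p : Var → Prop} {F : Finset Var} (π : Equiv.Perm Var)
    (h : ∀ y, y ∉ F → p (π y)) : ∀ y, y ∉ F.image π → p y := by
  intro y hy
  have := h (π.symm y) fun hm => hy (Finset.mem_image.2 ⟨_, hm, by simp⟩)
  simpa using this

mutual
-- Permutations rather than arbitrary renamings: the side condition `x ≠ x₀` of the variable rule
-- survives only injective maps.
theorem SubstN.equivariant (π : Equiv.Perm Var) : ∀ {N₀ x₀ α₀ N N'}, SubstN N₀ x₀ α₀ N N' →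
    SubstN (N₀.ren π) (π x₀) α₀ (N.ren π) (N'.ren π)
  | _, _, _, _, _, .atom h => .atom (h.equivariant π)
  | _, _, _, _, _, .atomNorm h => .atomNorm (h.equivariant π)
  | _, _, _, _, _, .lam F h => .lam (F.image π) <| forall_notMem_image π fun y hy => by
      simpa [Nrm.ren_opn] using (h y hy).equivariant π
theorem SubstRR.equivariant (π : Equiv.Perm Var) : ∀ {N₀ x₀ α₀ R R'}, SubstRR N₀ x₀ α₀ R R' →
    SubstRR (N₀.ren π) (π x₀) α₀ (R.ren π) (R'.ren π)
  | _, _, _, _, _, .var h => .var (by simpa using h)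
  | _, _, _, _, _, .con => .con
  | _, _, _, _, _, .app h₁ h₂ => .app (h₁.equivariant π) (h₂.equivariant π)
theorem SubstRN.equivariant (π : Equiv.Perm Var) : ∀ {N₀ x₀ α₀ R N' β},
    SubstRN N₀ x₀ α₀ R N' β → SubstRN (N₀.ren π) (π x₀) α₀ (R.ren π) (N'.ren π) β
  | _, _, _, _, _, _, .var => .var
  | _, _, _, _, _, _, .beta F h₁ h₂ h₃ =>
      .beta (F.image π) (h₁.equivariant π) (h₂.equivariant π) <|
        forall_notMem_image π fun y hy => by
          simpa [Nrm.ren_opn] using (h₃ y hy).equivariant π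
end

section
variable {N₀ : Nrm} {x₀ : Var} {α₀ : STy}

theorem SubstP.equivariant (π : Equiv.Perm Var) {P P'} (h : SubstP N₀ x₀ α₀ P P') :
    SubstP (N₀.ren π) (π x₀) α₀ (P.ren π) (P'.ren π) := by
  induction h with
  | con => exact .con
  | app _ h ih => exact .app ih (h.equivariant π)

theorem SubstA.equivariant (π : Equiv.Perm Var) {A A'} (h : SubstA N₀ x₀ α₀ A A') :
    SubstA (N₀.ren π) (π x₀) α₀ (A.ren π) (A'.ren π) := by
  induction h with
  | atm h => exact .atm (h.equivariant π)
  | pi F _ _ ihA ihB =>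
    exact .pi (F.image π) ihA <| forall_notMem_image π fun y hy => by
      simpa [Ty.ren_opn] using ihB y hy

theorem SubstQ.equivariant (π : Equiv.Perm Var) {Q Q'} (h : SubstQ N₀ x₀ α₀ Q Q') :
    SubstQ (N₀.ren π) (π x₀) α₀ (Q.ren π) (Q'.ren π) := by
  induction h with
  | con => exact .con
  | app _ h ih => exact .app ih (h.equivariant π)

theorem SubstS.equivariant (π : Equiv.Perm Var) {S S'} (h : SubstS N₀ x₀ α₀ S S') :
    SubstS (N₀.ren π) (π x₀) α₀ (S.ren π) (S'.ren π) := by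
  induction h with
  | atm h => exact .atm (h.equivariant π)
  | pi F _ hA _ ihS ihT =>
    exact .pi (F.image π) ihS (hA.equivariant π) <| forall_notMem_image π fun y hy => by
      simpa [Srt.ren_opn] using ihT y hy
  | top => exact .top
  | inter _ _ ih₁ ih₂ => exact .inter ih₁ ih₂

theorem SubstK.equivariant (π : Equiv.Perm Var) {K K'} (h : SubstK N₀ x₀ α₀ K K') :
    SubstK (N₀.ren π) (π x₀) α₀ (K.ren π) (K'.ren π) := by
  induction h with
  | type => exact .type
  | pi F hA _ ih =>
    exact .pi (F.image π) (hA.equivariant π) <| forall_notMem_image π fun y hy => by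
      simpa [Knd.ren_opn] using ih y hy

theorem SubstL.equivariant (π : Equiv.Perm Var) {L L'} (h : SubstL N₀ x₀ α₀ L L') :
    SubstL (N₀.ren π) (π x₀) α₀ (L.ren π) (L'.ren π) := by
  induction h with
  | sort => exact .sort
  | pi F hS hA _ ih =>
    exact .pi (F.image π) (hS.equivariant π) (hA.equivariant π) <|
      forall_notMem_image π fun y hy => by simpa [Cls.ren_opn] using ih y hy
  | top => exact .top
  | inter _ _ ih₁ ih₂ => exact .inter ih₁ ih₂

/-! ### Binder rules from a single fresh name -/

theorem Nrm.ren_swap_of_notMem {N : Nrm} {y z : Var} (hy : y ∉ N.fv) (hz : z ∉ N.fv) :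
    N.ren (Equiv.swap y z) = N :=
  ren_eq_self fun _ hv => Equiv.swap_apply_of_ne_of_ne
    (ne_of_mem_of_notMem hv hy) (ne_of_mem_of_notMem hv hz)

/-- Transposing `y` with another fresh name fixes `N₀` and `x₀` and changes only the name at which
the bodies are opened. -/
theorem SubstN.lam_of_fresh {N N' : Nrm} {y : Var} (hy₀ : y ∉ N₀.fv) (hx₀ : x₀ ≠ y)
    (hN : y ∉ N.fv) (hN' : y ∉ N'.fv) (h : SubstN N₀ x₀ α₀ (N.opn 0 y) (N'.opn 0 y)) :
    SubstN N₀ x₀ α₀ (.lam N) (.lam N') := by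
  refine .lam (N₀.fv ∪ {x₀} ∪ N.fv ∪ N'.fv) fun z hz => ?_
  simp only [Finset.mem_union, Finset.mem_singleton, not_or] at hz
  obtain ⟨⟨⟨hz₀, hzx⟩, hzN⟩, hzN'⟩ := hz
  have := h.equivariant (Equiv.swap y z)
  rwa [Nrm.ren_swap_of_notMem hy₀ hz₀, Equiv.swap_apply_of_ne_of_ne hx₀ (Ne.symm hzx),
    Nrm.ren_swap_opn hN hzN, Nrm.ren_swap_opn hN' hzN'] at this

/-- In a β step the variable substituted for is the opened one, so here it moves along with the
opening while the result stays fixed. -/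
theorem SubstN.change_var {N M : Nrm} {y z : Var} (hy₀ : y ∉ N₀.fv) (hN : y ∉ N.fv)
    (hM : y ∉ M.fv) (hz₀ : z ∉ N₀.fv) (hzN : z ∉ N.fv) (hzM : z ∉ M.fv)
    (h : SubstN N₀ y α₀ (N.opn 0 y) M) : SubstN N₀ z α₀ (N.opn 0 z) M := by
  have := h.equivariant (Equiv.swap y z)
  rwa [Nrm.ren_swap_of_notMem hy₀ hz₀, Equiv.swap_apply_left,
    Nrm.ren_swap_opn hN hzN, Nrm.ren_swap_of_notMem hM hzM] at this

theorem SubstA.pi_of_fresh {A A' B B' : Ty} {y : Var} (hy₀ : y ∉ N₀.fv) (hx₀ : x₀ ≠ y)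
    (hB : y ∉ B.fv) (hB' : y ∉ B'.fv) (hA : SubstA N₀ x₀ α₀ A A')
    (h : SubstA N₀ x₀ α₀ (B.opn 0 y) (B'.opn 0 y)) :
    SubstA N₀ x₀ α₀ (.pi A B) (.pi A' B') := by
  refine .pi (N₀.fv ∪ {x₀} ∪ B.fv ∪ B'.fv) hA fun z hz => ?_
  simp only [Finset.mem_union, Finset.mem_singleton, not_or] at hz
  obtain ⟨⟨⟨hz₀, hzx⟩, hzB⟩, hzB'⟩ := hz
  have := h.equivariant (Equiv.swap y z)
  rwa [Nrm.ren_swap_of_notMem hy₀ hz₀, Equiv.swap_apply_of_ne_of_ne hx₀ (Ne.symm hzx),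
    Ty.ren_swap_opn hB hzB, Ty.ren_swap_opn hB' hzB'] at this

theorem SubstS.pi_of_fresh {S S' A A'} {T T' : Srt} {y : Var} (hy₀ : y ∉ N₀.fv) (hx₀ : x₀ ≠ y)
    (hT : y ∉ T.fv) (hT' : y ∉ T'.fv) (hS : SubstS N₀ x₀ α₀ S S') (hA : SubstA N₀ x₀ α₀ A A')
    (h : SubstS N₀ x₀ α₀ (T.opn 0 y) (T'.opn 0 y)) :
    SubstS N₀ x₀ α₀ (.pi S A T) (.pi S' A' T') := by
  refine .pi (N₀.fv ∪ {x₀} ∪ T.fv ∪ T'.fv) hS hA fun z hz => ?_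
  simp only [Finset.mem_union, Finset.mem_singleton, not_or] at hz
  obtain ⟨⟨⟨hz₀, hzx⟩, hzT⟩, hzT'⟩ := hz
  have := h.equivariant (Equiv.swap y z)
  rwa [Nrm.ren_swap_of_notMem hy₀ hz₀, Equiv.swap_apply_of_ne_of_ne hx₀ (Ne.symm hzx),
    Srt.ren_swap_opn hT hzT, Srt.ren_swap_opn hT' hzT'] at this

theorem SubstK.pi_of_fresh {A A'} {K K' : Knd} {y : Var} (hy₀ : y ∉ N₀.fv) (hx₀ : x₀ ≠ y)
    (hK : y ∉ K.fv) (hK' : y ∉ K'.fv) (hA : SubstA N₀ x₀ α₀ A A')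
    (h : SubstK N₀ x₀ α₀ (K.opn 0 y) (K'.opn 0 y)) :
    SubstK N₀ x₀ α₀ (.pi A K) (.pi A' K') := by
  refine .pi (N₀.fv ∪ {x₀} ∪ K.fv ∪ K'.fv) hA fun z hz => ?_
  simp only [Finset.mem_union, Finset.mem_singleton, not_or] at hz
  obtain ⟨⟨⟨hz₀, hzx⟩, hzK⟩, hzK'⟩ := hz
  have := h.equivariant (Equiv.swap y z)
  rwa [Nrm.ren_swap_of_notMem hy₀ hz₀, Equiv.swap_apply_of_ne_of_ne hx₀ (Ne.symm hzx),
    Knd.ren_swap_opn hK hzK, Knd.ren_swap_opn hK' hzK'] at this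

theorem SubstL.pi_of_fresh {S S' A A'} {L L' : Cls} {y : Var} (hy₀ : y ∉ N₀.fv) (hx₀ : x₀ ≠ y)
    (hL : y ∉ L.fv) (hL' : y ∉ L'.fv) (hS : SubstS N₀ x₀ α₀ S S') (hA : SubstA N₀ x₀ α₀ A A')
    (h : SubstL N₀ x₀ α₀ (L.opn 0 y) (L'.opn 0 y)) :
    SubstL N₀ x₀ α₀ (.pi S A L) (.pi S' A' L') := by
  refine .pi (N₀.fv ∪ {x₀} ∪ L.fv ∪ L'.fv) hS hA fun z hz => ?_
  simp only [Finset.mem_union, Finset.mem_singleton, not_or] at hz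
  obtain ⟨⟨⟨hz₀, hzx⟩, hzL⟩, hzL'⟩ := hz
  have := h.equivariant (Equiv.swap y z)
  rwa [Nrm.ren_swap_of_notMem hy₀ hz₀, Equiv.swap_apply_of_ne_of_ne hx₀ (Ne.symm hzx),
    Cls.ren_swap_opn hL hzL, Cls.ren_swap_opn hL' hzL'] at this

end

/-! ### Local closure -/

mutual
-- No rule applies to a dangling index, so derivability certifies local closure.
theorem SubstN.lc_input : ∀ {N₀ x₀ α₀ N N'}, SubstN N₀ x₀ α₀ N N' → N.LcAt 0
  | _, _, _, _, _, .atom h => h.lc_input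
  | _, _, _, _, _, .atomNorm h => h.lc_input
  | _, _, _, _, _, .lam F h =>
      have ⟨y, hy⟩ := exists_fresh F
      Nrm.lcAt_opn.1 (h y hy).lc_input
theorem SubstRR.lc_input : ∀ {N₀ x₀ α₀ R R'}, SubstRR N₀ x₀ α₀ R R' → R.LcAt 0
  | _, _, _, _, _, .var _ => trivial
  | _, _, _, _, _, .con => trivial
  | _, _, _, _, _, .app h₁ h₂ => ⟨h₁.lc_input, h₂.lc_input⟩
theorem SubstRN.lc_input : ∀ {N₀ x₀ α₀ R N' β}, SubstRN N₀ x₀ α₀ R N' β → R.LcAt 0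
  | _, _, _, _, _, _, .var => trivial
  | _, _, _, _, _, _, .beta _ h₁ h₂ _ => ⟨h₁.lc_input, h₂.lc_input⟩
end

mutual
theorem SubstN.lc_output : ∀ {N₀ x₀ α₀ N N'}, SubstN N₀ x₀ α₀ N N' → N₀.LcAt 0 → N'.LcAt 0
  | _, _, _, _, _, .atom h, h₀ => h.lc_output h₀
  | _, _, _, _, _, .atomNorm h, h₀ => h.lc_output h₀
  | _, _, _, _, _, .lam F h, h₀ =>
      have ⟨y, hy⟩ := exists_fresh F
      Nrm.lcAt_opn.1 ((h y hy).lc_output h₀)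
theorem SubstRR.lc_output : ∀ {N₀ x₀ α₀ R R'}, SubstRR N₀ x₀ α₀ R R' → N₀.LcAt 0 → R'.LcAt 0
  | _, _, _, _, _, .var _, _ => trivial
  | _, _, _, _, _, .con, _ => trivial
  | _, _, _, _, _, .app h₁ h₂, h₀ => ⟨h₁.lc_output h₀, h₂.lc_output h₀⟩
theorem SubstRN.lc_output : ∀ {N₀ x₀ α₀ R N' β}, SubstRN N₀ x₀ α₀ R N' β → N₀.LcAt 0 →
    N'.LcAt 0
  | _, _, _, _, _, _, .var, h₀ => h₀
  | _, _, _, _, _, _, .beta F _ h₂ h₃, h₀ =>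
      have ⟨y, hy⟩ := exists_fresh F
      (h₃ y hy).lc_output (h₂.lc_output h₀)
end

section
variable {N₀ : Nrm} {x₀ : Var} {α₀ : STy}

theorem SubstP.lc_output {P P'} (h : SubstP N₀ x₀ α₀ P P') (h₀ : N₀.LcAt 0) : P'.LcAt 0 := by
  induction h with
  | con => trivial
  | app _ h ih => exact ⟨ih, h.lc_output h₀⟩

theorem SubstA.lc_output {A A'} (h : SubstA N₀ x₀ α₀ A A') (h₀ : N₀.LcAt 0) : A'.LcAt 0 := by
  induction h with
  | atm h => exact h.lc_output h₀
  | pi F _ _ ihA ihB =>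
    have ⟨y, hy⟩ := exists_fresh F
    exact ⟨ihA, Ty.lcAt_opn.1 (ihB y hy)⟩

theorem SubstQ.lc_output {Q Q'} (h : SubstQ N₀ x₀ α₀ Q Q') (h₀ : N₀.LcAt 0) : Q'.LcAt 0 := by
  induction h with
  | con => trivial
  | app _ h ih => exact ⟨ih, h.lc_output h₀⟩

theorem SubstS.lc_output {S S'} (h : SubstS N₀ x₀ α₀ S S') (h₀ : N₀.LcAt 0) : S'.LcAt 0 := by
  induction h with
  | atm h => exact h.lc_output h₀
  | pi F _ hA _ ihS ihT =>
    have ⟨y, hy⟩ := exists_fresh F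
    exact ⟨ihS, hA.lc_output h₀, Srt.lcAt_opn.1 (ihT y hy)⟩
  | top => trivial
  | inter _ _ ih₁ ih₂ => exact ⟨ih₁, ih₂⟩

theorem SubstK.lc_output {K K'} (h : SubstK N₀ x₀ α₀ K K') (h₀ : N₀.LcAt 0) : K'.LcAt 0 := by
  induction h with
  | type => trivial
  | pi F hA _ ih =>
    have ⟨y, hy⟩ := exists_fresh F
    exact ⟨hA.lc_output h₀, Knd.lcAt_opn.1 (ih y hy)⟩

theorem SubstL.lc_output {L L'} (h : SubstL N₀ x₀ α₀ L L') (h₀ : N₀.LcAt 0) : L'.LcAt 0 := by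
  induction h with
  | sort => trivial
  | pi F hS hA _ ih =>
    have ⟨y, hy⟩ := exists_fresh F
    exact ⟨hS.lc_output h₀, hA.lc_output h₀, Cls.lcAt_opn.1 (ih y hy)⟩
  | top => trivial
  | inter _ _ ih₁ ih₂ => exact ⟨ih₁, ih₂⟩

end

/-! ### Substitution for a variable that does not occur -/

mutual
/-- The number of nodes of an atomic term. -/
def Atm.size : Atm → ℕ
  | .con _ => 1
  | .fvar _ => 1
  | .bvar _ => 1
  | .app R N => R.size + N.size + 1
/-- The number of nodes of a normal term. -/
def Nrm.size : Nrm → ℕ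
  | .atm R => R.size + 1
  | .lam N => N.size + 1
end

/-- This measure and the next three justify recursion into opened bodies, which are not structural
subterms. Components that no recursion enters are not counted. -/
def Ty.size : Ty → ℕ
  | .atm _ => 1
  | .pi A B => A.size + B.size + 1

def Srt.size : Srt → ℕ
  | .atm _ => 1
  | .pi S _ T => S.size + T.size + 1
  | .top => 1
  | .inter S₁ S₂ => S₁.size + S₂.size + 1

def Knd.size : Knd → ℕ
  | .type => 1
  | .pi _ K => K.size + 1

def Cls.size : Cls → ℕ
  | .sort => 1
  | .pi _ _ L => L.size + 1
  | .top => 1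
  | .inter L₁ L₂ => L₁.size + L₂.size + 1

mutual
@[simp] theorem Atm.size_opn {k x} : ∀ {R : Atm}, (R.opn k x).size = R.size
  | .con _ => rfl
  | .fvar _ => rfl
  | .bvar _ => by simp only [Atm.opn]; split_ifs <;> simp [Atm.size]
  | .app R N => by simp [Atm.size, R.size_opn, N.size_opn]
@[simp] theorem Nrm.size_opn {k x} : ∀ {N : Nrm}, (N.opn k x).size = N.size
  | .atm R => by simp [Nrm.size, R.size_opn]
  | .lam N => by simp [Nrm.size, N.size_opn]
end

@[simp] theorem Ty.size_opn {x} {A : Ty} : ∀ {k}, (A.opn k x).size = A.size := by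
  induction A <;> simp_all [Ty.size]

@[simp] theorem Srt.size_opn {x} {S : Srt} : ∀ {k}, (S.opn k x).size = S.size := by
  induction S <;> simp_all [Srt.size]

@[simp] theorem Knd.size_opn {x} {K : Knd} : ∀ {k}, (K.opn k x).size = K.size := by
  induction K <;> simp_all [Knd.size]

@[simp] theorem Cls.size_opn {x} {L : Cls} : ∀ {k}, (L.opn k x).size = L.size := by
  induction L <;> simp_all [Cls.size]

section
variable (N₀ : Nrm) {x₀ : Var} (α₀ : STy)

mutual
theorem SubstRR.of_notMem : ∀ {R : Atm}, R.LcAt 0 → x₀ ∉ R.fv → SubstRR N₀ x₀ α₀ R R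
  | .con _, _, _ => .con
  | .fvar _, _, h => .var (by simpa [eq_comm] using h)
  | .bvar _, h, _ => by simp at h
  | .app R N, h, hx => by
      simp at hx
      exact .app (SubstRR.of_notMem h.1 hx.1) (SubstN.of_notMem h.2 hx.2)
termination_by R => R.size
decreasing_by all_goals (simp [Atm.size]; try omega)
theorem SubstN.of_notMem : ∀ {N : Nrm}, N.LcAt 0 → x₀ ∉ N.fv → SubstN N₀ x₀ α₀ N N
  | .atm _, h, hx => .atom (SubstRR.of_notMem h hx)
  | .lam N, h, hx => .lam {x₀} fun y hy =>
      SubstN.of_notMem (Nrm.lcAt_opn.2 h) fun hm => by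
        rcases Nrm.mem_fv_of_opn hm with rfl | hm
        · simp at hy
        · exact hx hm
termination_by N => N.size
decreasing_by all_goals simp [Nrm.size]
end

theorem SubstP.of_notMem {P : ATy} (h : P.LcAt 0) (hx : x₀ ∉ P.fv) : SubstP N₀ x₀ α₀ P P := by
  induction P with
  | con => exact .con
  | app P N ih =>
    simp at hx
    exact .app (ih h.1 hx.1) (.of_notMem _ _ h.2 hx.2)

theorem SubstA.of_notMem : ∀ {A : Ty}, A.LcAt 0 → x₀ ∉ A.fv → SubstA N₀ x₀ α₀ A A
  | .atm _, h, hx => .atm (.of_notMem _ _ h hx)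
  | .pi A B, h, hx => by
      simp at hx
      exact .pi {x₀} (SubstA.of_notMem h.1 hx.1) fun y hy =>
        SubstA.of_notMem (Ty.lcAt_opn.2 h.2) fun hm => by
          rcases Ty.mem_fv_of_opn hm with rfl | hm
          · simp at hy
          · exact hx.2 hm
termination_by A => A.size
decreasing_by all_goals (simp [Ty.size]; try omega)

theorem SubstQ.of_notMem {Q : ASrt} (h : Q.LcAt 0) (hx : x₀ ∉ Q.fv) : SubstQ N₀ x₀ α₀ Q Q := by
  induction Q with
  | con => exact .con
  | app P N ih =>
    simp at hx
    exact .app (ih h.1 hx.1) (.of_notMem _ _ h.2 hx.2)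

theorem SubstS.of_notMem : ∀ {S : Srt}, S.LcAt 0 → x₀ ∉ S.fv → SubstS N₀ x₀ α₀ S S
  | .atm _, h, hx => .atm (.of_notMem _ _ h hx)
  | .pi S A T, h, hx => by
      simp at hx
      exact .pi {x₀} (SubstS.of_notMem h.1 hx.1) (.of_notMem _ _ h.2.1 hx.2.1) fun y hy =>
        SubstS.of_notMem (Srt.lcAt_opn.2 h.2.2) fun hm => by
          rcases Srt.mem_fv_of_opn hm with rfl | hm
          · simp at hy
          · exact hx.2.2 hm
  | .top, _, _ => .top
  | .inter S₁ S₂, h, hx => by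
      simp at hx
      exact .inter (SubstS.of_notMem h.1 hx.1) (SubstS.of_notMem h.2 hx.2)
termination_by S => S.size
decreasing_by all_goals (simp [Srt.size]; try omega)

theorem SubstK.of_notMem : ∀ {K : Knd}, K.LcAt 0 → x₀ ∉ K.fv → SubstK N₀ x₀ α₀ K K
  | .type, _, _ => .type
  | .pi A K, h, hx => by
      simp at hx
      exact .pi {x₀} (.of_notMem _ _ h.1 hx.1) fun y hy =>
        SubstK.of_notMem (Knd.lcAt_opn.2 h.2) fun hm => by
          rcases Knd.mem_fv_of_opn hm with rfl | hm
          · simp at hy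
          · exact hx.2 hm
termination_by K => K.size
decreasing_by all_goals simp [Knd.size]

theorem SubstL.of_notMem : ∀ {L : Cls}, L.LcAt 0 → x₀ ∉ L.fv → SubstL N₀ x₀ α₀ L L
  | .sort, _, _ => .sort
  | .pi S A L, h, hx => by
      simp at hx
      exact .pi {x₀} (.of_notMem _ _ h.1 hx.1) (.of_notMem _ _ h.2.1 hx.2.1) fun y hy =>
        SubstL.of_notMem (Cls.lcAt_opn.2 h.2.2) fun hm => by
          rcases Cls.mem_fv_of_opn hm with rfl | hm
          · simp at hy
          · exact hx.2.2 hm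
  | .top, _, _ => .top
  | .inter L₁ L₂, h, hx => by
      simp at hx
      exact .inter (SubstL.of_notMem h.1 hx.1) (SubstL.of_notMem h.2 hx.2)
termination_by L => L.size
decreasing_by all_goals (simp [Cls.size]; try omega)

end

/-! ### Determinism -/

/-- Choose a name outside four finite sets. -/
theorem exists_fresh₄ (F₁ F₂ F₃ F₄ : Finset Var) :
    ∃ y, y ∉ F₁ ∧ y ∉ F₂ ∧ y ∉ F₃ ∧ y ∉ F₄ := by
  obtain ⟨y, hy⟩ := exists_fresh (F₁ ∪ F₂ ∪ F₃ ∪ F₄)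
  exact ⟨y, by simpa [and_assoc] using hy⟩

/-- The head decides which relation applies: `SubstRR` requires it to differ from `x₀`, `SubstRN` to
be `x₀`. -/
theorem SubstRR.not_substRN : ∀ {N₀ x₀ α₀ R R' N β}, SubstRR N₀ x₀ α₀ R R' →
    ¬ SubstRN N₀ x₀ α₀ R N β
  | _, _, _, _, _, _, _, .var h, h' => by cases h'; exact h rfl
  | _, _, _, _, _, _, _, .con, h' => by cases h'
  | _, _, _, _, _, _, _, .app h₁ _, h' => by cases h' with | beta _ h₁' => exact h₁.not_substRN h₁'

mutual
theorem SubstN.det : ∀ {N₀ x₀ α₀ N N' N''}, SubstN N₀ x₀ α₀ N N' → SubstN N₀ x₀ α₀ N N'' →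
    N' = N''
  | _, _, _, _, _, _, .atom h, h' => by
      cases h' with
      | atom h' => rw [h.det h']
      | atomNorm h' => exact (h.not_substRN h').elim
  | _, _, _, _, _, _, .atomNorm h, h' => by
      cases h' with
      | atom h' => exact (h'.not_substRN h).elim
      | atomNorm h' => exact (h.det h').1
  | _, _, _, _, .lam N', _, .lam F h, h' => by
      cases h' with
      | @lam _ _ _ _ N'' F' h' =>
        obtain ⟨y, hy, hy', h₁, h₂⟩ := exists_fresh₄ F F' N'.fv N''.fv
        rw [Nrm.opn_inj h₁ h₂ ((h y hy).det (h' y hy'))]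
theorem SubstRR.det : ∀ {N₀ x₀ α₀ R R' R''}, SubstRR N₀ x₀ α₀ R R' → SubstRR N₀ x₀ α₀ R R'' →
    R' = R''
  | _, _, _, _, _, _, .var _, h' => by cases h'; rfl
  | _, _, _, _, _, _, .con, h' => by cases h'; rfl
  | _, _, _, _, _, _, .app h₁ h₂, h' => by
      cases h' with | app h₁' h₂' => rw [h₁.det h₁', h₂.det h₂']
theorem SubstRN.det : ∀ {N₀ x₀ α₀ R N' N'' β β'}, SubstRN N₀ x₀ α₀ R N' β →
    SubstRN N₀ x₀ α₀ R N'' β' → N' = N'' ∧ β = β'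
  | _, _, _, _, _, _, _, _, .var, h' => by cases h'; exact ⟨rfl, rfl⟩
  | _, _, _, _, _, _, _, _, .beta F h₁ h₂ h₃, h' => by
      cases h' with
      | beta F' h₁' h₂' h₃' =>
        obtain ⟨y, hy, hy', -⟩ := exists_fresh₄ F F' ∅ ∅
        obtain ⟨e, e'⟩ := h₁.det h₁'
        cases e; cases e'
        have := h₂.det h₂'
        subst this
        exact ⟨(h₃ y hy).det (h₃' y hy'), rfl⟩
end

section
variable {N₀ : Nrm} {x₀ : Var} {α₀ : STy}

theorem SubstP.det {P P' P''} (h : SubstP N₀ x₀ α₀ P P') (h' : SubstP N₀ x₀ α₀ P P'') :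
    P' = P'' := by
  induction h generalizing P'' with
  | con => cases h'; rfl
  | app _ h ih => cases h' with | app h₁ h₂ => rw [ih h₁, h.det h₂]

theorem SubstA.det {A A' A''} (h : SubstA N₀ x₀ α₀ A A') (h' : SubstA N₀ x₀ α₀ A A'') :
    A' = A'' := by
  induction h generalizing A'' with
  | atm h => cases h' with | atm h' => rw [h.det h']
  | @pi _ _ _ B' F _ _ ihA ihB =>
    cases h' with
    | @pi _ _ _ B'' F' hA hB =>
      obtain ⟨y, hy, hy', h₁, h₂⟩ := exists_fresh₄ F F' B'.fv B''.fv
      rw [ihA hA, Ty.opn_inj h₁ h₂ (ihB y hy (hB y hy'))]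

theorem SubstQ.det {Q Q' Q''} (h : SubstQ N₀ x₀ α₀ Q Q') (h' : SubstQ N₀ x₀ α₀ Q Q'') :
    Q' = Q'' := by
  induction h generalizing Q'' with
  | con => cases h'; rfl
  | app _ h ih => cases h' with | app h₁ h₂ => rw [ih h₁, h.det h₂]

theorem SubstS.det {S S' S''} (h : SubstS N₀ x₀ α₀ S S') (h' : SubstS N₀ x₀ α₀ S S'') :
    S' = S'' := by
  induction h generalizing S'' with
  | atm h => cases h' with | atm h' => rw [h.det h']
  | @pi _ _ _ _ _ T' F _ hA _ ihS ihT =>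
    cases h' with
    | @pi _ _ _ _ _ T'' F' hS hA' hT =>
      obtain ⟨y, hy, hy', h₁, h₂⟩ := exists_fresh₄ F F' T'.fv T''.fv
      rw [ihS hS, hA.det hA', Srt.opn_inj h₁ h₂ (ihT y hy (hT y hy'))]
  | top => cases h'; rfl
  | inter _ _ ih₁ ih₂ => cases h' with | inter h₁ h₂ => rw [ih₁ h₁, ih₂ h₂]

theorem SubstK.det {K K' K''} (h : SubstK N₀ x₀ α₀ K K') (h' : SubstK N₀ x₀ α₀ K K'') :
    K' = K'' := by
  induction h generalizing K'' with
  | type => cases h'; rfl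
  | @pi _ _ _ K' F hA _ ih =>
    cases h' with
    | @pi _ _ _ K'' F' hA' hK =>
      obtain ⟨y, hy, hy', h₁, h₂⟩ := exists_fresh₄ F F' K'.fv K''.fv
      rw [hA.det hA', Knd.opn_inj h₁ h₂ (ih y hy (hK y hy'))]

theorem SubstL.det {L L' L''} (h : SubstL N₀ x₀ α₀ L L') (h' : SubstL N₀ x₀ α₀ L L'') :
    L' = L'' := by
  induction h generalizing L'' with
  | sort => cases h'; rfl
  | @pi _ _ _ _ _ L' F hS hA _ ih =>
    cases h' with
    | @pi _ _ _ _ _ L'' F' hS' hA' hL =>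
      obtain ⟨y, hy, hy', h₁, h₂⟩ := exists_fresh₄ F F' L'.fv L''.fv
      rw [hS.det hS', hA.det hA', Cls.opn_inj h₁ h₂ (ih y hy (hL y hy'))]
  | top => cases h'; rfl
  | inter _ _ ih₁ ih₂ => cases h' with | inter h₁ h₂ => rw [ih₁ h₁, ih₂ h₂]

/-! ### Substitution under a binder

If the body of a binder can be substituted into for almost all names, the results agree. -/

/-- The result for one fresh name is abstracted to a body; equivariance makes that body correct for
almost all names, and determinism identifies its openings with the given results. Hence `p`
transfers without being equivariant itself. -/
theorem SubstN.exists_lam {p : Var → Nrm → Prop} (h₀ : N₀.LcAt 0) {F : Finset Var} {N : Nrm}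
    (h : ∀ y, y ∉ F → ∃ N', SubstN N₀ x₀ α₀ (N.opn 0 y) N' ∧ p y N') :
    ∃ N', SubstN N₀ x₀ α₀ (.lam N) (.lam N') ∧
      ∃ F' : Finset Var, ∀ y, y ∉ F' → p y (N'.opn 0 y) := by
  obtain ⟨y, hF, hN₀, hx₀, hN⟩ := exists_fresh₄ F N₀.fv {x₀} N.fv
  obtain ⟨N', hs, -⟩ := h y hF
  obtain ⟨N', hN', rfl⟩ := Nrm.exists_opn_eq y (hs.lc_output h₀)
  have hl := SubstN.lam_of_fresh hN₀ (by simpa [eq_comm] using hx₀) hN hN' hs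
  refine ⟨N', hl, ?_⟩
  cases hl with
  | lam F₁ hl =>
    refine ⟨F ∪ F₁, fun z hz => ?_⟩
    rw [Finset.notMem_union] at hz
    obtain ⟨M, hM, hp⟩ := h z hz.1
    rwa [(hl z hz.2).det hM]

theorem SubstA.exists_pi {p : Var → Ty → Prop} (h₀ : N₀.LcAt 0) {F : Finset Var} {A A' B : Ty}
    (hA : SubstA N₀ x₀ α₀ A A')
    (h : ∀ y, y ∉ F → ∃ B', SubstA N₀ x₀ α₀ (B.opn 0 y) B' ∧ p y B') :
    ∃ B', SubstA N₀ x₀ α₀ (.pi A B) (.pi A' B') ∧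
      ∃ F' : Finset Var, ∀ y, y ∉ F' → p y (B'.opn 0 y) := by
  obtain ⟨y, hF, hN₀, hx₀, hB⟩ := exists_fresh₄ F N₀.fv {x₀} B.fv
  obtain ⟨B', hs, -⟩ := h y hF
  obtain ⟨B', hB', rfl⟩ := Ty.exists_opn_eq y (hs.lc_output h₀)
  have hl := SubstA.pi_of_fresh hN₀ (by simpa [eq_comm] using hx₀) hB hB' hA hs
  refine ⟨B', hl, ?_⟩
  cases hl with
  | pi F₁ _ hl =>
    refine ⟨F ∪ F₁, fun z hz => ?_⟩
    rw [Finset.notMem_union] at hz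
    obtain ⟨M, hM, hp⟩ := h z hz.1
    rwa [(hl z hz.2).det hM]

theorem SubstS.exists_pi {p : Var → Srt → Prop} (h₀ : N₀.LcAt 0) {F : Finset Var}
    {S S' : Srt} {A A' : Ty} {T : Srt} (hS : SubstS N₀ x₀ α₀ S S') (hA : SubstA N₀ x₀ α₀ A A')
    (h : ∀ y, y ∉ F → ∃ T', SubstS N₀ x₀ α₀ (T.opn 0 y) T' ∧ p y T') :
    ∃ T', SubstS N₀ x₀ α₀ (.pi S A T) (.pi S' A' T') ∧
      ∃ F' : Finset Var, ∀ y, y ∉ F' → p y (T'.opn 0 y) := by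
  obtain ⟨y, hF, hN₀, hx₀, hT⟩ := exists_fresh₄ F N₀.fv {x₀} T.fv
  obtain ⟨T', hs, -⟩ := h y hF
  obtain ⟨T', hT', rfl⟩ := Srt.exists_opn_eq y (hs.lc_output h₀)
  have hl := SubstS.pi_of_fresh hN₀ (by simpa [eq_comm] using hx₀) hT hT' hS hA hs
  refine ⟨T', hl, ?_⟩
  cases hl with
  | pi F₁ _ _ hl =>
    refine ⟨F ∪ F₁, fun z hz => ?_⟩
    rw [Finset.notMem_union] at hz
    obtain ⟨M, hM, hp⟩ := h z hz.1
    rwa [(hl z hz.2).det hM]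

/-! ### Simple types -/

theorem SubstP.simple_eq {P P'} (h : SubstP N₀ x₀ α₀ P P') : P'.simple = P.simple := by
  induction h <;> simp_all

theorem SubstA.simple_eq {A A'} (h : SubstA N₀ x₀ α₀ A A') : A'.simple = A.simple := by
  induction h with
  | atm h => simpa using h.simple_eq
  | pi F _ _ ihA ihB =>
    have ⟨y, hy⟩ := exists_fresh F
    have := ihB y hy
    simp_all

theorem ATy.exists_simple_eq (P : ATy) : ∃ a, P.simple = .base a := by
  induction P with
  | con a => exact ⟨a, rfl⟩
  | app P N ih => exact ih

/-- The number of nodes of a simple type. -/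
def STy.size : STy → ℕ
  | .base _ => 1
  | .arr α β => α.size + β.size + 1

/-- A β step passes from an arrow type to its codomain. Consequently the domain at which the step
substitutes is strictly smaller than `α₀`, which is the termination measure of hereditary
substitution. -/
theorem SubstRN.size_le : ∀ {N₀ x₀ α₀ R N' β}, SubstRN N₀ x₀ α₀ R N' β → β.size ≤ α₀.size
  | _, _, _, _, _, _, .var => le_rfl
  | _, _, _, _, _, _, .beta _ h _ _ => by
      have := h.size_le
      simp only [STy.size] at this
      omega

end

/-! ## Composition of hereditary substitutions -/

/-- Substitutions at simple types `α₀` and `α₂` commute on normal terms. -/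
def SubstComm (α₀ α₂ : STy) : Prop :=
  ∀ ⦃N₀ x₀ N₂ N₂' x₂ N N' N''⦄, N₀.LcAt 0 → x₂ ∉ N₀.fv → x₀ ≠ x₂ →
    SubstN N₀ x₀ α₀ N₂ N₂' → SubstN N₂ x₂ α₂ N N' → SubstN N₀ x₀ α₀ N N'' →
    ∃ M, SubstN N₀ x₀ α₀ N' M ∧ SubstN N₂' x₂ α₂ N'' M

section
variable {α₀ : STy} {N₀ N₂' : Nrm} {x₀ : Var}

/-- An atomic term has only one head. -/
theorem SubstRN.not_substRN_of_ne : ∀ {N₂ x₂ α₂ R N' N'' β β'} (_ : x₀ ≠ x₂),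
    SubstRN N₂ x₂ α₂ R N' β → ¬ SubstRN N₀ x₀ α₀ R N'' β'
  | _, _, _, _, _, _, _, _, hne, .var, h' => by cases h'; exact hne rfl
  | _, _, _, _, _, _, _, _, hne, .beta _ h _ _, h' => by
      cases h' with | beta _ h' => exact SubstRN.not_substRN_of_ne hne h h'

mutual
-- Inner induction on the derivation of the substitution for `x₂`. The cases follow the head of the
-- atomic term: neither variable, `x₀`, or `x₂`. In the last two a β step on one side is matched by
-- a β step on the other, and the outer hypothesis commutes the smaller substitution it creates.
theorem SubstN.comm_aux : ∀ {N₂ x₂ α₂ N N' N''}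
    (_ : ∀ β β' : STy, β.size + β'.size < α₀.size + α₂.size → SubstComm β β')
    (_ : N₀.LcAt 0) (_ : x₂ ∉ N₀.fv) (_ : x₀ ≠ x₂) (_ : SubstN N₀ x₀ α₀ N₂ N₂'),
    SubstN N₂ x₂ α₂ N N' → SubstN N₀ x₀ α₀ N N'' →
    ∃ M, SubstN N₀ x₀ α₀ N' M ∧ SubstN N₂' x₂ α₂ N'' M
  | _, _, _, _, _, _, ih, hl, hx, hne, h₀₂, .atom h, h' => by
      cases h' with
      | atom h' =>
        obtain ⟨M, h₁, h₂⟩ := SubstRR.comm_aux ih hl hx hne h₀₂ h h'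
        exact ⟨.atm M, .atom h₁, .atom h₂⟩
      | atomNorm h' =>
        obtain ⟨M, h₁, h₂⟩ := SubstRR.comm_rn_aux ih hl hx hne h₀₂ h h'
        cases h₂ with
        | atom h₂ => exact ⟨_, .atomNorm h₁, .atom h₂⟩
        | atomNorm h₂ => exact ⟨_, .atomNorm h₁, .atomNorm h₂⟩
  | _, _, _, _, _, _, ih, hl, hx, hne, h₀₂, .atomNorm h, h' => by
      cases h' with
      | atom h' =>
        obtain ⟨M, h₁, h₂⟩ := SubstRN.comm_aux ih hl hx hne h₀₂ h h'
        cases h₁ with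
        | atom h₁ => exact ⟨_, .atom h₁, .atomNorm h₂⟩
        | atomNorm h₁ => exact ⟨_, .atomNorm h₁, .atomNorm h₂⟩
      | atomNorm h' => exact (SubstRN.not_substRN_of_ne hne h h').elim
  | _, x₂, _, _, .lam N', _, ih, hl, hx, hne, h₀₂, .lam F h, h' => by
      cases h' with
      | @lam _ _ _ _ N'' F' h' =>
        obtain ⟨y, hy⟩ := exists_fresh
          (F ∪ F' ∪ N'.fv ∪ N''.fv ∪ N₀.fv ∪ N₂'.fv ∪ {x₀} ∪ {x₂})
        simp only [Finset.mem_union, Finset.mem_singleton, not_or] at hy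
        obtain ⟨⟨⟨⟨⟨⟨⟨hF, hF'⟩, hN'⟩, hN''⟩, hN₀⟩, hN₂'⟩, hx₀⟩, hx₂⟩ := hy
        obtain ⟨M, h₁, h₂⟩ := SubstN.comm_aux ih hl hx hne h₀₂ (h y hF) (h' y hF')
        obtain ⟨M, hM, rfl⟩ := Nrm.exists_opn_eq y (h₁.lc_output hl)
        exact ⟨.lam M, .lam_of_fresh hN₀ (Ne.symm hx₀) hN' hM h₁,
          .lam_of_fresh hN₂' (Ne.symm hx₂) hN'' hM h₂⟩
termination_by structural _ _ _ _ _ _ _ _ _ _ _ h => h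
theorem SubstRR.comm_aux : ∀ {N₂ x₂ α₂ R R' R''}
    (_ : ∀ β β' : STy, β.size + β'.size < α₀.size + α₂.size → SubstComm β β')
    (_ : N₀.LcAt 0) (_ : x₂ ∉ N₀.fv) (_ : x₀ ≠ x₂) (_ : SubstN N₀ x₀ α₀ N₂ N₂'),
    SubstRR N₂ x₂ α₂ R R' → SubstRR N₀ x₀ α₀ R R'' →
    ∃ M, SubstRR N₀ x₀ α₀ R' M ∧ SubstRR N₂' x₂ α₂ R'' M
  | _, _, _, _, _, _, _, _, _, _, _, .var h, h' => by
      cases h' with | var h' => exact ⟨_, .var h', .var h⟩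
  | _, _, _, _, _, _, _, _, _, _, _, .con, h' => by cases h' with | con => exact ⟨_, .con, .con⟩
  | _, _, _, _, _, _, ih, hl, hx, hne, h₀₂, .app h₁ h₂, h' => by
      cases h' with
      | app h₁' h₂' =>
        obtain ⟨_, h₃, h₄⟩ := SubstRR.comm_aux ih hl hx hne h₀₂ h₁ h₁'
        obtain ⟨_, h₅, h₆⟩ := SubstN.comm_aux ih hl hx hne h₀₂ h₂ h₂'
        exact ⟨_, .app h₃ h₅, .app h₄ h₆⟩
termination_by structural _ _ _ _ _ _ _ _ _ _ _ h => h
theorem SubstRR.comm_rn_aux : ∀ {N₂ x₂ α₂ R R' N'' β}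
    (_ : ∀ β β' : STy, β.size + β'.size < α₀.size + α₂.size → SubstComm β β')
    (_ : N₀.LcAt 0) (_ : x₂ ∉ N₀.fv) (_ : x₀ ≠ x₂) (_ : SubstN N₀ x₀ α₀ N₂ N₂'),
    SubstRR N₂ x₂ α₂ R R' → SubstRN N₀ x₀ α₀ R N'' β →
    ∃ M, SubstRN N₀ x₀ α₀ R' M β ∧ SubstN N₂' x₂ α₂ N'' M
  | _, _, _, _, _, _, _, _, hl, hx, _, _, .var _, h' => by
      -- The head `x₀` becomes `N₀`, which does not contain `x₂` and is therefore untouched by the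
      -- other substitution.
      cases h' with | var => exact ⟨_, .var, .of_notMem _ _ hl hx⟩
  | _, _, _, _, _, _, _, _, _, _, _, _, .con, h' => by cases h'
  | _, x₂, α₂, _, _, N₁'', _, ih, hl, hx, hne, h₀₂, .app h₁ h₂, h' => by
      cases h' with
      | @beta _ _ _ _ _ N₁ Na'' _ _ β₂ F h₁' h₂' h₃' =>
        obtain ⟨M₁, h₃, h₄⟩ := SubstRR.comm_rn_aux ih hl hx hne h₀₂ h₁ h₁'
        obtain ⟨Ma, h₅, h₆⟩ := SubstN.comm_aux ih hl hx hne h₀₂ h₂ h₂'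
        cases h₄ with
        | @lam _ _ _ _ M₁ F₁ h₄ =>
          have key : ∀ z, z ∉ F ∪ F₁ ∪ N₂'.fv ∪ {x₂} →
              ∃ M, SubstN N₂' x₂ α₂ N₁'' M ∧ SubstN Ma z β₂ (M₁.opn 0 z) M := by
            intro z hz
            simp only [Finset.mem_union, Finset.mem_singleton, not_or] at hz
            obtain ⟨⟨⟨hF, hF₁⟩, hN₂'⟩, hx₂⟩ := hz
            -- The roles rotate: the substitution for `x₂` becomes the outer one and the β
            -- substitution for `z`, at a type smaller than `α₀`, the inner one.
            refine ih α₂ β₂ ?_ (h₀₂.lc_output hl) hN₂' (Ne.symm hx₂) h₆ (h₃' z hF) (h₄ z hF₁)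
            have := h₁'.size_le
            simp only [STy.size] at this
            omega
          obtain ⟨z₀, hz₀⟩ := exists_fresh (F ∪ F₁ ∪ N₂'.fv ∪ {x₂})
          obtain ⟨M, hM, -⟩ := key z₀ hz₀
          refine ⟨M, .beta (F ∪ F₁ ∪ N₂'.fv ∪ {x₂}) h₃ h₅ fun z hz => ?_, hM⟩
          -- The reduct is also the unique result of substituting into `N₁''`, which does not depend
          -- on `z`; hence one `M` serves all names.
          obtain ⟨M', hM₁, hM₂⟩ := key z hz
          rwa [hM.det hM₁]
termination_by structural _ _ _ _ _ _ _ _ _ _ _ _ h => h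
theorem SubstRN.comm_aux : ∀ {N₂ x₂ α₂ R N' R'' β}
    (_ : ∀ β β' : STy, β.size + β'.size < α₀.size + α₂.size → SubstComm β β')
    (_ : N₀.LcAt 0) (_ : x₂ ∉ N₀.fv) (_ : x₀ ≠ x₂) (_ : SubstN N₀ x₀ α₀ N₂ N₂'),
    SubstRN N₂ x₂ α₂ R N' β → SubstRR N₀ x₀ α₀ R R'' →
    ∃ M, SubstN N₀ x₀ α₀ N' M ∧ SubstRN N₂' x₂ α₂ R'' M β
  | _, _, _, _, _, _, _, _, _, _, _, h₀₂, .var, h' => by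
      cases h' with | var => exact ⟨_, h₀₂, .var⟩
  | _, x₂, α₂, _, N₁', _, _, ih, hl, hx, hne, h₀₂,
      @SubstRN.beta _ _ _ _ _ N₁ _ _ _ β₂ F h₁ h₂ h₃, h' => by
      cases h' with
      | app h₁' h₂' =>
        obtain ⟨M₁, h₄, h₅⟩ := SubstRN.comm_aux ih hl hx hne h₀₂ h₁ h₁'
        obtain ⟨Ma, h₆, h₇⟩ := SubstN.comm_aux ih hl hx hne h₀₂ h₂ h₂'
        cases h₄ with
        | @lam _ _ _ _ M₁ F₁ h₄ =>
          have key : ∀ z, z ∉ F ∪ F₁ ∪ N₀.fv ∪ {x₀} →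
              ∃ M, SubstN N₀ x₀ α₀ N₁' M ∧ SubstN Ma z β₂ (M₁.opn 0 z) M := by
            intro z hz
            simp only [Finset.mem_union, Finset.mem_singleton, not_or] at hz
            obtain ⟨⟨⟨hF, hF₁⟩, hN₀⟩, hx₀⟩ := hz
            refine ih α₀ β₂ ?_ hl hN₀ (Ne.symm hx₀) h₆ (h₃ z hF) (h₄ z hF₁)
            have := h₁.size_le
            simp only [STy.size] at this
            omega
          obtain ⟨z₀, hz₀⟩ := exists_fresh (F ∪ F₁ ∪ N₀.fv ∪ {x₀})
          obtain ⟨M, hM, -⟩ := key z₀ hz₀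
          refine ⟨M, hM, .beta (F ∪ F₁ ∪ N₀.fv ∪ {x₀}) h₅ h₇ fun z hz => ?_⟩
          obtain ⟨M', hM₁, hM₂⟩ := key z hz
          rwa [hM.det hM₁]
termination_by structural _ _ _ _ _ _ _ _ _ _ _ _ h => h
end

end

/-- A β step replaces one of the two simple types by a smaller one and may exchange their roles, so
the induction runs on the sum of the sizes. -/
theorem substComm (α₀ α₂ : STy) : SubstComm α₀ α₂ := by
  induction hn : α₀.size + α₂.size using Nat.strong_induction_on generalizing α₀ α₂ with
  | _ n ih =>
    subst hn
    intro N₀ x₀ N₂ N₂' x₂ N N' N'' hl hx hne h₀₂ h h'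
    exact SubstN.comm_aux (fun β β' hβ => ih _ hβ β β' rfl) hl hx hne h₀₂ h h'

section
variable {N₀ N₂ N₂' : Nrm} {x₀ x₂ : Var} {α₀ α₂ : STy}
  (hl : N₀.LcAt 0) (hx : x₂ ∉ N₀.fv) (hne : x₀ ≠ x₂) (h₀₂ : SubstN N₀ x₀ α₀ N₂ N₂')
include hl hx hne h₀₂

theorem SubstP.comm {P P' P''} (h : SubstP N₂ x₂ α₂ P P') (h' : SubstP N₀ x₀ α₀ P P'') :
    ∃ M, SubstP N₀ x₀ α₀ P' M ∧ SubstP N₂' x₂ α₂ P'' M := by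
  induction h generalizing P'' with
  | con => cases h'; exact ⟨_, .con, .con⟩
  | app _ h ih =>
    cases h' with
    | app h₁ h₂ =>
      obtain ⟨_, h₃, h₄⟩ := ih h₁
      obtain ⟨_, h₅, h₆⟩ := substComm α₀ α₂ hl hx hne h₀₂ h h₂
      exact ⟨_, .app h₃ h₅, .app h₄ h₆⟩

theorem SubstA.comm {A A' A''} (h : SubstA N₂ x₂ α₂ A A') (h' : SubstA N₀ x₀ α₀ A A'') :
    ∃ M, SubstA N₀ x₀ α₀ A' M ∧ SubstA N₂' x₂ α₂ A'' M := by
  induction h generalizing A'' with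
  | atm h =>
    cases h' with
    | atm h' =>
      obtain ⟨_, h₁, h₂⟩ := h.comm hl hx hne h₀₂ h'
      exact ⟨_, .atm h₁, .atm h₂⟩
  | @pi _ _ _ B' F _ _ ihA ihB =>
    cases h' with
    | @pi _ _ _ B'' F' hA hB =>
      obtain ⟨_, h₁, h₂⟩ := ihA hA
      obtain ⟨y, hy⟩ := exists_fresh
        (F ∪ F' ∪ B'.fv ∪ B''.fv ∪ N₀.fv ∪ N₂'.fv ∪ {x₀} ∪ {x₂})
      simp only [Finset.mem_union, Finset.mem_singleton, not_or] at hy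
      obtain ⟨⟨⟨⟨⟨⟨⟨hF, hF'⟩, hB'⟩, hB''⟩, hN₀⟩, hN₂'⟩, hx₀⟩, hx₂⟩ := hy
      obtain ⟨M, h₃, h₄⟩ := ihB y hF (hB y hF')
      obtain ⟨M, hM, rfl⟩ := Ty.exists_opn_eq y (h₃.lc_output hl)
      exact ⟨_, .pi_of_fresh hN₀ (Ne.symm hx₀) hB' hM h₁ h₃,
        .pi_of_fresh hN₂' (Ne.symm hx₂) hB'' hM h₂ h₄⟩

theorem SubstQ.comm {Q Q' Q''} (h : SubstQ N₂ x₂ α₂ Q Q') (h' : SubstQ N₀ x₀ α₀ Q Q'') :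
    ∃ M, SubstQ N₀ x₀ α₀ Q' M ∧ SubstQ N₂' x₂ α₂ Q'' M := by
  induction h generalizing Q'' with
  | con => cases h'; exact ⟨_, .con, .con⟩
  | app _ h ih =>
    cases h' with
    | app h₁ h₂ =>
      obtain ⟨_, h₃, h₄⟩ := ih h₁
      obtain ⟨_, h₅, h₆⟩ := substComm α₀ α₂ hl hx hne h₀₂ h h₂
      exact ⟨_, .app h₃ h₅, .app h₄ h₆⟩

theorem SubstS.comm {S S' S''} (h : SubstS N₂ x₂ α₂ S S') (h' : SubstS N₀ x₀ α₀ S S'') :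
    ∃ M, SubstS N₀ x₀ α₀ S' M ∧ SubstS N₂' x₂ α₂ S'' M := by
  induction h generalizing S'' with
  | atm h =>
    cases h' with
    | atm h' =>
      obtain ⟨_, h₁, h₂⟩ := h.comm hl hx hne h₀₂ h'
      exact ⟨_, .atm h₁, .atm h₂⟩
  | @pi _ _ _ _ _ T' F _ hA _ ihS ihT =>
    cases h' with
    | @pi _ _ _ _ _ T'' F' hS hA' hT =>
      obtain ⟨_, h₁, h₂⟩ := ihS hS
      obtain ⟨_, h₃, h₄⟩ := hA.comm hl hx hne h₀₂ hA'
      obtain ⟨y, hy⟩ := exists_fresh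
        (F ∪ F' ∪ T'.fv ∪ T''.fv ∪ N₀.fv ∪ N₂'.fv ∪ {x₀} ∪ {x₂})
      simp only [Finset.mem_union, Finset.mem_singleton, not_or] at hy
      obtain ⟨⟨⟨⟨⟨⟨⟨hF, hF'⟩, hT'⟩, hT''⟩, hN₀⟩, hN₂'⟩, hx₀⟩, hx₂⟩ := hy
      obtain ⟨M, h₅, h₆⟩ := ihT y hF (hT y hF')
      obtain ⟨M, hM, rfl⟩ := Srt.exists_opn_eq y (h₅.lc_output hl)
      exact ⟨_, .pi_of_fresh hN₀ (Ne.symm hx₀) hT' hM h₁ h₃ h₅,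
        .pi_of_fresh hN₂' (Ne.symm hx₂) hT'' hM h₂ h₄ h₆⟩
  | top => cases h'; exact ⟨_, .top, .top⟩
  | inter _ _ ih₁ ih₂ =>
    cases h' with
    | inter h₁ h₂ =>
      obtain ⟨_, h₃, h₄⟩ := ih₁ h₁
      obtain ⟨_, h₅, h₆⟩ := ih₂ h₂
      exact ⟨_, .inter h₃ h₅, .inter h₄ h₆⟩

theorem SubstK.comm {K K' K''} (h : SubstK N₂ x₂ α₂ K K') (h' : SubstK N₀ x₀ α₀ K K'') :
    ∃ M, SubstK N₀ x₀ α₀ K' M ∧ SubstK N₂' x₂ α₂ K'' M := by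
  induction h generalizing K'' with
  | type => cases h'; exact ⟨_, .type, .type⟩
  | @pi _ _ _ K' F hA _ ih =>
    cases h' with
    | @pi _ _ _ K'' F' hA' hK =>
      obtain ⟨_, h₁, h₂⟩ := hA.comm hl hx hne h₀₂ hA'
      obtain ⟨y, hy⟩ := exists_fresh
        (F ∪ F' ∪ K'.fv ∪ K''.fv ∪ N₀.fv ∪ N₂'.fv ∪ {x₀} ∪ {x₂})
      simp only [Finset.mem_union, Finset.mem_singleton, not_or] at hy
      obtain ⟨⟨⟨⟨⟨⟨⟨hF, hF'⟩, hK'⟩, hK''⟩, hN₀⟩, hN₂'⟩, hx₀⟩, hx₂⟩ := hy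
      obtain ⟨M, h₃, h₄⟩ := ih y hF (hK y hF')
      obtain ⟨M, hM, rfl⟩ := Knd.exists_opn_eq y (h₃.lc_output hl)
      exact ⟨_, .pi_of_fresh hN₀ (Ne.symm hx₀) hK' hM h₁ h₃,
        .pi_of_fresh hN₂' (Ne.symm hx₂) hK'' hM h₂ h₄⟩

theorem SubstL.comm {L L' L''} (h : SubstL N₂ x₂ α₂ L L') (h' : SubstL N₀ x₀ α₀ L L'') :
    ∃ M, SubstL N₀ x₀ α₀ L' M ∧ SubstL N₂' x₂ α₂ L'' M := by
  induction h generalizing L'' with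
  | sort => cases h'; exact ⟨_, .sort, .sort⟩
  | @pi _ _ _ _ _ L' F hS hA _ ih =>
    cases h' with
    | @pi _ _ _ _ _ L'' F' hS' hA' hL =>
      obtain ⟨_, h₁, h₂⟩ := hS.comm hl hx hne h₀₂ hS'
      obtain ⟨_, h₃, h₄⟩ := hA.comm hl hx hne h₀₂ hA'
      obtain ⟨y, hy⟩ := exists_fresh
        (F ∪ F' ∪ L'.fv ∪ L''.fv ∪ N₀.fv ∪ N₂'.fv ∪ {x₀} ∪ {x₂})
      simp only [Finset.mem_union, Finset.mem_singleton, not_or] at hy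
      obtain ⟨⟨⟨⟨⟨⟨⟨hF, hF'⟩, hL'⟩, hL''⟩, hN₀⟩, hN₂'⟩, hx₀⟩, hx₂⟩ := hy
      obtain ⟨M, h₅, h₆⟩ := ih y hF (hL y hF')
      obtain ⟨M, hM, rfl⟩ := Cls.exists_opn_eq y (h₅.lc_output hl)
      exact ⟨_, .pi_of_fresh hN₀ (Ne.symm hx₀) hL' hM h₁ h₃ h₅,
        .pi_of_fresh hN₂' (Ne.symm hx₂) hL'' hM h₂ h₄ h₆⟩
  | top => cases h'; exact ⟨_, .top, .top⟩
  | inter _ _ ih₁ ih₂ =>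
    cases h' with
    | inter h₁ h₂ =>
      obtain ⟨_, h₃, h₄⟩ := ih₁ h₁
      obtain ⟨_, h₅, h₆⟩ := ih₂ h₂
      exact ⟨_, .inter h₃ h₅, .inter h₄ h₆⟩

/-! ### Substituting into the result of instantiating a binder -/

omit hx hne in
-- Commutation in the form used by the application rules: the instance `Br` and the substituted body
-- `B'` have a common reduct, and determinism makes it independent of the name opening the binder.
theorem substA_inst {B B' : Ty} {Br : Ty} {F F' : Finset Var}
    (h : ∀ x, x ∉ F → SubstA N₂ x α₂ (B.opn 0 x) Br)
    (h' : ∀ x, x ∉ F' → SubstA N₀ x₀ α₀ (B.opn 0 x) (B'.opn 0 x)) :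
    ∃ M, SubstA N₀ x₀ α₀ Br M ∧
      ∀ x, x ∉ F ∪ F' ∪ N₀.fv ∪ {x₀} → SubstA N₂' x α₂ (B'.opn 0 x) M := by
  have key : ∀ x, x ∉ F ∪ F' ∪ N₀.fv ∪ {x₀} →
      ∃ M, SubstA N₀ x₀ α₀ Br M ∧ SubstA N₂' x α₂ (B'.opn 0 x) M := by
    intro x hx
    simp only [Finset.mem_union, Finset.mem_singleton, not_or] at hx
    obtain ⟨⟨⟨hF, hF'⟩, hN₀⟩, hx₀⟩ := hx
    exact (h x hF).comm hl hN₀ (Ne.symm hx₀) h₀₂ (h' x hF')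
  obtain ⟨z, hz⟩ := exists_fresh (F ∪ F' ∪ N₀.fv ∪ {x₀})
  obtain ⟨M, hM, -⟩ := key z hz
  refine ⟨M, hM, fun x hx => ?_⟩
  obtain ⟨M', hM₁, hM₂⟩ := key x hx
  rwa [hM.det hM₁]

omit hx hne in
theorem substS_inst {T T' : Srt} {Tr : Srt} {F F' : Finset Var}
    (h : ∀ x, x ∉ F → SubstS N₂ x α₂ (T.opn 0 x) Tr)
    (h' : ∀ x, x ∉ F' → SubstS N₀ x₀ α₀ (T.opn 0 x) (T'.opn 0 x)) :
    ∃ M, SubstS N₀ x₀ α₀ Tr M ∧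
      ∀ x, x ∉ F ∪ F' ∪ N₀.fv ∪ {x₀} → SubstS N₂' x α₂ (T'.opn 0 x) M := by
  have key : ∀ x, x ∉ F ∪ F' ∪ N₀.fv ∪ {x₀} →
      ∃ M, SubstS N₀ x₀ α₀ Tr M ∧ SubstS N₂' x α₂ (T'.opn 0 x) M := by
    intro x hx
    simp only [Finset.mem_union, Finset.mem_singleton, not_or] at hx
    obtain ⟨⟨⟨hF, hF'⟩, hN₀⟩, hx₀⟩ := hx
    exact (h x hF).comm hl hN₀ (Ne.symm hx₀) h₀₂ (h' x hF')
  obtain ⟨z, hz⟩ := exists_fresh (F ∪ F' ∪ N₀.fv ∪ {x₀})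
  obtain ⟨M, hM, -⟩ := key z hz
  refine ⟨M, hM, fun x hx => ?_⟩
  obtain ⟨M', hM₁, hM₂⟩ := key x hx
  rwa [hM.det hM₁]

omit hx hne in
theorem substK_inst {K K' : Knd} {Kr : Knd} {F F' : Finset Var}
    (h : ∀ x, x ∉ F → SubstK N₂ x α₂ (K.opn 0 x) Kr)
    (h' : ∀ x, x ∉ F' → SubstK N₀ x₀ α₀ (K.opn 0 x) (K'.opn 0 x)) :
    ∃ M, SubstK N₀ x₀ α₀ Kr M ∧
      ∀ x, x ∉ F ∪ F' ∪ N₀.fv ∪ {x₀} → SubstK N₂' x α₂ (K'.opn 0 x) M := by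
  have key : ∀ x, x ∉ F ∪ F' ∪ N₀.fv ∪ {x₀} →
      ∃ M, SubstK N₀ x₀ α₀ Kr M ∧ SubstK N₂' x α₂ (K'.opn 0 x) M := by
    intro x hx
    simp only [Finset.mem_union, Finset.mem_singleton, not_or] at hx
    obtain ⟨⟨⟨hF, hF'⟩, hN₀⟩, hx₀⟩ := hx
    exact (h x hF).comm hl hN₀ (Ne.symm hx₀) h₀₂ (h' x hF')
  obtain ⟨z, hz⟩ := exists_fresh (F ∪ F' ∪ N₀.fv ∪ {x₀})
  obtain ⟨M, hM, -⟩ := key z hz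
  refine ⟨M, hM, fun x hx => ?_⟩
  obtain ⟨M', hM₁, hM₂⟩ := key x hx
  rwa [hM.det hM₁]

omit hx hne in
theorem substL_inst {L L' : Cls} {Lr : Cls} {F F' : Finset Var}
    (h : ∀ x, x ∉ F → SubstL N₂ x α₂ (L.opn 0 x) Lr)
    (h' : ∀ x, x ∉ F' → SubstL N₀ x₀ α₀ (L.opn 0 x) (L'.opn 0 x)) :
    ∃ M, SubstL N₀ x₀ α₀ Lr M ∧
      ∀ x, x ∉ F ∪ F' ∪ N₀.fv ∪ {x₀} → SubstL N₂' x α₂ (L'.opn 0 x) M := by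
  have key : ∀ x, x ∉ F ∪ F' ∪ N₀.fv ∪ {x₀} →
      ∃ M, SubstL N₀ x₀ α₀ Lr M ∧ SubstL N₂' x α₂ (L'.opn 0 x) M := by
    intro x hx
    simp only [Finset.mem_union, Finset.mem_singleton, not_or] at hx
    obtain ⟨⟨⟨hF, hF'⟩, hN₀⟩, hx₀⟩ := hx
    exact (h x hF).comm hl hN₀ (Ne.symm hx₀) h₀₂ (h' x hF')
  obtain ⟨z, hz⟩ := exists_fresh (F ∪ F' ∪ N₀.fv ∪ {x₀})
  obtain ⟨M, hM, -⟩ := key z hz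
  refine ⟨M, hM, fun x hx => ?_⟩
  obtain ⟨M', hM₁, hM₂⟩ := key x hx
  rwa [hM.det hM₁]

end

/-! ## η-expansion and hereditary substitution -/

/-- Expansion only appends arguments built from fresh variables, which the substitution leaves
alone. -/
theorem SubstRR.expand {N₀ : Nrm} {x₀ : Var} {α₀ : STy} (β : STy) : ∀ {R R' : Atm},
    R.LcAt 0 → R'.LcAt 0 → SubstRR N₀ x₀ α₀ R R' →
    SubstN N₀ x₀ α₀ (expand β R) (expand β R') := by
  induction β with
  | base a => exact fun _ _ h => .atom h
  | arr β₂ β₁ _ ih₁ =>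
    intro R R' hR hR' h
    refine .lam {x₀} fun y hy => ?_
    simp only [Finset.mem_singleton] at hy
    have hy' : (LFR.expand β₂ (.fvar y)).LcAt 0 := lcAt_expand_fvar
    rw [expand_body_opn hR, expand_body_opn hR']
    exact ih₁ ⟨hR, hy'⟩ ⟨hR', hy'⟩ (.app h (.of_notMem _ _ hy' (by simpa using Ne.symm hy)))

/-- If a substitution into `η_β(R)` is defined, then so is the substitution into `R`. -/
theorem SubstN.of_expand {N₀ : Nrm} {x₀ : Var} {α₀ : STy} (β : STy) : ∀ {R : Atm} {M : Nrm},
    R.LcAt 0 → SubstN N₀ x₀ α₀ (expand β R) M →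
    (∃ R', SubstRR N₀ x₀ α₀ R R') ∨ ∃ N γ, SubstRN N₀ x₀ α₀ R N γ := by
  induction β with
  | base a =>
    intro R M _ h
    cases h with
    | atom h => exact .inl ⟨_, h⟩
    | atomNorm h => exact .inr ⟨_, _, h⟩
  | arr β₂ β₁ _ ih₁ =>
    intro R M hR h
    cases h with
    | lam F h =>
      obtain ⟨y, hy⟩ := exists_fresh F
      have h := h y hy
      rw [expand_body_opn hR] at h
      rcases ih₁ (by exact ⟨hR, lcAt_expand_fvar⟩) h with ⟨_, h⟩ | ⟨_, _, h⟩
      · cases h with | app h _ => exact .inl ⟨_, h⟩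
      · cases h with | beta _ h _ _ => exact .inr ⟨_, _, h⟩

/-- Substituting `η_α(x)` for `y` renames `y` to `x`. -/
def ExpandRenames (α : STy) : Prop :=
  ∀ ⦃x y N N'⦄, SubstN (expand α (.fvar x)) y α N N' → N' = N.ren (Function.update id y x)

theorem Nrm.ren_update_opn {N : Nrm} {y : Var} (hy : y ∉ N.fv) (x : Var) {k} :
    (N.opn k y).ren (Function.update id y x) = N.opn k x := by
  rw [ren_opn, ren_eq_self, Function.update_self]
  exact fun v hv => by simp [Function.update_of_ne (ne_of_mem_of_notMem hv hy)]

/-- The β steps triggered by the arguments that expansion adds merely rename bound variables, so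
they rebuild `N`. The induction on `β` needs the renaming property only at smaller types, which lets
it be used inside the proof of that property. -/
theorem SubstRN.eq_of_expand {N₀ : Nrm} {x₀ : Var} {α₀ : STy} (β : STy)
    (ih : ∀ γ : STy, γ.size < β.size → ExpandRenames γ) : ∀ {R : Atm} {N M : Nrm},
    SubstRN N₀ x₀ α₀ R N β → SubstN N₀ x₀ α₀ (expand β R) M → M = N := by
  induction β with
  | base a =>
    intro R N M h h'
    cases h' with
    | atom h' => exact (h'.not_substRN h).elim
    | atomNorm h' => exact (h'.det h).1
  | arr β₂ β₁ _ ih₁ =>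
    intro R N M h h'
    cases h' with
    | @lam _ _ _ _ M F h' =>
      have hR := h.lc_input
      have key : ∀ w, w ∉ F ∪ {x₀} →
          ∃ N₁, N = .lam N₁ ∧ M.opn 0 w = N₁.opn 0 w := by
        intro w hw
        simp only [Finset.mem_union, Finset.mem_singleton, not_or] at hw
        have h' := h' w hw.1
        have hlc : (expand β₂ (.fvar w)).LcAt 0 := lcAt_expand_fvar
        rw [expand_body_opn hR] at h'
        rcases SubstN.of_expand β₁ (by exact ⟨hR, hlc⟩) h' with ⟨_, h₁⟩ | ⟨N', γ, h₁⟩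
        · cases h₁ with | app h₁ _ => exact (h₁.not_substRN h).elim
        · have h₁' := h₁
          cases h₁ with
          | @beta _ _ _ _ _ N₁ _ _ _ _ F' h₁ h₂ h₃ =>
            obtain ⟨e₁, e₂⟩ := h₁.det h
            cases e₂
            subst e₁
            refine ⟨N₁, rfl, ?_⟩
            obtain ⟨u, hu, hu', -⟩ := exists_fresh₄ F' N₁.fv ∅ ∅
            have e := h₂.det (.of_notMem _ _ hlc (by simpa using Ne.symm hw.2))
            subst e
            -- The β step puts `η(w)` for `u`; at the smaller type `β₂` this is a renaming, and the
            -- result is `N₁` opened at `w`.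
            have := ih β₂ (by simp only [STy.size]; omega) (h₃ u hu)
            rw [Nrm.ren_update_opn hu'] at this
            rw [← this]
            exact ih₁ (fun γ hγ => ih γ (by simp only [STy.size]; omega)) h₁' h'
      obtain ⟨w₀, hw₀⟩ := exists_fresh (F ∪ {x₀})
      obtain ⟨N₁, rfl, -⟩ := key w₀ hw₀
      obtain ⟨w, hw, hM, hN, -⟩ := exists_fresh₄ (F ∪ {x₀}) M.fv N₁.fv ∅
      obtain ⟨N₁', e, e'⟩ := key w hw
      cases e
      rw [Nrm.opn_inj hM hN e']

section
variable {x : Var}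

mutual
theorem SubstN.expandRenames_aux : ∀ {N₀ y α N N'} (_ : N₀ = expand α (.fvar x))
    (_ : ∀ γ : STy, γ.size < α.size → ExpandRenames γ), SubstN N₀ y α N N' →
    N' = N.ren (Function.update id y x)
  | _, _, _, _, _, e, ih, .atom h => by rw [SubstRR.expandRenames_aux e ih h]; rfl
  | _, _, _, _, _, e, ih, .atomNorm h => by rw [SubstRN.expandRenames_aux e ih h]; rfl
  | _, y, _, .lam N, .lam N', e, ih, .lam F h => by
      obtain ⟨z, hz, hzy, hN', hN⟩ :=
        exists_fresh₄ F {y} N'.fv (N.ren (Function.update id y x)).fv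
      have := SubstN.expandRenames_aux e ih (h z hz)
      rw [Nrm.ren_opn, Function.update_of_ne (by simpa using hzy)] at this
      simp [Nrm.opn_inj hN' hN this]
theorem SubstRR.expandRenames_aux : ∀ {N₀ y α R R'} (_ : N₀ = expand α (.fvar x))
    (_ : ∀ γ : STy, γ.size < α.size → ExpandRenames γ), SubstRR N₀ y α R R' →
    R' = R.ren (Function.update id y x)
  | _, _, _, _, _, _, _, .var h => by simp [Function.update_of_ne h]
  | _, _, _, _, _, _, _, .con => rfl
  | _, _, _, _, _, e, ih, .app h₁ h₂ => by
      rw [SubstRR.expandRenames_aux e ih h₁, SubstN.expandRenames_aux e ih h₂]; rfl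
-- With head `y` the result is the η-expansion of the renamed term at the type still to be consumed;
-- at base type the expansion is the term itself, as the normal case requires.
theorem SubstRN.expandRenames_aux : ∀ {N₀ y α R N' β} (_ : N₀ = expand α (.fvar x))
    (_ : ∀ γ : STy, γ.size < α.size → ExpandRenames γ), SubstRN N₀ y α R N' β →
    N' = expand β (R.ren (Function.update id y x))
  | _, _, _, _, _, _, e, _, .var => by simp [e]
  | _, y, α, .app R₁ N₂, N₁', _, e, ih,
      @SubstRN.beta _ _ _ _ _ _ N₂' _ α₁ α₂ F h₁ h₂ h₃ => by
      have e₁ := SubstRN.expandRenames_aux e ih h₁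
      have e₂ := SubstN.expandRenames_aux e ih h₂
      have hsize := h₁.size_le
      simp only [STy.size] at hsize
      have hR₁ : (R₁.ren (Function.update id y x)).LcAt 0 := Atm.lcAt_ren.2 h₁.lc_input
      have hN₂ : N₂'.LcAt 0 := e₂ ▸ Nrm.lcAt_ren.2 h₂.lc_input
      simp only [expand, Nrm.lam.injEq] at e₁
      subst e₁
      obtain ⟨z, hz, hzR, -⟩ := exists_fresh₄ F (R₁.ren (Function.update id y x)).fv ∅ ∅
      have h₃ := h₃ z hz
      rw [expand_body_opn hR₁] at h₃
      have hlc : (expand α₂ (.fvar z)).LcAt 0 := lcAt_expand_fvar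
      have hvac : SubstRR N₂' z α₂ _ _ := SubstRR.of_notMem N₂' α₂ hR₁ hzR
      rcases SubstN.of_expand α₁ (by exact ⟨hR₁, hlc⟩) h₃ with ⟨_, h⟩ | ⟨_, _, h⟩
      · cases h with
        | app h h' =>
          -- Substituting `N₂'` for `z` in `η(z)` returns `N₂'`. Renaming is invoked only below
          -- `α₂`, which is itself smaller than `α`.
          have := SubstRN.eq_of_expand α₂ (fun γ hγ => ih γ (by omega)) .var h'
          subst this
          have h₄ := SubstRR.expand α₁ (by exact ⟨hR₁, hlc⟩) (by exact ⟨hR₁, hN₂⟩) (.app hvac h')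
          rw [h₃.det h₄, e₂]; rfl
      · cases h with | beta _ h _ _ => exact (hvac.not_substRN h).elim
end

end

theorem expandRenames (α : STy) : ExpandRenames α := by
  induction hn : α.size using Nat.strong_induction_on generalizing α with
  | _ n ih =>
    subst hn
    intro x y N N' h
    exact SubstN.expandRenames_aux rfl (fun γ hγ => ih _ hγ γ rfl) h

/-- Substituting `N` for `x` in `η_α(x)` gives `N`. -/
theorem SubstN.eq_of_expand_fvar {α : STy} {N M : Nrm} {x : Var}
    (h : SubstN N x α (expand α (.fvar x)) M) : M = N :=
  SubstRN.eq_of_expand α (fun γ _ => expandRenames γ) .var h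

section
variable {α : STy} {x y : Var}

theorem SubstP.expandRenames {P P'} (h : SubstP (expand α (.fvar x)) y α P P') :
    P' = P.ren (Function.update id y x) := by
  induction h with
  | con => rfl
  | app _ h ih => rw [ih, LFR.expandRenames α h]; rfl

theorem SubstA.expandRenames {A A'} (h : SubstA (expand α (.fvar x)) y α A A') :
    A' = A.ren (Function.update id y x) := by
  induction h with
  | atm h => rw [h.expandRenames]; rfl
  | @pi _ _ B B' F _ _ ihA ihB =>
    obtain ⟨z, hz, hzy, hB', hB⟩ :=
      exists_fresh₄ F {y} B'.fv (B.ren (Function.update id y x)).fv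
    have := ihB z hz
    rw [Ty.ren_opn, Function.update_of_ne (by simpa using hzy)] at this
    rw [ihA, Ty.opn_inj hB' hB this]; rfl

theorem SubstQ.expandRenames {Q Q'} (h : SubstQ (expand α (.fvar x)) y α Q Q') :
    Q' = Q.ren (Function.update id y x) := by
  induction h with
  | con => rfl
  | app _ h ih => rw [ih, LFR.expandRenames α h]; rfl

theorem SubstS.expandRenames {S S'} (h : SubstS (expand α (.fvar x)) y α S S') :
    S' = S.ren (Function.update id y x) := by
  induction h with
  | atm h => rw [h.expandRenames]; rfl
  | @pi _ _ _ _ T T' F _ hA _ ihS ihT =>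
    obtain ⟨z, hz, hzy, hT', hT⟩ :=
      exists_fresh₄ F {y} T'.fv (T.ren (Function.update id y x)).fv
    have := ihT z hz
    rw [Srt.ren_opn, Function.update_of_ne (by simpa using hzy)] at this
    rw [ihS, hA.expandRenames, Srt.opn_inj hT' hT this]; rfl
  | top => rfl
  | inter _ _ ih₁ ih₂ => rw [ih₁, ih₂]; rfl

theorem SubstN.eq_of_self {N N'} (h : SubstN (expand α (.fvar x)) x α N N') : N' = N := by
  rw [LFR.expandRenames α h, Nrm.ren_eq_self]
  exact fun v _ => congrFun (Function.update_eq_self x id) v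

theorem SubstA.eq_of_self {A A'} (h : SubstA (expand α (.fvar x)) x α A A') : A' = A := by
  rw [h.expandRenames, Ty.ren_eq_self]
  exact fun v _ => congrFun (Function.update_eq_self x id) v

theorem SubstS.eq_of_self {S S'} (h : SubstS (expand α (.fvar x)) x α S S') : S' = S := by
  rw [h.expandRenames, Srt.ren_eq_self]
  exact fun v _ => congrFun (Function.update_eq_self x id) v

theorem SubstA.eq_opn {B : Ty} {B'} (hy : y ∉ B.fv)
    (h : SubstA (expand α (.fvar x)) y α (B.opn 0 y) B') : B' = B.opn 0 x := by
  rw [h.expandRenames, Ty.ren_opn, Ty.ren_eq_self, Function.update_self]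
  exact fun v hv => by simp [Function.update_of_ne (ne_of_mem_of_notMem hv hy)]

theorem SubstS.eq_opn {T : Srt} {T'} (hy : y ∉ T.fv)
    (h : SubstS (expand α (.fvar x)) y α (T.opn 0 y) T') : T' = T.opn 0 x := by
  rw [h.expandRenames, Srt.ren_opn, Srt.ren_eq_self, Function.update_self]
  exact fun v hv => by simp [Function.update_of_ne (ne_of_mem_of_notMem hv hy)]

end

/-! ## Weakening -/

section
variable {Sg : Sig}

mutual
-- Raw judgments consult a context only through membership and do not require distinct names, so
-- inclusion suffices and no bound name has to be changed.
theorem SynthTy.weaken : ∀ {Γ Δ R A}, SynthTy Sg Γ R A → Γ ⊆ Δ → SynthTy Sg Δ R A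
  | _, _, _, _, .con h, _ => .con h
  | _, _, _, _, .var h, hs => .var (hs h)
  | _, _, _, _, .app F h₁ h₂ h₃, hs => .app F (h₁.weaken hs) (h₂.weaken hs) h₃
theorem CheckTy.weaken : ∀ {Γ Δ N A}, CheckTy Sg Γ N A → Γ ⊆ Δ → CheckTy Sg Δ N A
  | _, _, _, _, .atm h, hs => .atm (h.weaken hs)
  | _, _, _, _, .lam F h, hs => .lam F fun x hx => (h x hx).weaken (List.cons_subset_cons _ hs)
end

theorem SynthKnd.weaken {Γ Δ P K} (h : SynthKnd Sg Γ P K) (hs : Γ ⊆ Δ) : SynthKnd Sg Δ P K := by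
  induction h with
  | con h => exact .con h
  | app F _ h₂ h₃ ih => exact .app F ih (h₂.weaken hs) h₃

theorem IsType.weaken {Γ Δ A} (h : IsType Sg Γ A) (hs : Γ ⊆ Δ) : IsType Sg Δ A := by
  induction h generalizing Δ with
  | atm h => exact .atm (h.weaken hs)
  | pi F _ _ ihA ihB => exact .pi F (ihA hs) fun x hx => ihB x hx (List.cons_subset_cons _ hs)

mutual
theorem Synth.weaken : ∀ {Γ Δ R S}, Synth Sg Γ R S → Γ ⊆ Δ → Synth Sg Δ R S
  | _, _, _, _, .con h, _ => .con h
  | _, _, _, _, .var h, hs => .var (hs h)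
  | _, _, _, _, .app F h₁ h₂ h₃, hs => .app F (h₁.weaken hs) (h₂.weaken hs) h₃
  | _, _, _, _, .interL h, hs => .interL (h.weaken hs)
  | _, _, _, _, .interR h, hs => .interR (h.weaken hs)
theorem Check.weaken : ∀ {Γ Δ N S}, Check Sg Γ N S → Γ ⊆ Δ → Check Sg Δ N S
  | _, _, _, _, .switch h hle, hs => .switch (h.weaken hs) hle
  | _, _, _, _, .lam F h, hs => .lam F fun x hx => (h x hx).weaken (List.cons_subset_cons _ hs)
  | _, _, _, _, .top, _ => .top
  | _, _, _, _, .inter h₁ h₂, hs => .inter (h₁.weaken hs) (h₂.weaken hs)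
end

theorem SynthCls.weaken {Γ Δ Q P L} (h : SynthCls Sg Γ Q P L) (hs : Γ ⊆ Δ) :
    SynthCls Sg Δ Q P L := by
  induction h with
  | con h => exact .con h
  | app F _ h₂ h₃ ih => exact .app F ih (h₂.weaken hs) h₃
  | interL _ ih => exact .interL ih
  | interR _ ih => exact .interR ih

theorem Refines.weaken {Γ Δ S A} (h : Refines Sg Γ S A) (hs : Γ ⊆ Δ) : Refines Sg Δ S A := by
  induction h generalizing Δ with
  | atm h => exact .atm (h.weaken hs)
  | pi F _ _ ihS ihT => exact .pi F (ihS hs) fun x hx => ihT x hx (List.cons_subset_cons _ hs)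
  | top => exact .top
  | inter _ _ ih₁ ih₂ => exact .inter (ih₁ hs) (ih₂ hs)

theorem Ctx.erase_subset {Γ Δ : Ctx} (hs : Γ ⊆ Δ) : Γ.erase ⊆ Δ.erase :=
  List.map_subset _ hs

theorem RefinesTy.weaken {Γ Δ S A} (h : RefinesTy Sg Γ S A) (hs : Γ ⊆ Δ) : RefinesTy Sg Δ S A :=
  ⟨h.1.weaken (Ctx.erase_subset hs), h.2.weaken hs⟩

/-! ## Scoping -/

theorem mem_names_of_opn {Γ : LFCtx} {x v : Var} {A : Ty} {s t : Finset Var}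
    (hs : s ⊆ t) (hx : x ∉ s) (h : ∀ v ∈ t, v ∈ ((x, A) :: Γ).map Prod.fst) (hv : v ∈ s) :
    v ∈ Γ.map Prod.fst := by
  have := h v (hs hv)
  rw [List.map_cons, List.mem_cons] at this
  exact this.resolve_left (ne_of_mem_of_notMem hv hx)

mutual
theorem SynthTy.scoped : ∀ {Γ R A}, SynthTy Sg Γ R A →
    R.LcAt 0 ∧ ∀ v ∈ R.fv, v ∈ Γ.map Prod.fst
  | _, _, _, .con _ => by simp
  | _, _, _, .var h => ⟨trivial, fun v hv => by
      rw [Atm.fv, Finset.mem_singleton] at hv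
      exact hv ▸ List.mem_map_of_mem (f := Prod.fst) h⟩
  | _, _, _, .app _ h₁ h₂ _ => ⟨⟨h₁.scoped.1, h₂.scoped.1⟩, fun v hv => by
      rcases Finset.mem_union.1 hv with hv | hv
      · exact h₁.scoped.2 v hv
      · exact h₂.scoped.2 v hv⟩
theorem CheckTy.scoped : ∀ {Γ N A}, CheckTy Sg Γ N A →
    N.LcAt 0 ∧ ∀ v ∈ N.fv, v ∈ Γ.map Prod.fst
  | _, _, _, .atm h => h.scoped
  | _, .lam N, _, .lam F h => by
      obtain ⟨x, hx, hN, -⟩ := exists_fresh₄ F N.fv ∅ ∅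
      have := (h x hx).scoped
      exact ⟨Nrm.lcAt_opn.1 this.1, fun v (hv : v ∈ N.fv) =>
        mem_names_of_opn Nrm.fv_subset_opn hN this.2 hv⟩
end

theorem SynthKnd.scoped {Γ P K} (h : SynthKnd Sg Γ P K) :
    P.LcAt 0 ∧ ∀ v ∈ P.fv, v ∈ Γ.map Prod.fst := by
  induction h with
  | con => simp
  | app _ _ h _ ih =>
    refine ⟨⟨ih.1, h.scoped.1⟩, fun v hv => ?_⟩
    rcases Finset.mem_union.1 hv with hv | hv
    · exact ih.2 v hv
    · exact h.scoped.2 v hv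

theorem IsType.scoped {Γ A} (h : IsType Sg Γ A) :
    A.LcAt 0 ∧ ∀ v ∈ A.fv, v ∈ Γ.map Prod.fst := by
  induction h with
  | atm h => exact h.scoped
  | @pi _ _ B F _ _ ihA ihB =>
    obtain ⟨x, hx, hB, -⟩ := exists_fresh₄ F B.fv ∅ ∅
    have := ihB x hx
    refine ⟨⟨ihA.1, Ty.lcAt_opn.1 this.1⟩, fun v hv => ?_⟩
    rcases Finset.mem_union.1 hv with hv | hv
    · exact ihA.2 v hv
    · exact mem_names_of_opn Ty.fv_subset_opn hB this.2 hv

theorem IsKnd.scoped {Γ K} (h : IsKnd Sg Γ K) :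
    K.LcAt 0 ∧ ∀ v ∈ K.fv, v ∈ Γ.map Prod.fst := by
  induction h with
  | type => simp
  | @pi _ _ K F hA _ ih =>
    obtain ⟨x, hx, hK, -⟩ := exists_fresh₄ F K.fv ∅ ∅
    have := ih x hx
    refine ⟨⟨hA.scoped.1, Knd.lcAt_opn.1 this.1⟩, fun v hv => ?_⟩
    rcases Finset.mem_union.1 hv with hv | hv
    · exact hA.scoped.2 v hv
    · exact mem_names_of_opn Knd.fv_subset_opn hK this.2 hv

/-- The arguments of an atomic sort are those of the type it refines. -/
theorem SynthCls.scoped {Γ Q P L} (h : SynthCls Sg Γ Q P L) :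
    (P.LcAt 0 → Q.LcAt 0) ∧ Q.fv ⊆ P.fv := by
  induction h with
  | con => simp
  | app _ _ _ _ ih => exact ⟨fun h => ⟨ih.1 h.1, h.2⟩, Finset.union_subset_union_left ih.2⟩
  | interL _ ih => exact ih
  | interR _ ih => exact ih

theorem subset_of_opn {x : Var} {s s' t t' : Finset Var} (hs : s ⊆ s') (hx : x ∉ s)
    (ht : ∀ v ∈ t', v = x ∨ v ∈ t) (h : s' ⊆ t') : s ⊆ t := fun v hv =>
  (ht v (h (hs hv))).resolve_left (ne_of_mem_of_notMem hv hx)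

/-- A sort has the same arguments and domain types as the type it refines, so its scope is bounded
by `A` without any condition on `Γ`. -/
theorem Refines.scoped {Γ S A} (h : Refines Sg Γ S A) :
    (A.LcAt 0 → S.LcAt 0) ∧ S.fv ⊆ A.fv := by
  induction h with
  | atm h => exact h.scoped
  | @pi _ _ A T B F _ _ ihS ihT =>
    obtain ⟨x, hx, hT, -⟩ := exists_fresh₄ F T.fv ∅ ∅
    have := ihT x hx
    refine ⟨fun h => ⟨ihS.1 h.1, h.1, Srt.lcAt_opn.1 (this.1 (Ty.lcAt_opn.2 h.2))⟩, ?_⟩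
    exact Finset.union_subset_union (Finset.union_subset ihS.2 subset_rfl)
      (subset_of_opn Srt.fv_subset_opn hT (fun v => Ty.mem_fv_of_opn) this.2)
  | top => simp
  | inter _ _ ih₁ ih₂ =>
    exact ⟨fun h => ⟨ih₁.1 h, ih₂.1 h⟩, Finset.union_subset ih₁.2 ih₂.2⟩

theorem RefinesCls.scoped {Γ L K} (h : RefinesCls Sg Γ L K) :
    (K.LcAt 0 → L.LcAt 0) ∧ L.fv ⊆ K.fv := by
  induction h with
  | sort => simp
  | @pi _ _ A L K F hS _ ih =>
    obtain ⟨x, hx, hL, -⟩ := exists_fresh₄ F L.fv ∅ ∅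
    have := ih x hx
    refine ⟨fun h => ⟨hS.scoped.1 h.1, h.1, Cls.lcAt_opn.1 (this.1 (Knd.lcAt_opn.2 h.2))⟩, ?_⟩
    exact Finset.union_subset_union (Finset.union_subset hS.scoped.2 subset_rfl)
      (subset_of_opn Cls.fv_subset_opn hL (fun v => Knd.mem_fv_of_opn) this.2)
  | top => simp
  | inter _ _ ih₁ ih₂ =>
    exact ⟨fun h => ⟨ih₁.1 h, ih₂.1 h⟩, Finset.union_subset ih₁.2 ih₂.2⟩

theorem RefinesTy.scoped {Γ S A} (h : RefinesTy Sg Γ S A) :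
    (A.LcAt 0 ∧ S.LcAt 0) ∧ ∀ v, v ∈ A.fv ∨ v ∈ S.fv → v ∈ Γ.dom := by
  have hA := h.1.scoped
  refine ⟨⟨hA.1, h.2.scoped.1 hA.1⟩, fun v hv => ?_⟩
  have := hA.2 v (hv.elim id fun hv => h.2.scoped.2 hv)
  simpa [Ctx.erase, Ctx.dom, Function.comp_def] using this

end

/-- Everything declared in the signature is closed. -/
structure Sig.Closed (Sg : Sig) : Prop where
  tyKind : ∀ {a K}, Decl.tyKind a K ∈ Sg → K.LcAt 0 ∧ K.fv = ∅
  tmType : ∀ {c A}, Decl.tmType c A ∈ Sg → A.LcAt 0 ∧ A.fv = ∅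
  srtRef : ∀ {s a L}, Decl.srtRef s a L ∈ Sg → L.LcAt 0 ∧ L.fv = ∅
  tmSort : ∀ {c S}, Decl.tmSort c S ∈ Sg → S.LcAt 0 ∧ S.fv = ∅

/-- Declarations are checked in the empty context; sorts and classes inherit closedness from the
types and kinds they refine. The metatheory uses well-formedness of the signature only through this
consequence, by which substitution fixes every declaration. -/
theorem WfSig.closed {Sg : Sig} (h : WfSig Sg) : Sg.Closed := by
  have empty {s : Finset Var} (h : ∀ v ∈ s, v ∈ ([] : LFCtx).map Prod.fst) : s = ∅ :=
    Finset.eq_empty_of_forall_notMem fun v hv => by simpa using h v hv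
  induction h with
  | nil => constructor <;> simp
  | @tyKind _ a K _ hK _ ih =>
    refine ⟨fun h => ?_, fun h => ih.tmType (by simpa using h),
      fun h => ih.srtRef (by simpa using h), fun h => ih.tmSort (by simpa using h)⟩
    rcases List.mem_cons.1 h with e | h
    · cases e; exact ⟨hK.scoped.1, empty hK.scoped.2⟩
    · exact ih.tyKind h
  | tmType _ hA _ ih =>
    refine ⟨fun h => ih.tyKind (by simpa using h), fun h => ?_,
      fun h => ih.srtRef (by simpa using h), fun h => ih.tmSort (by simpa using h)⟩
    rcases List.mem_cons.1 h with e | h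
    · cases e; exact ⟨hA.scoped.1, empty hA.scoped.2⟩
    · exact ih.tmType h
  | srtRef _ hK hL _ ih =>
    refine ⟨fun h => ih.tyKind (by simpa using h), fun h => ih.tmType (by simpa using h),
      fun h => ?_, fun h => ih.tmSort (by simpa using h)⟩
    rcases List.mem_cons.1 h with e | h
    · cases e
      have := ih.tyKind hK
      exact ⟨hL.scoped.1 this.1, Finset.subset_empty.1 (this.2 ▸ hL.scoped.2)⟩
    · exact ih.srtRef h
  | tmSort _ hA hS _ ih =>
    refine ⟨fun h => ih.tyKind (by simpa using h), fun h => ih.tmType (by simpa using h),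
      fun h => ih.srtRef (by simpa using h), fun h => ?_⟩
    rcases List.mem_cons.1 h with e | h
    · cases e
      have := ih.tmType hA
      exact ⟨hS.scoped.1 this.1, Finset.subset_empty.1 (this.2 ▸ hS.scoped.2)⟩
    · exact ih.tmSort h
  | subsort _ _ _ ih =>
    exact ⟨fun h => ih.tyKind (by simpa using h), fun h => ih.tmType (by simpa using h),
      fun h => ih.srtRef (by simpa using h), fun h => ih.tmSort (by simpa using h)⟩

/-! ## Substitution for types -/

/-- The names that occur in an LF context. -/
def LFCtx.fv : LFCtx → Finset Var
  | [] => ∅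
  | (x, A) :: Γ => {x} ∪ A.fv ∪ LFCtx.fv Γ

theorem LFCtx.mem_fv {Γ : LFCtx} {x A} (h : (x, A) ∈ Γ) : x ∈ Γ.fv ∧ A.fv ⊆ Γ.fv := by
  induction Γ with
  | nil => simp at h
  | cons d Γ ih =>
    rcases List.mem_cons.1 h with rfl | h
    · exact ⟨by simp [fv], fun v hv => by simp [fv, hv]⟩
    · exact ⟨by simp [fv, (ih h).1], fun v hv => by simp [fv, (ih h).2 hv]⟩

theorem LFCtx.names_subset_fv {Γ : LFCtx} {x} (h : x ∈ Γ.map Prod.fst) : x ∈ Γ.fv := by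
  obtain ⟨⟨x, A⟩, hm, rfl⟩ := List.mem_map.1 h
  exact (mem_fv hm).1

/-- All declared types are locally closed. -/
def LFCtx.Lc (Γ : LFCtx) : Prop := ∀ ⦃x A⦄, (x, A) ∈ Γ → A.LcAt 0

theorem LFCtx.Lc.cons {Γ : LFCtx} (h : Γ.Lc) {x A} (hA : A.LcAt 0) : LFCtx.Lc ((x, A) :: Γ) := by
  intro y B hy
  rcases List.mem_cons.1 hy with e | hy
  · cases e; exact hA
  · exact h hy

/-- The substitution `[N₀/x₀]` sends the declarations of `Γ` to declarations of `Δ`, except those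
of `x₀`, for which `N₀` is a well-typed instance in `Δ`.  The name `x₀` may be declared in `Δ`. -/
def LFSubstMap (Sg : Sig) (N₀ : Nrm) (x₀ : Var) (α₀ : STy) (Γ Δ : LFCtx) : Prop :=
  ∀ ⦃y A⦄, (y, A) ∈ Γ → ∃ A', SubstA N₀ x₀ α₀ A A' ∧
    (y ≠ x₀ ∧ (y, A') ∈ Δ ∨ y = x₀ ∧ A.simple = α₀ ∧ CheckTy Sg Δ N₀ A')

section
variable {Sg : Sig} {N₀ : Nrm} {x₀ : Var} {α₀ : STy}

theorem LFSubstMap.cons {Γ Δ y A A'} (h : LFSubstMap Sg N₀ x₀ α₀ Γ Δ) (hy : y ≠ x₀)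
    (hA : SubstA N₀ x₀ α₀ A A') : LFSubstMap Sg N₀ x₀ α₀ ((y, A) :: Γ) ((y, A') :: Δ) := by
  intro z B hz
  rcases List.mem_cons.1 hz with e | hz
  · cases e; exact ⟨A', hA, .inl ⟨hy, by simp⟩⟩
  · obtain ⟨B', hB, h⟩ := h hz
    refine ⟨B', hB, h.imp (fun h => ⟨h.1, by simp [h.2]⟩) fun h => ⟨h.1, h.2.1, ?_⟩⟩
    exact h.2.2.weaken (List.subset_cons_self _ _)

/-- The case of a β step, where `x₀` is the fresh name opening the body. -/
theorem LFSubstMap.single {Δ A} (hΔ : Δ.Lc) (hx : x₀ ∉ Δ.fv) (hA : A.LcAt 0) (hxA : x₀ ∉ A.fv)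
    (h : CheckTy Sg Δ N₀ A) : LFSubstMap Sg N₀ x₀ A.simple ((x₀, A) :: Δ) Δ := by
  intro y B hy
  rcases List.mem_cons.1 hy with e | hy
  · cases e; exact ⟨A, .of_notMem _ _ hA hxA, .inr ⟨rfl, rfl, h⟩⟩
  · have := LFCtx.mem_fv hy
    exact ⟨B, .of_notMem _ _ (hΔ hy) fun h => hx (this.2 h),
      .inl ⟨ne_of_mem_of_notMem this.1 hx, hy⟩⟩

/-- The substitution property of `Γ ⊢ N ⇐ A` at the simple type `α`. -/
def CheckTySubst (Sg : Sig) (α : STy) : Prop :=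
  ∀ ⦃N₀ x₀ Γ Δ N A A'⦄, N₀.LcAt 0 → LFCtx.Lc Δ → LFSubstMap Sg N₀ x₀ α Γ Δ →
    CheckTy Sg Γ N A → SubstA N₀ x₀ α A A' → ∃ N', SubstN N₀ x₀ α N N' ∧ CheckTy Sg Δ N' A'

mutual
-- If the head is not `x₀` the result is atomic and still synthesizes. If it is `x₀` the result is
-- normal and can only be checked; the returned simple type is then the erasure of the synthesized
-- type, which makes the next argument fit the domain of the β step.
theorem SynthTy.subst_aux (hSg : Sg.Closed) (h₀ : N₀.LcAt 0)
    (ih : ∀ β : STy, β.size < α₀.size → CheckTySubst Sg β) : ∀ {Γ Δ R A},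
    Δ.Lc → LFSubstMap Sg N₀ x₀ α₀ Γ Δ → SynthTy Sg Γ R A →
    ∃ A', SubstA N₀ x₀ α₀ A A' ∧
      ((∃ R', SubstRR N₀ x₀ α₀ R R' ∧ SynthTy Sg Δ R' A') ∨
        ∃ N', SubstRN N₀ x₀ α₀ R N' A.simple ∧ CheckTy Sg Δ N' A')
  | _, _, _, _, _, _, .con h =>
      have hA := hSg.tmType h
      ⟨_, .of_notMem _ _ hA.1 (by simp [hA.2]), .inl ⟨_, .con, .con h⟩⟩
  | _, _, _, _, _, hm, .var h => by
      obtain ⟨A', hA, ⟨hne, h⟩ | ⟨rfl, rfl, h⟩⟩ := hm h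
      · exact ⟨A', hA, .inl ⟨_, .var hne, .var h⟩⟩
      · exact ⟨A', hA, .inr ⟨_, .var, h⟩⟩
  | _, Δ, _, _, hΔ, hm, @SynthTy.app _ _ R N A B Br F h₁ h₂ h₃ => by
      obtain ⟨_, hpi, hR⟩ := SynthTy.subst_aux hSg h₀ ih hΔ hm h₁
      cases hpi with
      | @pi _ A' _ B' F' hA hB =>
        obtain ⟨N', hN, hN'⟩ := CheckTy.subst_aux hSg h₀ ih hΔ hm h₂ hA
        obtain ⟨M, hM, hM'⟩ := substA_inst h₀ hN h₃ hB
        refine ⟨M, hM, ?_⟩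
        rcases hR with ⟨R', hR, hR'⟩ | ⟨N₁, hR, hR'⟩
        · rw [← hA.simple_eq] at hM'
          exact .inl ⟨_, .app hR hN, .app _ hR' hN' hM'⟩
        · right
          have hBr : Br.simple = B.simple := by
            obtain ⟨z, hz⟩ := exists_fresh F
            simpa using (h₃ z hz).simple_eq
          have hsize : A.simple.size < α₀.size := by
            have := hR.size_le
            simp only [Ty.simple, STy.size] at this
            omega
          cases hR' with
          | @lam _ N₁ _ _ F₁ hN₁ =>
            obtain ⟨z, hz⟩ := exists_fresh
              (F ∪ F' ∪ N₀.fv ∪ {x₀} ∪ F₁ ∪ Δ.fv ∪ A'.fv ∪ N'.fv ∪ N₁.fv)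
            -- The union is regrouped so that its first part is literally the set excluded by
            -- `substA_inst`.
            rw [Finset.union_assoc, Finset.union_assoc, Finset.union_assoc, Finset.union_assoc,
              Finset.notMem_union] at hz
            obtain ⟨hz₁, hz⟩ := hz
            simp only [Finset.mem_union, not_or] at hz
            obtain ⟨hz₂, hz₃, hz₄, hz₅, hz₆⟩ := hz
            have hmap := LFSubstMap.single hΔ hz₃ (hA.lc_output h₀) hz₄ hN'
            rw [hA.simple_eq] at hmap
            obtain ⟨M', hs, hc⟩ := ih A.simple hsize (hN.lc_output h₀) hΔ hmap
              (hN₁ z hz₂) (hM' z hz₁)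
            have hzM : z ∉ M'.fv := fun h => hz₃ (LFCtx.names_subset_fv (hc.scoped.2 z h))
            rw [Ty.simple, ← hBr] at hR
            -- The induction hypothesis gave a reduct for the single name `z`; the β rule wants
            -- almost all names, and `M'` does not contain `z`.
            refine ⟨M', .beta (N'.fv ∪ N₁.fv ∪ M'.fv) hR hN fun w hw => ?_, hc⟩
            simp only [Finset.mem_union, not_or] at hw
            exact hs.change_var hz₅ hz₆ hzM hw.1.1 hw.1.2 hw.2
theorem CheckTy.subst_aux (hSg : Sg.Closed) (h₀ : N₀.LcAt 0)
    (ih : ∀ β : STy, β.size < α₀.size → CheckTySubst Sg β) : ∀ {Γ Δ N A A'},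
    Δ.Lc → LFSubstMap Sg N₀ x₀ α₀ Γ Δ → CheckTy Sg Γ N A → SubstA N₀ x₀ α₀ A A' →
    ∃ N', SubstN N₀ x₀ α₀ N N' ∧ CheckTy Sg Δ N' A'
  | _, _, _, _, _, hΔ, hm, @CheckTy.atm _ _ R P h, hA => by
      obtain ⟨A', hA', hR⟩ := SynthTy.subst_aux hSg h₀ ih hΔ hm h
      cases hA.det hA'
      cases hA with
      | atm hA =>
        rcases hR with ⟨R', hR, hR'⟩ | ⟨N', hR, hR'⟩
        · exact ⟨_, .atom hR, .atm hR'⟩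
        · cases hR' with
          | atm hR' =>
            -- `atomNorm` demands a base type, and an atomic type erases to one.
            obtain ⟨a, ha⟩ := P.exists_simple_eq
            rw [Ty.simple, ha] at hR
            exact ⟨_, .atomNorm hR, .atm hR'⟩
  | _, Δ, _, _, _, hΔ, hm, @CheckTy.lam _ _ N A B F h, hA => by
      cases hA with
      | @pi _ A' _ B' F' hA hB =>
        have key : ∀ y, y ∉ F ∪ F' ∪ {x₀} → ∃ N', SubstN N₀ x₀ α₀ (N.opn 0 y) N' ∧
            CheckTy Sg ((y, A') :: Δ) N' (B'.opn 0 y) := by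
          intro y hy
          simp only [Finset.mem_union, Finset.mem_singleton, not_or] at hy
          exact CheckTy.subst_aux hSg h₀ ih (hΔ.cons (hA.lc_output h₀)) (hm.cons hy.2 hA)
            (h y hy.1.1) (hB y hy.1.2)
        obtain ⟨N', hs, F'', hc⟩ := SubstN.exists_lam h₀ key
        exact ⟨.lam N', hs, .lam F'' hc⟩
end

theorem checkTySubst (hSg : Sg.Closed) (α : STy) : CheckTySubst Sg α := by
  induction hn : α.size using Nat.strong_induction_on generalizing α with
  | _ n ih =>
    subst hn
    intro N₀ x₀ Γ Δ N A A' h₀ hΔ hm h hA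
    exact h.subst_aux hSg h₀ (fun β hβ => ih _ hβ β rfl) hΔ hm hA

theorem SynthKnd.subst (hSg : Sg.Closed) (h₀ : N₀.LcAt 0) {Γ Δ P K} (hΔ : Δ.Lc)
    (hm : LFSubstMap Sg N₀ x₀ α₀ Γ Δ) (h : SynthKnd Sg Γ P K) :
    ∃ P' K', SubstP N₀ x₀ α₀ P P' ∧ SubstK N₀ x₀ α₀ K K' ∧ SynthKnd Sg Δ P' K' := by
  induction h with
  | con h =>
    have hK := hSg.tyKind h
    exact ⟨_, _, .con, .of_notMem _ _ hK.1 (by simp [hK.2]), .con h⟩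
  | app F _ h₂ h₃ ih =>
    obtain ⟨P', _, hP, hpi, hP'⟩ := ih
    cases hpi with
    | pi F' hA hK =>
      obtain ⟨N', hN, hN'⟩ := checkTySubst hSg α₀ h₀ hΔ hm h₂ hA
      obtain ⟨M, hM, hM'⟩ := substK_inst h₀ hN h₃ hK
      rw [← hA.simple_eq] at hM'
      exact ⟨_, M, .app hP hN, hM, .app _ hP' hN' hM'⟩

theorem IsType.subst (hSg : Sg.Closed) (h₀ : N₀.LcAt 0) {Γ Δ A} (hΔ : Δ.Lc)
    (hm : LFSubstMap Sg N₀ x₀ α₀ Γ Δ) (h : IsType Sg Γ A) :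
    ∃ A', SubstA N₀ x₀ α₀ A A' ∧ IsType Sg Δ A' := by
  induction h generalizing Δ with
  | atm h =>
    obtain ⟨P', _, hP, hK, h⟩ := h.subst hSg h₀ hΔ hm
    cases hK
    exact ⟨_, .atm hP, .atm h⟩
  | @pi _ A B F _ _ ihA ihB =>
    obtain ⟨A', hA, hA'⟩ := ihA hΔ hm
    have key : ∀ y, y ∉ F ∪ {x₀} → ∃ B', SubstA N₀ x₀ α₀ (B.opn 0 y) B' ∧
        IsType Sg ((y, A') :: Δ) B' := by
      intro y hy
      simp only [Finset.mem_union, Finset.mem_singleton, not_or] at hy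
      exact ihB y hy.1 (hΔ.cons hA'.scoped.1) (hm.cons hy.2 hA)
    obtain ⟨B', hs, F', hc⟩ := SubstA.exists_pi h₀ hA key
    exact ⟨_, hs, .pi F' hA' hc⟩

end

/-! ## Substitution for sorts -/

/-- The function sorts in `S` follow the arrows of the simple type. -/
def Srt.Compat : Srt → STy → Prop
  | .atm _, _ => True
  | .pi _ _ _, .base _ => False
  | .pi S A T, .arr α β => A.simple = α ∧ S.Compat α ∧ T.Compat β
  | .top, _ => True
  | .inter S₁ S₂, α => S₁.Compat α ∧ S₂.Compat α

theorem Srt.compat_opn {x} {S : Srt} : ∀ {k α}, (S.opn k x).Compat α ↔ S.Compat α := by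
  induction S with
  | atm | top => simp [Compat]
  | pi S A T ihS ihT => intro k α; cases α <;> simp [Compat, ihS, ihT]
  | inter S₁ S₂ ih₁ ih₂ => simp [Compat, ih₁, ih₂]

theorem SubstS.compat {N₀ x₀ α₀ S S'} (h : SubstS N₀ x₀ α₀ S S') :
    ∀ {α}, S.Compat α → S'.Compat α := by
  induction h with
  | atm | top => exact fun _ => trivial
  | pi F _ hA _ ihS ihT =>
    rintro (_ | ⟨α, β⟩) h
    · exact h
    · obtain ⟨y, hy⟩ := exists_fresh F
      exact ⟨hA.simple_eq.trans h.1, ihS h.2.1,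
        Srt.compat_opn.1 (ihT y hy (Srt.compat_opn.2 h.2.2))⟩
  | inter _ _ ih₁ ih₂ => exact fun h => ⟨ih₁ h.1, ih₂ h.2⟩

theorem Refines.compat {Sg Γ S A} (h : Refines Sg Γ S A) : S.Compat A.simple := by
  induction h with
  | atm | top => trivial
  | pi F _ _ ihS ihT =>
    obtain ⟨y, hy⟩ := exists_fresh F
    exact ⟨rfl, ihS, Srt.compat_opn.1 (Ty.simple_opn ▸ ihT y hy)⟩
  | inter _ _ ih₁ ih₂ => exact ⟨ih₁, ih₂⟩

/-- The names that occur in a context. -/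
def Ctx.fv : Ctx → Finset Var
  | [] => ∅
  | (x, S, A) :: Γ => {x} ∪ S.fv ∪ A.fv ∪ Ctx.fv Γ

theorem Ctx.mem_fv {Γ : Ctx} {x S A} (h : (x, S, A) ∈ Γ) :
    x ∈ Γ.fv ∧ S.fv ⊆ Γ.fv ∧ A.fv ⊆ Γ.fv := by
  induction Γ with
  | nil => simp at h
  | cons d Γ ih =>
    rcases List.mem_cons.1 h with rfl | h
    · exact ⟨by simp [fv], fun v hv => by simp [fv, hv], fun v hv => by simp [fv, hv]⟩
    · exact ⟨by simp [fv, (ih h).1], fun v hv => by simp [fv, (ih h).2.1 hv],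
        fun v hv => by simp [fv, (ih h).2.2 hv]⟩

/-- All declared sorts and types are locally closed. -/
def Ctx.Lc (Γ : Ctx) : Prop := ∀ ⦃x S A⦄, (x, S, A) ∈ Γ → S.LcAt 0 ∧ A.LcAt 0

theorem Ctx.Lc.cons {Γ : Ctx} (h : Γ.Lc) {x S A} (hS : S.LcAt 0) (hA : A.LcAt 0) :
    Ctx.Lc ((x, S, A) :: Γ) := by
  intro y T B hy
  rcases List.mem_cons.1 hy with e | hy
  · cases e; exact ⟨hS, hA⟩
  · exact h hy

/-- The substitution `[N₀/x₀]` sends the declarations of `Γ` to declarations of `Δ`, except those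
of `x₀`, for which `N₀` is a well-sorted instance in `Δ`.  The name `x₀` may be declared in `Δ`. -/
def SubstMap (Sg : Sig) (N₀ : Nrm) (x₀ : Var) (α₀ : STy) (Γ Δ : Ctx) : Prop :=
  ∀ ⦃y S A⦄, (y, S, A) ∈ Γ → ∃ S' A', SubstS N₀ x₀ α₀ S S' ∧ SubstA N₀ x₀ α₀ A A' ∧
    (y ≠ x₀ ∧ (y, S', A') ∈ Δ ∨ y = x₀ ∧ S.Compat α₀ ∧ Check Sg Δ N₀ S')

section
variable {Sg : Sig} {N₀ : Nrm} {x₀ : Var} {α₀ : STy}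

theorem SubstMap.cons {Γ Δ y S S' A A'} (h : SubstMap Sg N₀ x₀ α₀ Γ Δ) (hy : y ≠ x₀)
    (hS : SubstS N₀ x₀ α₀ S S') (hA : SubstA N₀ x₀ α₀ A A') :
    SubstMap Sg N₀ x₀ α₀ ((y, S, A) :: Γ) ((y, S', A') :: Δ) := by
  intro z T B hz
  rcases List.mem_cons.1 hz with e | hz
  · cases e; exact ⟨S', A', hS, hA, .inl ⟨hy, by simp⟩⟩
  · obtain ⟨T', B', hT, hB, h⟩ := h hz
    refine ⟨T', B', hT, hB, h.imp (fun h => ⟨h.1, by simp [h.2]⟩) fun h => ⟨h.1, h.2.1, ?_⟩⟩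
    exact h.2.2.weaken (List.subset_cons_self _ _)

theorem SubstMap.single {Δ S A} (hΔ : Δ.Lc) (hx : x₀ ∉ Δ.fv) (hS : S.LcAt 0) (hxS : x₀ ∉ S.fv)
    (hA : A.LcAt 0) (hxA : x₀ ∉ A.fv) (hc : S.Compat α₀) (h : Check Sg Δ N₀ S) :
    SubstMap Sg N₀ x₀ α₀ ((x₀, S, A) :: Δ) Δ := by
  intro y T B hy
  rcases List.mem_cons.1 hy with e | hy
  · cases e
    exact ⟨S, A, .of_notMem _ _ hS hxS, .of_notMem _ _ hA hxA, .inr ⟨rfl, hc, h⟩⟩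
  · have := Ctx.mem_fv hy
    exact ⟨T, B, .of_notMem _ _ (hΔ hy).1 fun h => hx (this.2.1 h),
      .of_notMem _ _ (hΔ hy).2 fun h => hx (this.2.2 h),
      .inl ⟨ne_of_mem_of_notMem this.1 hx, hy⟩⟩

theorem Subsort.trans {Q₁ Q₂ Q₃} (h : Subsort Sg Q₁ Q₂) (h' : Subsort Sg Q₂ Q₃) :
    Subsort Sg Q₁ Q₃ := by
  induction h with
  | refl => exact h'
  | step h _ ih => exact .step h (ih h')

theorem SubDecl.subst {Q₁ Q₂ Q₁' Q₂'} (h : SubDecl Sg Q₁ Q₂) (h₁ : SubstQ N₀ x₀ α₀ Q₁ Q₁')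
    (h₂ : SubstQ N₀ x₀ α₀ Q₂ Q₂') : SubDecl Sg Q₁' Q₂' := by
  induction h generalizing Q₁' Q₂' with
  | con h => cases h₁; cases h₂; exact .con h
  | app _ ih =>
    cases h₁ with
    | app h₁ h₁' =>
      cases h₂ with
      | app h₂ h₂' => rw [h₁'.det h₂']; exact .app (ih h₁ h₂)

/-- Both sides share their spine, so substitution is defined on one if it is defined on the other.
This supplies the intermediate sorts in a subsorting chain. -/
theorem SubDecl.exists_subst {Q₁ Q₂ Q₁'} (h : SubDecl Sg Q₁ Q₂) (h₁ : SubstQ N₀ x₀ α₀ Q₁ Q₁') :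
    ∃ Q₂', SubstQ N₀ x₀ α₀ Q₂ Q₂' := by
  induction h generalizing Q₁' with
  | con h => exact ⟨_, .con⟩
  | app _ ih =>
    cases h₁ with
    | app h₁ h₁' =>
      obtain ⟨_, h⟩ := ih h₁
      exact ⟨_, .app h h₁'⟩

theorem Subsort.subst {Q₁ Q₂ Q₁' Q₂'} (h : Subsort Sg Q₁ Q₂) (h₁ : SubstQ N₀ x₀ α₀ Q₁ Q₁')
    (h₂ : SubstQ N₀ x₀ α₀ Q₂ Q₂') : Subsort Sg Q₁' Q₂' := by
  induction h generalizing Q₁' with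
  | refl => rw [h₁.det h₂]; exact .refl
  | step h _ ih =>
    obtain ⟨_, hr⟩ := h.exists_subst h₁
    exact .step (h.subst h₁ hr) (ih hr h₂)

/-- The substitution property of `Γ ⊢ N ⇐ S` at the simple type `α`. -/
def CheckSubst (Sg : Sig) (α : STy) : Prop :=
  ∀ ⦃N₀ x₀ Γ Δ N N' S S'⦄, N₀.LcAt 0 → Ctx.Lc Δ → SubstMap Sg N₀ x₀ α Γ Δ →
    Check Sg Γ N S → SubstN N₀ x₀ α N N' → SubstS N₀ x₀ α S S' → Check Sg Δ N' S'

mutual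
-- The substituted term is given, since sorting cannot provide it. A sort does not determine its
-- type, so `S.Compat β` takes the place of the equation between `β` and an erasure.
theorem Synth.subst_aux (hSg : Sg.Closed) (h₀ : N₀.LcAt 0)
    (ih : ∀ β : STy, β.size < α₀.size → CheckSubst Sg β) : ∀ {Γ Δ R S},
    Δ.Lc → SubstMap Sg N₀ x₀ α₀ Γ Δ → Synth Sg Γ R S →
    (∀ R', SubstRR N₀ x₀ α₀ R R' → ∃ S', SubstS N₀ x₀ α₀ S S' ∧ Synth Sg Δ R' S') ∧
    (∀ N' β, SubstRN N₀ x₀ α₀ R N' β →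
      ∃ S', SubstS N₀ x₀ α₀ S S' ∧ S.Compat β ∧ Check Sg Δ N' S')
  | _, _, _, _, _, _, .con h => by
      have hS := hSg.tmSort h
      refine ⟨fun R' hR => ?_, fun N' β hR => by cases hR⟩
      cases hR
      exact ⟨_, .of_notMem _ _ hS.1 (by simp [hS.2]), .con h⟩
  | _, _, _, _, _, hm, .var h => by
      obtain ⟨S', A', hS, -, h⟩ := hm h
      refine ⟨fun R' hR => ?_, fun N' β hR => ?_⟩
      · cases hR with
        | var hne => exact ⟨S', hS, .var (h.resolve_right fun h => hne h.1).2⟩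
      · cases hR
        exact ⟨S', hS, (h.resolve_left fun h => h.1 rfl).2⟩
  | _, Δ, _, _, hΔ, hm, @Synth.app _ _ R N S A T Tr F h₁ h₂ h₃ => by
      have ⟨hrr, hrn⟩ := Synth.subst_aux hSg h₀ ih hΔ hm h₁
      refine ⟨fun R' hR => ?_, fun N' β hR => ?_⟩
      · cases hR with
        | app hR hN =>
          obtain ⟨_, hpi, hR'⟩ := hrr _ hR
          cases hpi with
          | pi F' hS hA hT =>
            obtain ⟨M, hM, hM'⟩ := substS_inst h₀ hN h₃ hT
            rw [← hA.simple_eq] at hM'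
            exact ⟨M, hM, .app _ hR' (Check.subst_aux hSg h₀ ih hΔ hm h₂ hN hS) hM'⟩
      · cases hR with
        | beta F₁ hR hN hβ =>
          have hsize := hR.size_le
          simp only [STy.size] at hsize
          obtain ⟨_, hpi, hc, hR'⟩ := hrn _ _ hR
          cases hpi with
          | @pi _ S' _ A' _ T' F' hS hA hT =>
            -- Compatibility identifies the domain of the β step with `A.simple`: term and sort are
            -- substituted into at the same simple type.
            obtain ⟨rfl, hcS, hcT⟩ := hc
            obtain ⟨M, hM, hM'⟩ := substS_inst h₀ hN h₃ hT
            have hN' := Check.subst_aux hSg h₀ ih hΔ hm h₂ hN hS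
            have hTr : Tr.Compat β := by
              obtain ⟨z, hz⟩ := exists_fresh F
              exact (h₃ z hz).compat (Srt.compat_opn.2 hcT)
            refine ⟨M, hM, hTr, ?_⟩
            cases hR' with
            | lam F₂ hR' =>
              obtain ⟨z, hz₁, hz₂, hz₃, hz₄⟩ := exists_fresh₄ (F ∪ F' ∪ N₀.fv ∪ {x₀}) F₁ F₂
                (Δ.fv ∪ S'.fv ∪ A'.fv)
              simp only [Finset.mem_union, not_or] at hz₄
              exact ih A.simple (by omega) (hN.lc_output h₀) hΔ
                (.single hΔ hz₄.1.1 (hS.lc_output h₀) hz₄.1.2 (hA.lc_output h₀) hz₄.2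
                  (hS.compat hcS) hN')
                (hR' z hz₃) (hβ z hz₂) (hM' z hz₁)
  | _, _, _, _, hΔ, hm, .interL h => by
      have ⟨hrr, hrn⟩ := Synth.subst_aux hSg h₀ ih hΔ hm h
      refine ⟨fun R' hR => ?_, fun N' β hR => ?_⟩
      · obtain ⟨_, hS, h⟩ := hrr _ hR
        cases hS with | inter hS _ => exact ⟨_, hS, .interL h⟩
      · obtain ⟨_, hS, hc, h⟩ := hrn _ _ hR
        cases hS with
        | inter hS _ => cases h with | inter h _ => exact ⟨_, hS, hc.1, h⟩
  | _, _, _, _, hΔ, hm, .interR h => by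
      have ⟨hrr, hrn⟩ := Synth.subst_aux hSg h₀ ih hΔ hm h
      refine ⟨fun R' hR => ?_, fun N' β hR => ?_⟩
      · obtain ⟨_, hS, h⟩ := hrr _ hR
        cases hS with | inter _ hS => exact ⟨_, hS, .interR h⟩
      · obtain ⟨_, hS, hc, h⟩ := hrn _ _ hR
        cases hS with
        | inter _ hS => cases h with | inter _ h => exact ⟨_, hS, hc.2, h⟩
theorem Check.subst_aux (hSg : Sg.Closed) (h₀ : N₀.LcAt 0)
    (ih : ∀ β : STy, β.size < α₀.size → CheckSubst Sg β) : ∀ {Γ Δ N N' S S'},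
    Δ.Lc → SubstMap Sg N₀ x₀ α₀ Γ Δ → Check Sg Γ N S →
    SubstN N₀ x₀ α₀ N N' → SubstS N₀ x₀ α₀ S S' → Check Sg Δ N' S'
  | _, _, _, _, _, _, hΔ, hm, .switch h hle, hN, hS => by
      have ⟨hrr, hrn⟩ := Synth.subst_aux hSg h₀ ih hΔ hm h
      cases hS with
      | atm hQ =>
        cases hN with
        | atom hR =>
          obtain ⟨_, hS, h⟩ := hrr _ hR
          cases hS with | atm hS => exact .switch h (hle.subst hS hQ)
        | atomNorm hR =>
          obtain ⟨_, hS, -, h⟩ := hrn _ _ hR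
          cases hS with
          | atm hS =>
            -- Only `switch` checks against an atomic sort; the subsorting it contains is composed
            -- with the original one.
            cases h with
            | switch h hle' => exact .switch h (hle'.trans (hle.subst hS hQ))
  | _, _, _, _, _, _, hΔ, hm, .lam F h, hN, hS => by
      cases hS with
      | pi F₁ hS hA hT =>
        cases hN with
        | lam F₂ hN =>
          refine .lam (F ∪ F₁ ∪ F₂ ∪ {x₀}) fun y hy => ?_
          simp only [Finset.mem_union, Finset.mem_singleton, not_or] at hy
          obtain ⟨⟨⟨hy, hy₁⟩, hy₂⟩, hyx⟩ := hy
          exact Check.subst_aux hSg h₀ ih (hΔ.cons (hS.lc_output h₀) (hA.lc_output h₀))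
            (hm.cons hyx hS hA) (h y hy) (hN y hy₂) (hT y hy₁)
  | _, _, _, _, _, _, _, _, .top, _, hS => by cases hS; exact .top
  | _, _, _, _, _, _, hΔ, hm, .inter h₁ h₂, hN, hS => by
      cases hS with
      | inter hS₁ hS₂ =>
        exact .inter (Check.subst_aux hSg h₀ ih hΔ hm h₁ hN hS₁)
          (Check.subst_aux hSg h₀ ih hΔ hm h₂ hN hS₂)
end

theorem checkSubst (hSg : Sg.Closed) (α : STy) : CheckSubst Sg α := by
  induction hn : α.size using Nat.strong_induction_on generalizing α with
  | _ n ih =>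
    subst hn
    intro N₀ x₀ Γ Δ N N' S S' h₀ hΔ hm h hN hS
    exact h.subst_aux hSg h₀ (fun β hβ => ih _ hβ β rfl) hΔ hm hN hS

/-- `Q` and `P` carry the same arguments, so definedness on `P` gives definedness on `Q`. -/
theorem SynthCls.subst (hSg : Sg.Closed) (h₀ : N₀.LcAt 0) {Γ Δ Q P P' L} (hΔ : Δ.Lc)
    (hm : SubstMap Sg N₀ x₀ α₀ Γ Δ) (h : SynthCls Sg Γ Q P L) (hP : SubstP N₀ x₀ α₀ P P') :
    ∃ Q' L', SubstQ N₀ x₀ α₀ Q Q' ∧ SubstL N₀ x₀ α₀ L L' ∧ SynthCls Sg Δ Q' P' L' := by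
  induction h generalizing P' with
  | con h =>
    have hL := hSg.srtRef h
    cases hP
    exact ⟨_, _, .con, .of_notMem _ _ hL.1 (by simp [hL.2]), .con h⟩
  | app F _ h₂ h₃ ih =>
    cases hP with
    | app hP hN =>
      obtain ⟨Q', _, hQ, hpi, hQ'⟩ := ih hP
      cases hpi with
      | pi F' hS hA hL =>
        obtain ⟨M, hM, hM'⟩ := substL_inst h₀ hN h₃ hL
        rw [← hA.simple_eq] at hM'
        exact ⟨_, M, .app hQ hN, hM, .app _ hQ' (checkSubst hSg α₀ h₀ hΔ hm h₂ hN hS) hM'⟩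
  | interL _ ih =>
    obtain ⟨Q', _, hQ, hL, h⟩ := ih hP
    cases hL with | inter hL _ => exact ⟨_, _, hQ, hL, .interL h⟩
  | interR _ ih =>
    obtain ⟨Q', _, hQ, hL, h⟩ := ih hP
    cases hL with | inter _ hL => exact ⟨_, _, hQ, hL, .interR h⟩

theorem Refines.subst (hSg : Sg.Closed) (h₀ : N₀.LcAt 0) {Γ Δ S A A'} (hΔ : Δ.Lc)
    (hm : SubstMap Sg N₀ x₀ α₀ Γ Δ) (h : Refines Sg Γ S A) (hA : SubstA N₀ x₀ α₀ A A') :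
    ∃ S', SubstS N₀ x₀ α₀ S S' ∧ Refines Sg Δ S' A' := by
  induction h generalizing Δ A' with
  | atm h =>
    cases hA with
    | atm hP =>
      obtain ⟨_, _, hQ, hL, h⟩ := h.subst hSg h₀ hΔ hm hP
      cases hL
      exact ⟨_, .atm hQ, .atm h⟩
  | @pi _ S A T B F _ _ ihS ihT =>
    cases hA with
    | @pi _ A' _ B' F' hA hB =>
      obtain ⟨S', hS, hS'⟩ := ihS hΔ hm hA
      have key : ∀ y, y ∉ F ∪ F' ∪ {x₀} → ∃ T', SubstS N₀ x₀ α₀ (T.opn 0 y) T' ∧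
          Refines Sg ((y, S', A') :: Δ) T' (B'.opn 0 y) := by
        intro y hy
        simp only [Finset.mem_union, Finset.mem_singleton, not_or] at hy
        exact ihT y hy.1.1 (hΔ.cons (hS.lc_output h₀) (hA.lc_output h₀)) (hm.cons hy.2 hS hA)
          (hB y hy.1.2)
      obtain ⟨T', hs, F₁, hT⟩ := SubstS.exists_pi h₀ hS hA key
      exact ⟨_, hs, .pi F₁ hS' hT⟩
  | top => exact ⟨_, .top, .top⟩
  | inter _ _ ih₁ ih₂ =>
    obtain ⟨_, h₁, h₁'⟩ := ih₁ hΔ hm hA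
    obtain ⟨_, h₂, h₂'⟩ := ih₂ hΔ hm hA
    exact ⟨_, .inter h₁ h₂, .inter h₁' h₂'⟩

end

/-! ## η-expansion preserves types and sorts -/

section
variable {Sg : Sig}

/-- The substitution is defined because `η(x)` is well-typed, and its value is then forced by the
renaming property. Thus applying a function to `η(x)` yields the codomain opened at `x`. -/
theorem IsType.substA_expand (hSg : Sg.Closed) {Γ A B x} (hΓ : Γ.Lc)
    (h : IsType Sg Γ (.pi A B)) (hx : CheckTy Sg ((x, A) :: Γ) (expand A.simple (.fvar x)) A) :
    ∃ F : Finset Var, ∀ z, z ∉ F →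
      SubstA (expand A.simple (.fvar x)) z A.simple (B.opn 0 z) (B.opn 0 x) := by
  cases h with
  | pi F hA hB =>
    refine ⟨F ∪ LFCtx.fv ((x, A) :: Γ) ∪ A.fv ∪ B.fv, fun z hz => ?_⟩
    simp only [Finset.mem_union, not_or] at hz
    obtain ⟨⟨⟨hzF, hzΓ⟩, hzA⟩, hzB⟩ := hz
    have hΔ := hΓ.cons (x := x) hA.scoped.1
    have hB' := (hB z hzF).weaken (List.cons_subset_cons _ (List.subset_cons_self (x, A) Γ))
    obtain ⟨B', hs, -⟩ := hB'.subst hSg (lcAt_expand_fvar) hΔ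
      (.single hΔ hzΓ hA.scoped.1 hzA hx)
    rwa [hs.eq_opn hzB] at hs

theorem SynthTy.expand (hSg : Sg.Closed) : ∀ {A Γ R}, Γ.Lc → IsType Sg Γ A → SynthTy Sg Γ R A →
    CheckTy Sg Γ (expand A.simple R) A
  | .atm P, _, _, _, _, h => by
      obtain ⟨a, ha⟩ := P.exists_simple_eq
      rw [Ty.simple, ha]
      exact .atm h
  | .pi A B, Γ, R, hΓ, hpi, h => by
      have hpi' := hpi
      cases hpi' with
      | pi F hA hB =>
        refine .lam F fun x hx => ?_
        rw [expand_body_opn h.scoped.1]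
        have hs : Γ ⊆ (x, A) :: Γ := List.subset_cons_self _ _
        have hΔ := hΓ.cons (x := x) hA.scoped.1
        have hη := SynthTy.expand hSg hΔ (hA.weaken hs) (.var List.mem_cons_self)
        obtain ⟨F', hF'⟩ := hpi.substA_expand hSg hΓ hη
        have := SynthTy.expand hSg hΔ (hB x hx) (.app F' (h.weaken hs) hη hF')
        rwa [Ty.simple_opn] at this
termination_by A => A.size
decreasing_by all_goals (simp [Ty.size]; try omega)

theorem Ctx.Lc.erase {Γ : Ctx} (h : Γ.Lc) : Γ.erase.Lc := by
  intro x A hx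
  obtain ⟨⟨y, S, B⟩, hm, e⟩ := List.mem_map.1 hx
  cases e
  exact (h hm).2

/-- At an intersection both projections apply to the same expansion, as it depends on `A` alone. At
a function sort the bound variable is expanded first, by recursion on the domain, so that it can
serve as an argument. -/
theorem Synth.expand (hSg : Sg.Closed) : ∀ {S Γ R A}, Γ.Lc → IsType Sg Γ.erase A →
    Refines Sg Γ S A → R.LcAt 0 → Synth Sg Γ R S → Check Sg Γ (expand A.simple R) S
  | .atm Q, _, _, _, _, _, hr, _, h => by
      cases hr with
      | @atm _ _ P hr =>
        obtain ⟨a, ha⟩ := P.exists_simple_eq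
        rw [Ty.simple, ha]
        exact .switch h .refl
  | .top, _, _, _, _, _, _, _, _ => .top
  | .inter S₁ S₂, _, _, _, hΓ, hA, hr, hR, h => by
      cases hr with
      | inter hr₁ hr₂ =>
        exact .inter (Synth.expand hSg hΓ hA hr₁ hR (.interL h))
          (Synth.expand hSg hΓ hA hr₂ hR (.interR h))
  | .pi S A T, Γ, R, _, hΓ, hpi, hr, hR, h => by
      cases hr with
      | @pi _ _ _ _ B F hS hT =>
        have hpi' := hpi
        cases hpi' with
        | pi F' hA hB =>
          refine .lam (F ∪ F') fun x hx => ?_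
          rw [Finset.notMem_union] at hx
          rw [expand_body_opn hR]
          have hs : Γ ⊆ (x, S, A) :: Γ := List.subset_cons_self _ _
          have hs' : Γ.erase ⊆ (x, A) :: Γ.erase := List.subset_cons_self _ _
          have hAl := hA.scoped.1
          have hSl := hS.scoped.1 hAl
          have hΔ := hΓ.cons (x := x) hSl hAl
          have hηA := SynthTy.expand hSg hΔ.erase (hA.weaken hs') (.var List.mem_cons_self)
          have hη := Synth.expand hSg hΔ (hA.weaken hs') (hS.weaken hs) (by exact trivial)
            (.var List.mem_cons_self)
          obtain ⟨F₁, hF₁⟩ := hpi.substA_expand hSg hΓ.erase hηA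
          have happ : Synth Sg ((x, S, A) :: Γ) (.app R (LFR.expand A.simple (.fvar x)))
              (T.opn 0 x) := by
            refine .app (F ∪ F₁ ∪ Ctx.fv ((x, S, A) :: Γ) ∪ S.fv ∪ A.fv ∪ T.fv)
              (h.weaken hs) hη fun z hz => ?_
            simp only [Finset.mem_union, not_or] at hz
            obtain ⟨⟨⟨⟨⟨hzF, hzF₁⟩, hzΓ⟩, hzS⟩, hzA⟩, hzT⟩ := hz
            have hT' := (hT z hzF).weaken
              (List.cons_subset_cons _ (List.subset_cons_self (x, S, A) Γ))
            obtain ⟨T', hs, -⟩ := hT'.subst hSg (lcAt_expand_fvar) hΔ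
              (.single hΔ hzΓ hSl hzS hAl hzA hS.compat hη) (hF₁ z hzF₁)
            rwa [hs.eq_opn hzT] at hs
          have := Synth.expand hSg hΔ (hB x hx.2) (hT x hx.1)
            (by exact ⟨hR, lcAt_expand_fvar⟩) happ
          rwa [Ty.simple_opn] at this
termination_by S => S.size
decreasing_by all_goals (simp [Srt.size]; try omega)

/-! ## Well-formed contexts -/

theorem WfCtx.refinesTy {Γ : Ctx} (h : WfCtx Sg Γ) {x S A} (hx : (x, S, A) ∈ Γ) :
    RefinesTy Sg Γ S A := by
  induction h with
  | nil => simp at hx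
  | cons _ _ hr ih =>
    rcases List.mem_cons.1 hx with e | hx
    · cases e; exact hr.weaken (List.subset_cons_self _ _)
    · exact (ih hx).weaken (List.subset_cons_self _ _)

theorem WfCtx.lc {Γ : Ctx} (h : WfCtx Sg Γ) : Γ.Lc := fun _ _ _ hx =>
  (h.refinesTy hx).scoped.1.symm

theorem SynthAt.expand (hSg : Sg.Closed) {Γ R S A} (h : SynthAt Sg Γ R S A) :
    CheckAt Sg Γ (expand A.simple R) S A where
  ctx := h.ctx
  refines := h.refines
  typed := h.typed.expand hSg h.ctx.lc.erase h.refines.1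
  sorted := h.sorted.expand hSg h.ctx.lc h.refines.1 h.refines.2 h.typed.scoped.1

theorem SynthAt.fvar {Γ x S A} (h : WfCtx Sg Γ) (hx : x ∉ Γ.dom) (hr : RefinesTy Sg Γ S A) :
    SynthAt Sg ((x, S, A) :: Γ) (.fvar x) S A where
  ctx := h.cons hx hr
  refines := hr.weaken (List.subset_cons_self _ _)
  typed := .var List.mem_cons_self
  sorted := .var List.mem_cons_self

theorem BothRefine.cons_left {Γ x S₁ S₂ A} (h : BothRefine Sg Γ S₁ S₂ A) (hx : x ∉ Γ.dom) :
    BothRefine Sg ((x, S₁, A) :: Γ) S₁ S₂ A where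
  ctx := h.ctx.cons hx h.left
  left := h.left.weaken (List.subset_cons_self _ _)
  right := h.right.weaken (List.subset_cons_self _ _)

/-! ## The substitution theorem -/

theorem RefinesTy.subst_of_notMem {Γ S A} (h : RefinesTy Sg Γ S A) {x} (hx : x ∉ Γ.dom) (N α) :
    SubstS N x α S S ∧ SubstA N x α A A :=
  ⟨.of_notMem _ _ h.scoped.1.2 fun hm => hx (h.scoped.2 x (.inr hm)),
    .of_notMem _ _ h.scoped.1.1 fun hm => hx (h.scoped.2 x (.inl hm))⟩

/-- Substitution of `N₁` for the head variable of a context, into a context extending its tail. -/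
theorem SubstMap.head {ΓL Δ : Ctx} {x S A N₁} (hL : WfCtx Sg ΓL) (hx : x ∉ ΓL.dom)
    (hr : RefinesTy Sg ΓL S A) (hs : ΓL ⊆ Δ) (hN₁ : CheckAt Sg Δ N₁ S A) :
    LFSubstMap Sg N₁ x A.simple (Ctx.erase ((x, S, A) :: ΓL)) Δ.erase ∧
      SubstMap Sg N₁ x A.simple ((x, S, A) :: ΓL) Δ := by
  have vac {T B} (h : RefinesTy Sg ΓL T B) := h.subst_of_notMem hx N₁ A.simple
  have ne {y T B} (hy : (y, T, B) ∈ ΓL) : y ≠ x := by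
    rintro rfl
    exact hx (List.mem_map.2 ⟨_, hy, rfl⟩)
  constructor
  · intro y B hy
    obtain ⟨⟨y, T, B⟩, hm, e⟩ := List.mem_map.1 hy
    cases e
    rcases List.mem_cons.1 hm with e | hm
    · cases e
      exact ⟨A, (vac hr).2, .inr ⟨rfl, rfl, hN₁.typed⟩⟩
    · exact ⟨B, (vac (hL.refinesTy hm)).2,
        .inl ⟨ne hm, List.mem_map.2 ⟨(y, T, B), hs hm, rfl⟩⟩⟩
  · intro y T B hm
    rcases List.mem_cons.1 hm with e | hm
    · cases e
      exact ⟨S, A, (vac hr).1, (vac hr).2, .inr ⟨rfl, hr.2.compat, hN₁.sorted⟩⟩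
    · exact ⟨T, B, (vac (hL.refinesTy hm)).1, (vac (hL.refinesTy hm)).2, .inl ⟨ne hm, hs hm⟩⟩

theorem RefinesTy.subst (hSg : Sg.Closed) {N₀ x₀ α₀} (h₀ : N₀.LcAt 0) {Γ Δ S A} (hΔ : Δ.Lc)
    (hm : LFSubstMap Sg N₀ x₀ α₀ Γ.erase Δ.erase) (hm' : SubstMap Sg N₀ x₀ α₀ Γ Δ)
    (h : RefinesTy Sg Γ S A) :
    ∃ S' A', SubstS N₀ x₀ α₀ S S' ∧ SubstA N₀ x₀ α₀ A A' ∧ RefinesTy Sg Δ S' A' := by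
  obtain ⟨A', hA, hA'⟩ := h.1.subst hSg h₀ hΔ.erase hm
  obtain ⟨S', hS, hS'⟩ := h.2.subst hSg h₀ hΔ hm' hA
  exact ⟨S', A', hS, hA, hA', hS'⟩

/-- Beyond the names of `ΓL`, `Δ` may declare only `x`, which `ΓR` already avoids; so the names of
`ΓR` remain distinct from those of `Δ`. -/
theorem WfCtx.subst (hSg : Sg.Closed) {N₁ x S A} {ΓL Δ : Ctx} (hs : ΓL ⊆ Δ)
    (hd : Δ.dom ⊆ x :: ΓL.dom) (hN₁ : CheckAt Sg Δ N₁ S A) : ∀ {ΓR : Ctx},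
    WfCtx Sg (ΓR ++ (x, S, A) :: ΓL) →
    ∃ ΓR', SubstCtx N₁ x A.simple ΓR ΓR' ∧ ΓR'.dom = ΓR.dom ∧ WfCtx Sg (ΓR' ++ Δ) ∧
      LFSubstMap Sg N₁ x A.simple (Ctx.erase (ΓR ++ (x, S, A) :: ΓL)) (Ctx.erase (ΓR' ++ Δ)) ∧
      SubstMap Sg N₁ x A.simple (ΓR ++ (x, S, A) :: ΓL) (ΓR' ++ Δ)
  | [], h => by
      cases h with
      | cons hL hx hr => exact ⟨[], .nil, rfl, hN₁.ctx, SubstMap.head hL hx hr hs hN₁⟩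
  | (y, T, B) :: ΓR, h => by
      cases h with
      | cons h hy hr =>
        obtain ⟨ΓR', hc, hdom, hwf, hm, hm'⟩ := WfCtx.subst hSg hs hd hN₁ h
        obtain ⟨T', B', hT, hB, hr'⟩ := hr.subst hSg hN₁.typed.scoped.1 hwf.lc hm hm'
        have hy : y ∉ Ctx.dom (ΓR ++ (x, S, A) :: ΓL) := hy
        have hy' : y ≠ x ∧ y ∉ Ctx.dom (ΓR' ++ Δ) := by
          simp only [Ctx.dom, List.map_append, List.mem_append, List.map_cons, List.mem_cons,
            not_or] at hy hdom hd ⊢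
          rw [hdom]
          refine ⟨hy.2.1, hy.1, fun hm => ?_⟩
          rcases List.mem_cons.1 (hd hm) with e | e
          · exact hy.2.1 e
          · exact hy.2.2 e
        exact ⟨(y, T', B') :: ΓR', .cons hc hT hB, by simpa [Ctx.dom] using hdom,
          hwf.cons hy'.2 hr', hm.cons hy'.1 hB, hm'.cons hy'.1 hT hB⟩

/-- The substitution theorem.  The target context `Δ` may redeclare `x`, so that substitution of
`η_A(x)` for `x` itself is an instance. -/
theorem CheckAt.subst (hSg : Sg.Closed) {N₁ x S A} {ΓL ΓR Δ : Ctx} (hs : ΓL ⊆ Δ)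
    (hd : Δ.dom ⊆ x :: ΓL.dom) (hN₁ : CheckAt Sg Δ N₁ S A) {N T B}
    (h : CheckAt Sg (ΓR ++ (x, S, A) :: ΓL) N T B) :
    ∃ (ΓR' : Ctx) (N' : Nrm) (T' : Srt) (B' : Ty),
      SubstCtx N₁ x A.simple ΓR ΓR' ∧ SubstN N₁ x A.simple N N' ∧
      SubstS N₁ x A.simple T T' ∧ SubstA N₁ x A.simple B B' ∧
      CheckAt Sg (ΓR' ++ Δ) N' T' B' := by
  obtain ⟨ΓR', hc, -, hwf, hm, hm'⟩ := h.ctx.subst hSg hs hd hN₁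
  have h₀ := hN₁.typed.scoped.1
  obtain ⟨T', B', hT, hB, hr⟩ := h.refines.subst hSg h₀ hwf.lc hm hm'
  obtain ⟨N', hN, hN'⟩ := checkTySubst hSg _ h₀ hwf.lc.erase hm h.typed hB
  exact ⟨ΓR', N', T', B', hc, hN, hT, hB, hwf, hr, hN',
    checkSubst hSg _ h₀ hwf.lc hm' h.sorted hN hT⟩

theorem SubstCtx.eq_of_self {α x Γ Γ'} (h : SubstCtx (expand α (.fvar x)) x α Γ Γ') : Γ' = Γ := by
  induction h with
  | nil => rfl
  | cons _ hS hA ih => rw [ih, hS.eq_of_self, hA.eq_of_self]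

theorem Ctx.exists_notMem_dom (Γ : Ctx) : ∃ x, x ∉ Γ.dom := by
  obtain ⟨x, hx⟩ := exists_fresh Γ.dom.toFinset
  exact ⟨x, by simpa using hx⟩

/-! ## The formulations of subsorting -/

section
variable {A : Ty} {S₁ S₂ : Srt}

theorem SubExpansion.subIdentity (h : SubExpansion Sg A S₁ S₂) : SubIdentity Sg A S₁ S₂ :=
  fun _ _ hb hx => h _ _ (hb.cons_left hx) (.fvar hb.ctx hx hb.left)

theorem SubIdentity.subSubsumption (hSg : Sg.Closed) (h : SubIdentity Sg A S₁ S₂) :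
    SubSubsumption Sg A S₁ S₂ := by
  intro Γ N hb hN
  obtain ⟨x, hx⟩ := Γ.exists_notMem_dom
  obtain ⟨_, N', S', B', hc, hs, hS, hB, hN'⟩ :=
    CheckAt.subst hSg (ΓR := []) (List.Subset.refl Γ) (List.subset_cons_self x _) hN (h Γ x hb hx)
  cases hc
  have hv := hb.right.subst_of_notMem hx N A.simple
  -- The substituted term is `N` itself, and `S₂` and `A` are unchanged because `x` was chosen
  -- outside `Γ`.
  cases hs.eq_of_expand_fvar
  cases hS.det hv.1
  cases hB.det hv.2
  exact hN'

theorem SubSubsumption.subExpansion (hSg : Sg.Closed) (h : SubSubsumption Sg A S₁ S₂) :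
    SubExpansion Sg A S₁ S₂ :=
  fun _ _ hb hR => h _ _ hb (hR.expand hSg)

theorem SubSubsumption.subSubstitution (hSg : Sg.Closed) (h : SubSubsumption Sg A S₁ S₂) :
    SubSubstitution Sg A S₁ S₂ :=
  fun ΓL _ x _ _ _ _ hb hN hN₁ =>
    CheckAt.subst hSg (List.Subset.refl ΓL) (List.subset_cons_self x _) (h _ _ hb hN₁) hN

/-- The instance is `η(x)` with `x` of sort `S₂`: substituting `N` into it returns `N`. -/
theorem SubSubstitution.subSubsumption (hSg : Sg.Closed) (h : SubSubstitution Sg A S₁ S₂) :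
    SubSubsumption Sg A S₁ S₂ := by
  intro Γ N hb hN
  obtain ⟨x, hx⟩ := Γ.exists_notMem_dom
  obtain ⟨_, N', S', B', hc, hs, hS, hB, hN'⟩ := h Γ [] x _ _ _ N hb
    ((SynthAt.fvar hb.ctx hx hb.right).expand hSg) hN
  cases hc
  have hv := hb.right.subst_of_notMem hx N A.simple
  cases hs.eq_of_expand_fvar
  cases hS.det hv.1
  cases hB.det hv.2
  exact hN'

theorem WfCtx.notMem_dom_of_append {x S} {ΓL ΓR : Ctx}
    (h : WfCtx Sg (ΓR ++ (x, S, A) :: ΓL)) : x ∉ ΓL.dom := by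
  induction ΓR with
  | nil => cases h with | cons _ hx _ => exact hx
  | cons _ _ ih => cases h with | cons h _ _ => exact ih h

theorem SubSubsumption.subNarrowing (hSg : Sg.Closed) (h : SubSubsumption Sg A S₁ S₂) :
    SubNarrowing Sg A S₁ S₂ := by
  intro ΓL ΓR x N S B hb hN
  have hx := hN.ctx.notMem_dom_of_append
  have hη := h _ _ (hb.cons_left hx) ((SynthAt.fvar hb.ctx hx hb.left).expand hSg)
  -- The target context is `ΓL` with `x` redeclared at `S₁`. Substituting `η(x)` for `x` is the
  -- identity on everything, so only the declaration of `x` changes.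
  obtain ⟨ΓR', N', S', B', hc, hs, hS, hB, hN'⟩ :=
    CheckAt.subst hSg (List.subset_cons_self _ _) (List.Subset.refl _) hη hN
  cases hc.eq_of_self
  cases hs.eq_of_self
  cases hS.eq_of_self
  cases hB.eq_of_self
  exact hN'

theorem SubNarrowing.subIdentity (hSg : Sg.Closed) (h : SubNarrowing Sg A S₁ S₂) :
    SubIdentity Sg A S₁ S₂ :=
  fun Γ x hb hx => h Γ [] x _ _ _ hb ((SynthAt.fvar hb.ctx hx hb.right).expand hSg)

end

end

end LFR

theorem mainTheorem4 (Sg : LFR.Sig) (hSg : LFR.WfSig Sg)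
    (A : LFR.Ty) (S₁ S₂ : LFR.Srt)
    (h₀ : ∃ Γ₀ : LFR.Ctx, LFR.BothRefine Sg Γ₀ S₁ S₂ A) :
    List.TFAE [
      LFR.SubExpansion Sg A S₁ S₂,
      LFR.SubIdentity Sg A S₁ S₂,
      LFR.SubSubsumption Sg A S₁ S₂,
      LFR.SubNarrowing Sg A S₁ S₂,
      LFR.SubSubstitution Sg A S₁ S₂] := by
  have hc := hSg.closed
  tfae_have 1 → 2 := LFR.SubExpansion.subIdentity
  tfae_have 2 → 3 := LFR.SubIdentity.subSubsumption hc
  tfae_have 3 → 1 := LFR.SubSubsumption.subExpansion hc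
  tfae_have 3 → 4 := LFR.SubSubsumption.subNarrowing hc
  tfae_have 4 → 2 := LFR.SubNarrowing.subIdentity hc
  tfae_have 3 → 5 := LFR.SubSubsumption.subSubstitution hc
  tfae_have 5 → 3 := LFR.SubSubstitution.subSubsumption hc
  tfae_finish
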